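/- **Setting.** Let $G$ be a group. A $G$-bornological coarse space is a $G$-set with a compatible bornology and coarse structure, both $G$-invariant, such that the invariant coarse entourages are cofinal among all coarse entourages; morphisms are equivariant, controlled and proper maps. Let $\mathrm{Yo}^s: G\mathbf{BornCoarse}\to G\mathrm{Sp}\mathcal X$ be the universal equivariant coarse homology theory: $G\mathrm{Sp}\mathcal X$ is the stable $\infty$-category obtained by stabilizing the localization of presheaves of spaces on $G\mathbf{BornCoarse}$ which enforces vanishing on $\emptyset$, excision for invariant complementary pairs, invariance under coarse equivalences, vanishing on flasque spaces and $u$-continuity. A $G$-uniform bornological coarse space is a $G$-bornological coarse space with a uniform structure, in which the invariant uniform entourages are cofinal and in which some uniform entourage is also a coarse entourage. Subsets carry the induced structures; $\otimes$ has the product coarse and uniform structures and the product bornology, and $\mathbb R$ has its metric structures and the trivial action. For a $G$-uniform bornological coarse space $X$, let $\mathcal O(X)_-$ be $\mathbb R\otimes X$ with the hybrid coarse structure: its entourages are the entourages $E$ of $\mathbb R\otimes X$ such that for every uniform entourage $V$ there is $n\in\mathbb N$ with $E\subseteq ((-\infty,n]\times X)^2\cup V$. Let $\mathcal O(X)=[0,\infty)\times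 X\subseteq\mathcal O(X)_-$, and put $\mathcal O^\infty(X)=\mathrm{Cofib}(\mathrm{Yo}^s(X)\to\mathrm{Yo}^s(\mathcal O(X)))$, the map being induced by $x\mapsto(0,x)$. A decomposition $X=A\cup B$ into invariant subsets is *coarsely excisive* if for every coarse entourage $E$ there is a coarse entourage $F$ with $E[A]\cap E[B]\subseteq F[A\cap B]$. It is *uniformly excisive* if there are an invariant uniform entourage $V$ and a map $\sigma$ from invariant relations contained in $V$ to invariant relations such that $U[A]\cap U[B]\subseteq \sigma(U)[A\cap B]$ for all invariant $U\subseteq V$, and such that for every uniform entourage $U'$ there is an invariant uniform entourage $U\subseteq V$ with $\sigma(U)\subseteq U'$. **Assumptions.** Let $W_\infty$ be a $G$-uniform bornological coarse space with a coarsely and uniformly excisive decomposition $(M_\infty,W)$ into invariant subsets, and put $M=W\cap M_\infty$. Let $\phi:[0,\infty)\otimes M\to M_\infty$ be an isomorphism of $G$-uniform bornological coarse spaces with $\phi(0,m)=m$ for all $m\in M$, and assume that the inclusion $f:M\to W$ is a coarse equivalence. Let $$Y_-=(-\infty,0]\times W,\qquad Y_+=[0,\infty)\times W_\infty=\mathcal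 O(W_\infty),\qquad Y=Y_-\cup Y_+$$ be equipped with the structures induced from $\mathcal O(W_\infty)_-$. **Assertion.** (a) The functor $\mathrm{Yo}^s$ sends the squares of the decompositions $((-\infty,0]\times M,[0,\infty)\times M)$ of $\mathbb R\otimes M$, $(Y_-,Y_+)$ of $Y$ (with intersection $W$), $(\mathbb R\times W,[0,\infty)\times M_\infty)$ of $Y$ (with intersection $\mathcal O(M)$), and $([0,\infty)\times W,[0,\infty)\times M_\infty)$ of $\mathcal O(W_\infty)$ (with intersection $\mathcal O(M)$) to push-out squares. The Mayer–Vietoris boundary map $\mathrm{susp}:\mathrm{Yo}^s(\mathbb R\otimes M)\to\Sigma\mathrm{Yo}^s(M)$ of the first one is an equivalence. The motive $\mathrm{Yo}^s((-\infty,0]\times W_\infty)$ of the subspace of $\mathcal O(W_\infty)_-$ can be replaced by $0$, in the sense that the induced map from the push-out of $\mathrm{Yo}^s((-\infty,0]\times W_\infty)\leftarrow\mathrm{Yo}^s(W_\infty)\to\mathrm{Yo}^s(\mathcal O(W_\infty))$ to $\mathcal O^\infty(W_\infty)$ is an equivalence, and the resulting map $c:\mathcal O^\infty(W_\infty)\to\mathrm{Yo}^s(\mathcal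 O(W_\infty)_-)$ is an equivalence. Hence there are the following maps: * $s:\mathrm{Yo}^s(\mathcal O(W_\infty))\to\mathrm{Yo}^s(Y)$, induced by the inclusion $Y_+\to Y$; * $i:\mathrm{Yo}^s(Y)\to\mathcal O^\infty(W_\infty)$, the map induced by the inclusion $Y\to\mathcal O(W_\infty)_-$ followed by $c^{-1}$; * the Mayer–Vietoris boundary maps $\partial:\mathrm{Yo}^s(Y)\to\Sigma\mathrm{Yo}^s(W)$, $\partial':\mathrm{Yo}^s(Y)\to\Sigma\mathrm{Yo}^s(\mathcal O(M))$ and $\partial'':\mathrm{Yo}^s(\mathcal O(W_\infty))\to\Sigma\mathrm{Yo}^s(\mathcal O(M))$ of the last three squares; * $j:\Sigma\mathrm{Yo}^s(M)\to\mathrm{Yo}^s(Y)$, the composition of $\mathrm{susp}^{-1}$ with the map induced by the morphism $\tilde j:\mathbb R\otimes M\to Y$, $\tilde j(t,m)=(t,m)$ for $t\le 0$ and $\tilde j(t,m)=(0,\phi(t,m))$ for $t\ge 0$. (b) The canonical map $\mathrm{Yo}^s(\mathcal O(W_\infty))\to\mathcal O^\infty(W_\infty)$ and the map $\Sigma\mathrm{Yo}^s(f):\Sigma\mathrm{Yo}^s(M)\to\Sigma\mathrm{Yo}^s(W)$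 are equivalences. (c) The following diagram in $G\mathrm{Sp}\mathcal X$ commutes: $$\begin{array}{ccccc}\mathcal O^\infty(W_\infty)&&&&\\ {\scriptstyle\simeq}\uparrow&\nwarrow{\scriptstyle i}&&&\\ \mathrm{Yo}^s(\mathcal O(W_\infty))&\xrightarrow{\ s\ }&\mathrm{Yo}^s(Y)&\xrightarrow{\ \partial\ }&\Sigma\mathrm{Yo}^s(W)\\ {\scriptstyle\partial''}\downarrow&&{\scriptstyle\partial'}\downarrow&\nwarrow{\scriptstyle j}&\uparrow{\scriptstyle\simeq}\\ \Sigma\mathrm{Yo}^s(\mathcal O(M))&=&\Sigma\mathrm{Yo}^s(\mathcal O(M))&\longleftarrow&\Sigma\mathrm{Yo}^s(M)\end{array}$$ Here the lower right horizontal map is induced by the inclusion $M\to\mathcal O(M)$, $m\mapsto(0,m)$, and the right vertical map is $\Sigma\mathrm{Yo}^s(f)$. That is, $i\circ s$ is the canonical map $\mathrm{Yo}^s(\mathcal O(W_\infty))\to\mathcal O^\infty(W_\infty)$, $\partial'\circ s=\partial''$, $\partial\circ j=\Sigma\mathrm{Yo}^s(f)$ and $\partial'\circ j=\Sigma\mathrm{Yo}^s(M\to\mathcal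 O(M))$. (d) The map $s+j:\mathrm{Yo}^s(\mathcal O(W_\infty))\oplus\Sigma\mathrm{Yo}^s(M)\to\mathrm{Yo}^s(Y)$ is an equivalence. -/

import Mathlib

open CategoryTheory Limits Opposite MonoidalCategory Bornology Uniformity

universe u

namespace CoarseMotives

/-! ### Equivariant bornological coarse spaces -/

/-- The thickening `E[B]` of a subset `B` by a relation `E`. -/
def thickening {X : Type u} (E : Set (X × X)) (B : Set X) : Set X :=
  {x | ∃ b ∈ B, (x, b) ∈ E}

/-- Invariance of a relation under the diagonal action. -/
def IsInvariant (G : Type u) [Group G] {X : Type u} [MulAction G X] (E : Set (X × X)) : Prop :=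
  ∀ (g : G) (x y : X), (x, y) ∈ E → (g • x, g • y) ∈ E

/-- A `G`-bornological coarse space: a `G`-set with an invariant bornology and a coarse structure
in which the invariant entourages are cofinal, such that thickenings of bounded sets are
bounded. -/
structure BornCoarse (G : Type u) [Group G] : Type (u + 1) where
  carrier : Type u
  [mulAction : MulAction G carrier]
  [bornology : Bornology carrier]
  entourages : Set (Set (carrier × carrier))
  diag_mem : {p : carrier × carrier | p.1 = p.2} ∈ entourages
  subset_mem : ∀ ⦃E F : Set (carrier × carrier)⦄, E ∈ entourages → F ⊆ E → F ∈ entourages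
  union_mem : ∀ ⦃E F : Set (carrier × carrier)⦄, E ∈ entourages → F ∈ entourages →
    E ∪ F ∈ entourages
  inv_mem : ∀ ⦃E : Set (carrier × carrier)⦄, E ∈ entourages → {p | (p.2, p.1) ∈ E} ∈ entourages
  comp_mem : ∀ ⦃E F : Set (carrier × carrier)⦄, E ∈ entourages → F ∈ entourages →
    {p | ∃ y, (p.1, y) ∈ E ∧ (y, p.2) ∈ F} ∈ entourages
  exists_invariant : ∀ ⦃E : Set (carrier × carrier)⦄, E ∈ entourages →
    ∃ F ∈ entourages, E ⊆ F ∧ IsInvariant G F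
  isBounded_smul : ∀ (g : G) ⦃B : Set carrier⦄, IsBounded B → IsBounded ((fun x => g • x) '' B)
  isBounded_thickening : ∀ ⦃E : Set (carrier × carrier)⦄, E ∈ entourages →
    ∀ ⦃B : Set carrier⦄, IsBounded B → IsBounded (thickening E B)

attribute [instance] BornCoarse.mulAction BornCoarse.bornology

variable {G : Type u} [Group G]

namespace BornCoarse

/-- Morphisms of `G`-bornological coarse spaces: equivariant, controlled and proper maps. -/
@[ext]
structure Hom (X Y : BornCoarse G) : Type u where
  toFun : X.carrier → Y.carrier
  map_smul : ∀ (g : G) (x : X.carrier), toFun (g • x) = g • toFun x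
  controlled : ∀ ⦃E : Set (X.carrier × X.carrier)⦄, E ∈ X.entourages →
    (fun p : X.carrier × X.carrier => (toFun p.1, toFun p.2)) '' E ∈ Y.entourages
  proper : ∀ ⦃B : Set Y.carrier⦄, IsBounded B → IsBounded (toFun ⁻¹' B)

instance : Category.{u} (BornCoarse G) where
  Hom := Hom
  id X :=
    { toFun := id
      map_smul := fun _ _ => rfl
      controlled := fun E hE => by simpa using hE
      proper := fun B hB => hB }
  comp f g :=
    { toFun := g.toFun ∘ f.toFun
      map_smul := fun a x => by simp [f.map_smul, g.map_smul]
      controlled := fun E hE => by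
        have := g.controlled (f.controlled hE)
        rwa [Set.image_image] at this
      proper := fun B hB => f.proper (g.proper hB) }

/-- Two morphisms are close if `{(f x, g x)}` is an entourage. -/
def Close {X Y : BornCoarse G} (f g : X ⟶ Y) : Prop :=
  Set.range (fun x => (Hom.toFun f x, Hom.toFun g x)) ∈ Y.entourages

/-- Equivalences of `G`-bornological coarse spaces: morphisms which are invertible up to
closeness. -/
def IsCoarseEquivalence {X Y : BornCoarse G} (f : X ⟶ Y) : Prop :=
  ∃ g : Y ⟶ X, Close (f ≫ g) (𝟙 X) ∧ Close (g ≫ f) (𝟙 Y)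

/-- Flasqueness, witnessed by an endomorphism `f` which is close to the identity, whose iterates
are uniformly controlled, and which eventually leaves every bounded subset. -/
def IsFlasque (X : BornCoarse G) : Prop :=
  ∃ f : X ⟶ X, Close f (𝟙 X) ∧
    (∀ E ∈ X.entourages,
      (⋃ n : ℕ, (fun p : X.carrier × X.carrier =>
        ((Hom.toFun f)^[n] p.1, (Hom.toFun f)^[n] p.2)) '' E) ∈ X.entourages) ∧
    ∀ B : Set X.carrier, IsBounded B → ∃ n : ℕ, Set.range (Hom.toFun f)^[n] ∩ B = ∅

/-- An invariant subset with the induced structures. -/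
def sub (X : BornCoarse G) (A : SubMulAction G X.carrier) : BornCoarse G where
  carrier := A
  entourages := {E | (fun p : A × A => ((p.1 : X.carrier), (p.2 : X.carrier))) '' E ∈ X.entourages}
  diag_mem := X.subset_mem X.diag_mem (by rintro _ ⟨⟨a, b⟩, h, rfl⟩; exact congrArg Subtype.val h)
  subset_mem := fun E F hE hF => X.subset_mem hE (Set.image_mono hF)
  union_mem := fun E F hE hF => by
    have := X.union_mem hE hF
    rwa [← Set.image_union] at this
  inv_mem := fun E hE => X.subset_mem (X.inv_mem hE) (by
    rintro _ ⟨⟨a, b⟩, h, rfl⟩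
    exact ⟨(b, a), h, rfl⟩)
  comp_mem := fun E F hE hF => X.subset_mem (X.comp_mem hE hF) (by
    rintro _ ⟨⟨a, b⟩, ⟨y, h1, h2⟩, rfl⟩
    exact ⟨y, ⟨(a, y), h1, rfl⟩, ⟨(y, b), h2, rfl⟩⟩)
  exists_invariant := fun E hE => by
    obtain ⟨F, hF, hEF, hinv⟩ := X.exists_invariant hE
    refine ⟨{p | ((p.1 : X.carrier), (p.2 : X.carrier)) ∈ F}, X.subset_mem hF ?_, ?_, ?_⟩
    · rintro _ ⟨p, h, rfl⟩
      exact h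
    · intro p hp
      exact hEF ⟨p, hp, rfl⟩
    · intro g x y h
      exact hinv g _ _ h
  isBounded_smul := fun g B hB => by
    rw [← isBounded_image_subtype_val] at hB ⊢
    refine (X.isBounded_smul g hB).subset ?_
    rintro _ ⟨_, ⟨b, hb, rfl⟩, rfl⟩
    exact ⟨b, ⟨b, hb, rfl⟩, rfl⟩
  isBounded_thickening := fun E hE B hB => by
    rw [← isBounded_image_subtype_val] at hB ⊢
    refine (X.isBounded_thickening hE hB).subset ?_
    rintro _ ⟨a, ⟨b, hb, hab⟩, rfl⟩
    exact ⟨b, ⟨b, hb, rfl⟩, ⟨(a, b), hab, rfl⟩⟩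

/-- The inclusion of an invariant subset. -/
def incl (X : BornCoarse G) (A : SubMulAction G X.carrier) : X.sub A ⟶ X :=
  { toFun := fun a => a.1
    map_smul := fun _ _ => rfl
    controlled := fun _ hE => hE
    proper := fun B hB => by
      change IsBounded (Subtype.val ⁻¹' B)
      rw [← isBounded_image_subtype_val]
      exact hB.subset (Set.image_preimage_subset _ _) : Hom (X.sub A) X }

/-- A morphism with values in an invariant subset, as a morphism to that subset. -/
def codRestrict {T X : BornCoarse G} (f : T ⟶ X) (A : SubMulAction G X.carrier)
    (h : ∀ t, Hom.toFun f t ∈ A) : T ⟶ X.sub A :=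
  { toFun := fun t => ⟨Hom.toFun f t, h t⟩
    map_smul := fun g t => Subtype.ext (Hom.map_smul f g t)
    controlled := fun E hE => X.subset_mem (Hom.controlled f hE) (by
      rintro _ ⟨_, ⟨p, hp, rfl⟩, rfl⟩
      exact ⟨p, hp, rfl⟩)
    proper := fun B hB => by
      have hB' := isBounded_image_subtype_val.2 hB
      refine (Hom.proper f hB').subset ?_
      intro t ht
      exact ⟨_, ht, rfl⟩ : Hom T (X.sub A) }

/-- The functor sending an invariant subset of `X` to this subset with the induced structures. -/
def subFunctor (X : BornCoarse G) : SubMulAction G X.carrier ⥤ BornCoarse G where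
  obj A := X.sub A
  map {A B} h := codRestrict (X.incl A) B (fun a => leOfHom h (Subtype.prop a))

/-- Membership in the coarse structure generated by a relation `U`. -/
inductive GeneratedBy {X : Type u} (U : Set (X × X)) : Set (X × X) → Prop
  | base : GeneratedBy U U
  | diag : GeneratedBy U {p | p.1 = p.2}
  | subset {E F : Set (X × X)} : GeneratedBy U E → F ⊆ E → GeneratedBy U F
  | union {E F : Set (X × X)} : GeneratedBy U E → GeneratedBy U F → GeneratedBy U (E ∪ F)
  | inv {E : Set (X × X)} : GeneratedBy U E → GeneratedBy U {p | (p.2, p.1) ∈ E}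
  | comp {E F : Set (X × X)} : GeneratedBy U E → GeneratedBy U F →
      GeneratedBy U {p | ∃ y, (p.1, y) ∈ E ∧ (y, p.2) ∈ F}

theorem GeneratedBy.mem {X : BornCoarse G} {U E : Set (X.carrier × X.carrier)}
    (hU : U ∈ X.entourages) (h : GeneratedBy U E) : E ∈ X.entourages := by
  induction h with
  | base => exact hU
  | diag => exact X.diag_mem
  | subset _ hF ih => exact X.subset_mem ih hF
  | union _ _ h1 h2 => exact X.union_mem h1 h2
  | inv _ ih => exact X.inv_mem ih
  | comp _ _ h1 h2 => exact X.comp_mem h1 h2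

theorem GeneratedBy.mono {X : Type u} {U V E : Set (X × X)}
    (hUV : U ⊆ V) (h : GeneratedBy U E) : GeneratedBy V E := by
  induction h with
  | base => exact .subset .base hUV
  | diag => exact .diag
  | subset _ hF ih => exact .subset ih hF
  | union _ _ h1 h2 => exact .union h1 h2
  | inv _ ih => exact .inv ih
  | comp _ _ h1 h2 => exact .comp h1 h2

theorem GeneratedBy.exists_invariant {X : Type u} [MulAction G X] {U E : Set (X × X)}
    (hU : IsInvariant G U) (h : GeneratedBy U E) :
    ∃ F, GeneratedBy U F ∧ E ⊆ F ∧ IsInvariant G F := by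
  induction h with
  | base => exact ⟨U, .base, subset_rfl, hU⟩
  | diag => exact ⟨_, .diag, subset_rfl, fun g x y h => congrArg _ h⟩
  | subset _ hF ih =>
    obtain ⟨F, h1, h2, h3⟩ := ih
    exact ⟨F, h1, hF.trans h2, h3⟩
  | union _ _ ih1 ih2 =>
    obtain ⟨F, h1, h2, h3⟩ := ih1
    obtain ⟨F', h1', h2', h3'⟩ := ih2
    exact ⟨F ∪ F', .union h1 h1', Set.union_subset_union h2 h2',
      fun g x y h => h.imp (h3 g x y) (h3' g x y)⟩
  | inv _ ih =>
    obtain ⟨F, h1, h2, h3⟩ := ih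
    exact ⟨_, .inv h1, fun p hp => h2 hp, fun g x y h => h3 g y x h⟩
  | comp _ _ ih1 ih2 =>
    obtain ⟨F, h1, h2, h3⟩ := ih1
    obtain ⟨F', h1', h2', h3'⟩ := ih2
    exact ⟨_, .comp h1 h1', fun p ⟨y, a, b⟩ => ⟨y, h2 a, h2' b⟩,
      fun g x z ⟨y, a, b⟩ => ⟨g • y, h3 g _ _ a, h3' g _ _ b⟩⟩

/-- The poset of invariant entourages of `X`. -/
abbrev InvEntourage (X : BornCoarse G) : Type u :=
  {U : Set (X.carrier × X.carrier) // U ∈ X.entourages ∧ IsInvariant G U}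

/-- The space `X_U`: the coarse structure is replaced by the one generated by the invariant
entourage `U`. -/
def restrictEntourage (X : BornCoarse G) (U : X.InvEntourage) : BornCoarse G where
  carrier := X.carrier
  entourages := {E | GeneratedBy U.1 E}
  diag_mem := .diag
  subset_mem := fun _ _ hE hF => .subset hE hF
  union_mem := fun _ _ hE hF => .union hE hF
  inv_mem := fun _ hE => .inv hE
  comp_mem := fun _ _ hE hF => .comp hE hF
  exists_invariant := fun _ hE => GeneratedBy.exists_invariant U.2.2 hE
  isBounded_smul := X.isBounded_smul
  isBounded_thickening := fun _ hE _ hB =>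
    X.isBounded_thickening (GeneratedBy.mem U.2.1 hE) hB

/-- The functor `U ↦ X_U`; all its structure maps are identities on underlying sets. -/
def restrictEntourageFunctor (X : BornCoarse G) : X.InvEntourage ⥤ BornCoarse G where
  obj U := X.restrictEntourage U
  map {U V} h :=
    { toFun := id
      map_smul := fun _ _ => rfl
      controlled := fun E hE => by
        refine (X.restrictEntourage V).subset_mem (GeneratedBy.mono (leOfHom h) hE) ?_
        rintro _ ⟨p, hp, rfl⟩
        exact hp
      proper := fun _ hB => hB : Hom (X.restrictEntourage U) (X.restrictEntourage V) }

/-- The canonical maps `X_U → X`. -/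
def fromRestrictEntourage (X : BornCoarse G) :
    X.restrictEntourageFunctor ⟶ (Functor.const _).obj X where
  app U :=
    { toFun := id
      map_smul := fun _ _ => rfl
      controlled := fun E hE => by
        refine X.subset_mem (GeneratedBy.mem U.2.1 hE) ?_
        rintro _ ⟨p, hp, rfl⟩
        exact hp
      proper := fun _ hB => hB : Hom (X.restrictEntourage U) X }

/-- An equivariant big family on `X`: a filtered monotone family of invariant subsets such that
each thickening of a member is contained in a member. -/
structure BigFamily (X : BornCoarse G) where
  I : Type u
  [preorder : Preorder I]
  [directed : IsDirectedOrder I]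
  [nonempty : Nonempty I]
  Y : I → SubMulAction G X.carrier
  mono : Monotone Y
  big : ∀ E ∈ X.entourages, ∀ i, ∃ j, thickening E (Y i : Set X.carrier) ⊆ Y j

attribute [instance] BigFamily.preorder BigFamily.directed BigFamily.nonempty

/-- `(Z, 𝒴)` is a complementary pair if `Z` together with some member of `𝒴` covers `X`. -/
def BigFamily.IsComplementary {X : BornCoarse G} (𝒴 : X.BigFamily)
    (Z : SubMulAction G X.carrier) : Prop :=
  ∃ i, ∀ x, x ∈ Z ∨ x ∈ 𝒴.Y i

/-- The diagram `i ↦ Y_i`. -/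
def BigFamily.functor {X : BornCoarse G} (𝒴 : X.BigFamily) : 𝒴.I ⥤ SubMulAction G X.carrier :=
  𝒴.mono.functor

/-- The diagram `i ↦ Z ∩ Y_i`. -/
def BigFamily.interFunctor {X : BornCoarse G} (𝒴 : X.BigFamily) (Z : SubMulAction G X.carrier) :
    𝒴.I ⥤ SubMulAction G X.carrier :=
  Monotone.functor (f := fun i => Z ⊓ 𝒴.Y i) (fun _ _ h => inf_le_inf_left Z (𝒴.mono h))

end BornCoarse

/-! ### Equivariant coarse motivic spectra -/

/-- The relation of being simplicially homotopic. -/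
def SHomotopic {X Z : SSet.{u}} (f g : X ⟶ Z) : Prop := Nonempty (SSet.Homotopy f g)

/-- Weak homotopy equivalences of simplicial sets: maps `X ⟶ Y` inducing a bijection
`[Y, Z] → [X, Z]` on homotopy classes of maps into every Kan complex `Z`. -/
def IsWeakHomotopyEquivalence {X Y : SSet.{u}} (f : X ⟶ Y) : Prop :=
  ∀ (Z : SSet.{u}) [SSet.KanComplex Z],
    (∀ a b : Y ⟶ Z, Relation.EqvGen SHomotopic (f ≫ a) (f ≫ b) → Relation.EqvGen SHomotopic a b) ∧
    ∀ a : X ⟶ Z, ∃ b : Y ⟶ Z, Relation.EqvGen SHomotopic (f ≫ b) a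

variable (G) in
/-- `ℤ × ℤ`-indexed diagrams of simplicial presheaves on `G`-bornological coarse spaces. They model
prespectrum objects: a prespectrum object vanishes off the diagonal, so that its squares
`E(n,n) → E(n+1,n), E(n,n+1) → E(n+1,n+1)` are maps `E(n,n) → Ω E(n+1,n+1)`. -/
abbrev Diag : Type (u + 2) := ((ℤ × ℤ) × (BornCoarse G)ᵒᵖ) ⥤ SSet.{u + 1}

/-- The indicator functor of an upward closed subset of `ℤ × ℤ`. -/
def indicator (S : UpperSet (ℤ × ℤ)) : (ℤ × ℤ) ⥤ Type (u + 1) where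
  obj q := ULift.{u + 1} (PLift (q ∈ S))
  map h := TypeCat.ofHom (fun x => ⟨⟨S.upper (show _ ≤ _ from ⟨leOfHom h.1, leOfHom h.2⟩) x.down.down⟩⟩)

/-- The extension by the empty set, from an upward closed `S ⊆ ℤ × ℤ`, of the constant diagram on
a simplicial presheaf. -/
noncomputable def freeOn (S : UpperSet (ℤ × ℤ)) :
    ((BornCoarse G)ᵒᵖ ⥤ SSet.{u + 1}) ⥤ Diag G :=
  (Functor.whiskeringLeft _ _ _).obj (CategoryTheory.Prod.snd (ℤ × ℤ) (BornCoarse G)ᵒᵖ) ⋙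
    tensorLeft (CategoryTheory.Prod.fst (ℤ × ℤ) (BornCoarse G)ᵒᵖ ⋙
      indicator S ⋙ SimplicialObject.const _)

/-- The simplicial presheaf represented by `X`, discrete in the simplicial direction. -/
noncomputable def representable :
    BornCoarse G ⥤ ((BornCoarse G)ᵒᵖ ⥤ SSet.{u + 1}) :=
  uliftYoneda.{u + 1} ⋙ (Functor.whiskeringRight _ _ _).obj (SimplicialObject.const (Type (u + 1)))

/-- The diagram corepresenting evaluation at `X` and at the position `p`. -/
noncomputable def yo (p : ℤ × ℤ) : BornCoarse G ⥤ Diag G :=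
  representable ⋙ freeOn (UpperSet.Ici p)

/-- The inclusion of the free diagram on `{q | n < q}`, which is the union of `{q | (n+1,n) ≤ q}`
and `{q | (n,n+1) ≤ q}` along `{q | (n+1,n+1) ≤ q}`, into the one on `{q | (n,n) ≤ q}`. -/
noncomputable def cornerIncl (n : ℤ) (Z : (BornCoarse G)ᵒᵖ ⥤ SSet.{u + 1}) :
    (freeOn (UpperSet.Ioi ((n, n) : ℤ × ℤ))).obj Z ⟶ (freeOn (UpperSet.Ici (n, n))).obj Z :=
  Functor.whiskerLeft (CategoryTheory.Prod.fst (ℤ × ℤ) (BornCoarse G)ᵒᵖ)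
    (Functor.whiskerRight
      ({ app := fun _ => TypeCat.ofHom (fun x => ⟨⟨UpperSet.mem_Ici_iff.2 (UpperSet.mem_Ioi_iff.1 x.down.down).le⟩⟩) } :
        indicator (UpperSet.Ioi ((n, n) : ℤ × ℤ)) ⟶ indicator (UpperSet.Ici (n, n)))
      (SimplicialObject.const _)) ▷ _

section HomotopyPushout

variable {K A B X K' A' B' : Diag G}

/-- The cylinder `K × Δ[1]`. -/
noncomputable abbrev cyl (K : Diag G) : Diag G :=
  K ⋙ tensorRight (SSet.stdSimplex.obj (SimplexCategory.mk 1))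

noncomputable def cylInl (K : Diag G) : K ⟶ cyl K where
  app _ := SSet.ι₀

noncomputable def cylInr (K : Diag G) : K ⟶ cyl K where
  app _ := SSet.ι₁

noncomputable def cylProj (K : Diag G) : cyl K ⟶ K where
  app _ := CartesianMonoidalCategory.fst _ _

noncomputable def cylMap (f : K ⟶ K') : cyl K ⟶ cyl K' :=
  Functor.whiskerRight f _

theorem cylInl_proj (K : Diag G) : cylInl K ≫ cylProj K = 𝟙 K := rfl

theorem cylInr_proj (K : Diag G) : cylInr K ≫ cylProj K = 𝟙 K := rfl

theorem cylInl_map (f : K ⟶ K') : cylInl K ≫ cylMap f = f ≫ cylInl K' := rfl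

theorem cylInr_map (f : K ⟶ K') : cylInr K ≫ cylMap f = f ≫ cylInr K' := rfl

/-- The homotopy pushout of `A ← K → B`: the double mapping cylinder
`A ∪ (K × Δ[1]) ∪ B`, where `A` is glued at the end `0` and `B` at the end `1`. -/
noncomputable abbrev hpush (f : K ⟶ A) (g : K ⟶ B) : Diag G :=
  pushout (coprod.desc (cylInl K) (cylInr K)) (coprod.map f g)

noncomputable def hpushInl (f : K ⟶ A) (g : K ⟶ B) : A ⟶ hpush f g :=
  coprod.inl ≫ pushout.inr _ _

noncomputable def hpushInr (f : K ⟶ A) (g : K ⟶ B) : B ⟶ hpush f g :=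
  coprod.inr ≫ pushout.inr _ _

/-- The map out of the homotopy pushout induced by a strictly commuting square. -/
noncomputable def hpushDesc (f : K ⟶ A) (g : K ⟶ B) (a : A ⟶ X) (b : B ⟶ X)
    (h : f ≫ a = g ≫ b) : hpush f g ⟶ X :=
  pushout.desc (cylProj K ≫ f ≫ a) (coprod.desc a b) (by
    apply coprod.hom_ext
    · rw [coprod.inl_desc_assoc, ← Category.assoc, cylInl_proj, Category.id_comp, coprod.map_desc]
      exact (coprod.inl_desc _ _).symm
    · rw [coprod.inr_desc_assoc, ← Category.assoc, cylInr_proj, Category.id_comp, coprod.map_desc, h]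
      exact (coprod.inr_desc _ _).symm)

/-- Functoriality of homotopy pushouts. -/
noncomputable def hpushMap {f : K ⟶ A} {g : K ⟶ B} {f' : K' ⟶ A'} {g' : K' ⟶ B'}
    (κ : K ⟶ K') (α : A ⟶ A') (β : B ⟶ B') (hα : f ≫ α = κ ≫ f') (hβ : g ≫ β = κ ≫ g') :
    hpush f g ⟶ hpush f' g' :=
  pushout.map _ _ _ _ (cylMap κ) (coprod.map α β) (coprod.map κ κ)
    (by ext <;> simp [cylInl_map, cylInr_map]) (by ext <;> simp [hα, hβ])

/-- The suspension: the homotopy pushout of `* ← K → *`. -/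
noncomputable abbrev susp (K : Diag G) : Diag G :=
  hpush (terminal.from K) (terminal.from K)

noncomputable def suspMap (f : K ⟶ K') : susp K ⟶ susp K' :=
  hpushMap f (𝟙 _) (𝟙 _) (terminal.hom_ext _ _) (terminal.hom_ext _ _)

/-- The collapse map from a homotopy pushout of `A ← K → B` to the suspension of `K`. -/
noncomputable def hpushToSusp (f : K ⟶ A) (g : K ⟶ B) : hpush f g ⟶ susp K :=
  hpushMap (𝟙 K) (terminal.from A) (terminal.from B)
    (terminal.hom_ext _ _) (terminal.hom_ext _ _)

/-- The cofibre: the homotopy pushout of `* ← K → B`. -/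
noncomputable abbrev cofib (g : K ⟶ B) : Diag G :=
  hpush (terminal.from K) g

end HomotopyPushout

namespace BornCoarse.BigFamily

variable {X : BornCoarse G} (𝒴 : X.BigFamily) (Z : SubMulAction G X.carrier) (p : ℤ × ℤ)

/-- The value of `yo p` on the big family, as a colimit over its members. -/
noncomputable def yoFamily : Diag G := colimit (𝒴.functor ⋙ X.subFunctor ⋙ yo p)

/-- The value of `yo p` on the big family `Z ∩ 𝒴`. -/
noncomputable def yoInter : Diag G := colimit (𝒴.interFunctor Z ⋙ X.subFunctor ⋙ yo p)

/-- The map `yo(Z ∩ 𝒴) → yo(𝒴)`. -/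
noncomputable def yoInterToFamily : 𝒴.yoInter Z p ⟶ 𝒴.yoFamily p :=
  colimMap (Functor.whiskerRight
    ({ app := fun _ => homOfLE inf_le_right } : 𝒴.interFunctor Z ⟶ 𝒴.functor) _)

/-- The map `yo(Z ∩ 𝒴) → yo(Z)`. -/
noncomputable def yoInterToSub : 𝒴.yoInter Z p ⟶ (yo p).obj (X.sub Z) :=
  colimit.desc (𝒴.interFunctor Z ⋙ X.subFunctor ⋙ yo p)
    ⟨_, { app := fun i => (X.subFunctor ⋙ yo p).map
            (homOfLE inf_le_left : (𝒴.interFunctor Z).obj i ⟶ Z) }⟩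

/-- The map `yo(𝒴) → yo(X)`. -/
noncomputable def yoFamilyToSpace : 𝒴.yoFamily p ⟶ (yo p).obj X :=
  colimit.desc (𝒴.functor ⋙ X.subFunctor ⋙ yo p)
    ⟨_, { app := fun i => (yo p).map (X.incl (𝒴.Y i)) }⟩

end BornCoarse.BigFamily

theorem BornCoarse.BigFamily.yo_comm {X : BornCoarse G} (𝒴 : X.BigFamily)
    (Z : SubMulAction G X.carrier) (p : ℤ × ℤ) :
    𝒴.yoInterToSub Z p ≫ (yo p).map (X.incl Z) =
      𝒴.yoInterToFamily Z p ≫ 𝒴.yoFamilyToSpace p := by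
  refine colimit.hom_ext fun i => ?_
  have h1 : (colimit.ι (𝒴.interFunctor Z ⋙ X.subFunctor ⋙ yo p) i : _ ⟶ 𝒴.yoInter Z p) ≫
      𝒴.yoInterToSub Z p = (X.subFunctor ⋙ yo p).map
        (homOfLE inf_le_left : (𝒴.interFunctor Z).obj i ⟶ Z) := colimit.ι_desc _ _
  have h2 : (colimit.ι (𝒴.interFunctor Z ⋙ X.subFunctor ⋙ yo p) i : _ ⟶ 𝒴.yoInter Z p) ≫
      𝒴.yoInterToFamily Z p = (X.subFunctor ⋙ yo p).map
        (homOfLE inf_le_right : (𝒴.interFunctor Z).obj i ⟶ 𝒴.functor.obj i) ≫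
          colimit.ι (𝒴.functor ⋙ X.subFunctor ⋙ yo p) i := ι_colimMap _ _
  have h3 : (colimit.ι (𝒴.functor ⋙ X.subFunctor ⋙ yo p) i : _ ⟶ 𝒴.yoFamily p) ≫
      𝒴.yoFamilyToSpace p = (yo p).map (X.incl (𝒴.Y i)) := colimit.ι_desc _ _
  refine (Category.assoc _ _ _).symm.trans ?_
  refine (congrArg (fun k => k ≫ (yo p).map (X.incl Z)) h1).trans ?_
  refine Eq.trans ?_ (Category.assoc _ _ _)
  refine Eq.trans ?_ (congrArg (fun k => k ≫ 𝒴.yoFamilyToSpace p) h2.symm)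
  refine Eq.trans ?_ (Category.assoc _ _ _).symm
  refine Eq.trans ?_ (congrArg (fun k => (X.subFunctor ⋙ yo p).map
        (homOfLE inf_le_right : (𝒴.interFunctor Z).obj i ⟶ 𝒴.functor.obj i) ≫ k) h3.symm)
  exact ((yo p).map_comp _ _).symm.trans ((yo p).map_comp _ _)

/-- The maps inverted in equivariant coarse motivic spectra.
The first five families are the axioms of an equivariant coarse homology theory, at every position
`p` of a prespectrum object. The last two say that a prespectrum object vanishes off the diagonal,
and that the squares of a spectrum object are cartesian. -/
inductive Generator : ∀ ⦃A B : Diag G⦄, (A ⟶ B) → Prop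
  | empty (p : ℤ × ℤ) (X : BornCoarse G) (h : IsEmpty X.carrier) :
      Generator (initial.to ((yo p).obj X))
  | excision (p : ℤ × ℤ) (X : BornCoarse G) (𝒴 : X.BigFamily) (Z : SubMulAction G X.carrier)
      (h : 𝒴.IsComplementary Z) :
      Generator (hpushDesc (𝒴.yoInterToSub Z p) (𝒴.yoInterToFamily Z p)
        ((yo p).map (X.incl Z)) (𝒴.yoFamilyToSpace p) (𝒴.yo_comm Z p))
  | coarse (p : ℤ × ℤ) (X Y : BornCoarse G) (f : X ⟶ Y) (h : BornCoarse.IsCoarseEquivalence f) :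
      Generator ((yo p).map f)
  | flasque (p : ℤ × ℤ) (X : BornCoarse G) (h : X.IsFlasque) :
      Generator (initial.to ((yo p).obj X))
  | uContinuity (p : ℤ × ℤ) (X : BornCoarse G) :
      Generator (colimit.desc (X.restrictEntourageFunctor ⋙ yo p)
        ⟨(yo p).obj X, { app := fun U => (yo p).map (X.fromRestrictEntourage.app U) }⟩)
  | reduced (p : ℤ × ℤ) (h : p.1 ≠ p.2) (Z : (BornCoarse G)ᵒᵖ ⥤ SSet.{u + 1}) :
      Generator (initial.to ((freeOn (UpperSet.Ici p)).obj Z))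
  | cartesian (n : ℤ) (Z : (BornCoarse G)ᵒᵖ ⥤ SSet.{u + 1}) : Generator (cornerIncl n Z)

/-- Classes of maps which contain the objectwise weak homotopy equivalences and the generators,
satisfy two-out-of-three, and are closed under homotopy pushouts and filtered (homotopy) colimits,
hence under all homotopy colimits. -/
structure IsLocalizer (W : MorphismProperty (Diag G)) : Prop where
  objectwise : ∀ ⦃A B : Diag G⦄ (f : A ⟶ B),
    (∀ q, IsWeakHomotopyEquivalence (f.app q)) → W f
  generators : ∀ ⦃A B : Diag G⦄ (f : A ⟶ B), Generator f → W f
  twoOutOfThree : W.HasTwoOutOfThreeProperty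
  hpush : ∀ ⦃K A B K' A' B' : Diag G⦄ (f : K ⟶ A) (g : K ⟶ B) (f' : K' ⟶ A') (g' : K' ⟶ B')
    (κ : K ⟶ K') (α : A ⟶ A') (β : B ⟶ B') (hα : f ≫ α = κ ≫ f') (hβ : g ≫ β = κ ≫ g'),
    W κ → W α → W β → W (hpushMap κ α β hα hβ)
  filtered : MorphismProperty.IsStableUnderFilteredColimits.{u + 1, u + 1} W

variable (G) in
/-- The smallest localizer: the strongly saturated class generated by the above maps. -/
def motivicEquivalence : MorphismProperty (Diag G) :=
  fun _ _ f => ∀ W : MorphismProperty (Diag G), IsLocalizer W → W f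

variable (G) in
/-- The homotopy category of the stable `∞`-category of equivariant coarse motivic spectra, the
localization of diagrams of simplicial presheaves at the motivic equivalences. -/
def GSpX := (motivicEquivalence G).Localization

noncomputable instance : Category (GSpX G) :=
  inferInstanceAs (Category (motivicEquivalence G).Localization)

/-- The localization functor. -/
noncomputable def motive : Diag G ⥤ GSpX G := (motivicEquivalence G).Q

/-- The underlying diagram of the motive of `X`. -/
noncomputable abbrev yo₀ : BornCoarse G ⥤ Diag G := yo (0, 0)

/-- The universal equivariant coarse homology theory `Yoˢ`. -/
noncomputable abbrev Yo : BornCoarse G ⥤ GSpX G := yo₀ ⋙ motive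

/-- The suspension `Σ Yoˢ(X)`. -/
noncomputable abbrev suspYo (X : BornCoarse G) : GSpX G := motive.obj (susp (yo₀.obj X))

/-- The map `Σ Yoˢ(f)`. -/
noncomputable abbrev suspYoMap {X Y : BornCoarse G} (f : X ⟶ Y) : suspYo X ⟶ suspYo Y :=
  motive.map (suspMap (yo₀.map f))

variable (G) in
/-- A commutative square `K → A, B → X` of `G`-bornological coarse spaces. -/
structure Square where
  {K A B X : BornCoarse G}
  kA : K ⟶ A
  kB : K ⟶ B
  a : A ⟶ X
  b : B ⟶ X
  comm : kA ≫ a = kB ≫ b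

namespace Square

variable (S : Square G)

/-- The homotopy pushout of the motives of `A ← K → B`. -/
noncomputable abbrev union : Diag G := hpush (yo₀.map S.kA) (yo₀.map S.kB)

/-- The comparison of the homotopy pushout with the motive of `X`. -/
noncomputable def compare : S.union ⟶ yo₀.obj S.X :=
  hpushDesc _ _ (yo₀.map S.a) (yo₀.map S.b) (by rw [← Functor.map_comp, S.comm, Functor.map_comp])

/-- `Yoˢ` sends the square to a push-out square. -/
def IsExcisive : Prop := IsIso (motive.map S.compare)

/-- The Mayer-Vietoris boundary map `Yoˢ(X) → Σ Yoˢ(K)`: the map from the push-out of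
`Yoˢ(A) ← Yoˢ(K) → Yoˢ(B)` to that of `0 ← Yoˢ(K) → 0`. -/
noncomputable def boundary (h : S.IsExcisive) : Yo.obj S.X ⟶ suspYo S.K :=
  haveI : IsIso (motive.map S.compare) := h
  inv (motive.map S.compare) ≫ motive.map (hpushToSusp _ _)

end Square

/-! ### Uniform bornological coarse spaces and cones -/

/-- A `G`-uniform bornological coarse space: a `G`-bornological coarse space with a uniform
structure in which every uniform entourage contains an invariant one, and such that some uniform
entourage is also a coarse entourage. -/
structure UnifBornCoarse (G : Type u) [Group G] : Type (u + 1) where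
  space : BornCoarse G
  [uniform : UniformSpace space.carrier]
  exists_invariant_uniform : ∀ V ∈ 𝓤 space.carrier, ∃ V' ∈ 𝓤 space.carrier,
    V' ⊆ V ∧ IsInvariant G V'
  compatible : ∃ V ∈ 𝓤 space.carrier, V ∈ space.entourages

attribute [instance] UnifBornCoarse.uniform

/-- The tensor product `ℝ ⊗ X`, where `ℝ` has its metric structures and the trivial action. -/
def BornCoarse.line (X : BornCoarse G) : BornCoarse G where
  carrier := ℝ × X.carrier
  mulAction :=
    { smul := fun g p => (p.1, g • p.2)
      one_smul := fun p => Prod.ext rfl (one_smul G p.2)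
      mul_smul := fun g h p => Prod.ext rfl (mul_smul g h p.2) }
  entourages := {E | ∃ r : ℝ, ∃ F ∈ X.entourages, ∀ p q, (p, q) ∈ E →
    |p.1 - q.1| ≤ r ∧ (p.2, q.2) ∈ F}
  diag_mem := ⟨0, _, X.diag_mem, fun p q h => by
    obtain rfl : p = q := h
    simp⟩
  subset_mem := fun E E' ⟨r, F, hF, h⟩ hE' => ⟨r, F, hF, fun p q hpq => h p q (hE' hpq)⟩
  union_mem := fun E E' ⟨r, F, hF, h⟩ ⟨r', F', hF', h'⟩ =>
    ⟨max r r', F ∪ F', X.union_mem hF hF', fun p q hpq => by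
      rcases hpq with hpq | hpq
      · exact ⟨(h p q hpq).1.trans (le_max_left _ _), Or.inl (h p q hpq).2⟩
      · exact ⟨(h' p q hpq).1.trans (le_max_right _ _), Or.inr (h' p q hpq).2⟩⟩
  inv_mem := fun E ⟨r, F, hF, h⟩ => ⟨r, _, X.inv_mem hF, fun p q hpq => by
    rw [abs_sub_comm]
    exact h q p hpq⟩
  comp_mem := fun E E' ⟨r, F, hF, h⟩ ⟨r', F', hF', h'⟩ =>
    ⟨r + r', _, X.comp_mem hF hF', fun p q ⟨y, h1, h2⟩ =>
      ⟨(abs_sub_le p.1 y.1 q.1).trans (add_le_add (h _ _ h1).1 (h' _ _ h2).1),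
        ⟨y.2, (h _ _ h1).2, (h' _ _ h2).2⟩⟩⟩
  exists_invariant := fun E ⟨r, F, hF, h⟩ => by
    obtain ⟨F', hF', hFF', hinv⟩ := X.exists_invariant hF
    exact ⟨{p | |p.1.1 - p.2.1| ≤ r ∧ (p.1.2, p.2.2) ∈ F'}, ⟨r, F', hF', fun p q h => h⟩,
      fun p hp => ⟨(h p.1 p.2 hp).1, hFF' (h p.1 p.2 hp).2⟩,
      fun g p q h => ⟨h.1, hinv g _ _ h.2⟩⟩
  isBounded_smul := fun g B hB => by
    rw [← isBounded_image_fst_and_snd] at hB ⊢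
    refine ⟨hB.1.subset ?_, (X.isBounded_smul g hB.2).subset ?_⟩
    · rintro _ ⟨_, ⟨b, hb, rfl⟩, rfl⟩
      exact ⟨b, hb, rfl⟩
    · rintro _ ⟨_, ⟨b, hb, rfl⟩, rfl⟩
      exact ⟨b.2, ⟨b, hb, rfl⟩, rfl⟩
  isBounded_thickening := fun E ⟨r, F, hF, h⟩ B hB => by
    rw [← isBounded_image_fst_and_snd] at hB ⊢
    refine ⟨(hB.1.cthickening (δ := r)).subset ?_, (X.isBounded_thickening hF hB.2).subset ?_⟩
    · rintro _ ⟨p, ⟨b, hb, hp⟩, rfl⟩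
      refine Metric.mem_cthickening_of_dist_le p.1 b.1 r _ ⟨b, hb, rfl⟩ ?_
      rw [Real.dist_eq]
      exact (h _ _ hp).1
    · rintro _ ⟨p, ⟨b, hb, hp⟩, rfl⟩
      exact ⟨b.2, ⟨b, hb, rfl⟩, (h _ _ hp).2⟩

namespace UnifBornCoarse

/-- Isomorphisms of `G`-uniform bornological coarse spaces: bijections which are equivariant,
controlled, proper and uniformly continuous in both directions. -/
structure Iso (X Y : UnifBornCoarse G) where
  hom : X.space ⟶ Y.space
  inv : Y.space ⟶ X.space
  hom_inv_id : hom ≫ inv = 𝟙 _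
  inv_hom_id : inv ≫ hom = 𝟙 _
  uniformContinuous_hom : UniformContinuous (BornCoarse.Hom.toFun hom)
  uniformContinuous_inv : UniformContinuous (BornCoarse.Hom.toFun inv)

/-- An invariant subset with the induced structures. -/
def sub (X : UnifBornCoarse G) (A : SubMulAction G X.space.carrier) : UnifBornCoarse G where
  space := X.space.sub A
  uniform := instUniformSpaceSubtype
  exists_invariant_uniform := fun V hV => by
    obtain ⟨W, hW, hWV⟩ := hV
    obtain ⟨W', hW', hWW', hinv⟩ := X.exists_invariant_uniform W hW
    exact ⟨_, Filter.preimage_mem_comap hW', (Set.preimage_mono hWW').trans hWV,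
      fun g x y h => hinv g _ _ h⟩
  compatible := by
    obtain ⟨V, hV, hV'⟩ := X.compatible
    exact ⟨_, Filter.preimage_mem_comap hV, X.space.subset_mem hV' (Set.image_preimage_subset _ _)⟩

theorem exists_rect {α : Type u} [UniformSpace α] {V : Set ((ℝ × α) × (ℝ × α))}
    (hV : V ∈ 𝓤 (ℝ × α)) : ∃ S ∈ 𝓤 ℝ, ∃ T ∈ 𝓤 α,
      ∀ p q : ℝ × α, (p.1, q.1) ∈ S → (p.2, q.2) ∈ T → (p, q) ∈ V := by
  rw [uniformity_prod, Filter.mem_inf_iff] at hV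
  obtain ⟨A, ⟨S, hS, hSA⟩, B, ⟨T, hT, hTB⟩, rfl⟩ := hV
  exact ⟨S, hS, T, hT, fun p q h1 h2 =>
    ⟨hSA (show (p, q) ∈ _ ⁻¹' S from h1), hTB (show (p, q) ∈ _ ⁻¹' T from h2)⟩⟩

theorem rect_mem {α : Type u} [UniformSpace α] {S : Set (ℝ × ℝ)} {T : Set (α × α)}
    (hS : S ∈ 𝓤 ℝ) (hT : T ∈ 𝓤 α) :
    {p : (ℝ × α) × (ℝ × α) | (p.1.1, p.2.1) ∈ S ∧ (p.1.2, p.2.2) ∈ T} ∈ 𝓤 (ℝ × α) := by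
  rw [uniformity_prod]
  exact Filter.inter_mem_inf (Filter.preimage_mem_comap hS) (Filter.preimage_mem_comap hT)

/-- The tensor product `ℝ ⊗ X` of uniform bornological coarse spaces. -/
def line (X : UnifBornCoarse G) : UnifBornCoarse G where
  space := X.space.line
  uniform := instUniformSpaceProd
  exists_invariant_uniform := fun V hV => by
    obtain ⟨S, hS, T, hT, hST⟩ := exists_rect hV
    obtain ⟨T', hT', hTT', hinv⟩ := X.exists_invariant_uniform T hT
    exact ⟨_, rect_mem hS hT', fun p hp => hST p.1 p.2 hp.1 (hTT' hp.2),
      fun g p q h => ⟨h.1, hinv g _ _ h.2⟩⟩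
  compatible := by
    obtain ⟨T, hT, hT'⟩ := X.compatible
    refine ⟨_, rect_mem (Metric.dist_mem_uniformity one_pos) hT, 1, T, hT', fun p q h => ⟨?_, h.2⟩⟩
    have := h.1
    rw [Set.mem_ofPred_eq, Real.dist_eq] at this
    exact this.le

/-- The invariant subset `T × A` of `ℝ ⊗ X`. -/
def strip (X : UnifBornCoarse G) (T : Set ℝ) (A : SubMulAction G X.space.carrier) :
    SubMulAction G X.line.space.carrier where
  carrier := {p | p.1 ∈ T ∧ p.2 ∈ A}
  smul_mem' g _ h := ⟨h.1, A.smul_mem g h.2⟩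

/-- The tensor product `[0,∞) ⊗ X`. -/
def ray (X : UnifBornCoarse G) : UnifBornCoarse G := X.line.sub (X.strip (Set.Ici 0) ⊤)

/-- The space `𝒪(X)₋`: the space `ℝ ⊗ X` with the hybrid coarse structure induced by the uniform
structure and the big family `((-∞,n] × X)`. Its entourages are the entourages `E` of `ℝ ⊗ X` such
that for every uniform entourage `V` there is `n` with
`E ⊆ ((-∞,n] × X) × ((-∞,n] × X) ∪ V`. -/
def coneMinus (X : UnifBornCoarse G) : BornCoarse G where
  carrier := X.line.space.carrier
  entourages := {E | E ∈ X.line.space.entourages ∧ ∀ V ∈ 𝓤 X.line.space.carrier,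
    ∃ n : ℕ, ∀ p q, (p, q) ∈ E → (p.1 ≤ n ∧ q.1 ≤ n) ∨ (p, q) ∈ V}
  diag_mem := ⟨X.line.space.diag_mem, fun V hV => ⟨0, fun p q h => by
    obtain rfl : p = q := h
    exact Or.inr (refl_mem_uniformity hV)⟩⟩
  subset_mem := fun E F hE hF => ⟨X.line.space.subset_mem hE.1 hF, fun V hV => by
    obtain ⟨n, hn⟩ := hE.2 V hV
    exact ⟨n, fun p q h => hn p q (hF h)⟩⟩
  union_mem := fun E F hE hF => ⟨X.line.space.union_mem hE.1 hF.1, fun V hV => by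
    obtain ⟨n, hn⟩ := hE.2 V hV
    obtain ⟨m, hm⟩ := hF.2 V hV
    have h1 : (n : ℝ) ≤ (max n m : ℕ) := by exact_mod_cast le_max_left n m
    have h2 : (m : ℝ) ≤ (max n m : ℕ) := by exact_mod_cast le_max_right n m
    refine ⟨max n m, fun p q h => ?_⟩
    rcases h with h | h
    · exact (hn p q h).imp_left fun h => ⟨h.1.trans h1, h.2.trans h1⟩
    · exact (hm p q h).imp_left fun h => ⟨h.1.trans h2, h.2.trans h2⟩⟩
  inv_mem := fun E hE => ⟨X.line.space.inv_mem hE.1, fun V hV => by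
    obtain ⟨n, hn⟩ := hE.2 _ (symm_le_uniformity hV)
    exact ⟨n, fun p q h => (hn q p h).imp_left And.symm⟩⟩
  comp_mem := fun E F hE hF => ⟨X.line.space.comp_mem hE.1 hF.1, fun V hV => by
    obtain ⟨V', hV', hVV'⟩ := comp_mem_uniformity_sets hV
    obtain ⟨n, hn⟩ := hE.2 V' hV'
    obtain ⟨m, hm⟩ := hF.2 V' hV'
    obtain ⟨r, _, -, hr⟩ := hE.1
    obtain ⟨s, _, -, hs⟩ := hF.1
    obtain ⟨k, hk⟩ := exists_nat_ge (max (n : ℝ) m + max r s)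
    have h1 := le_max_left (n : ℝ) m
    have h2 := le_max_right (n : ℝ) m
    have h3 := le_max_left r s
    have h4 := le_max_right r s
    refine ⟨k, fun p q ⟨y, hpy, hyq⟩ => ?_⟩
    have a1 := abs_le.1 (hr _ _ hpy).1
    have a2 := abs_le.1 (hs _ _ hyq).1
    have a3 := (abs_nonneg _).trans (hr _ _ hpy).1
    rcases hn _ _ hpy with h | h
    · left
      constructor <;> linarith [h.1, h.2, a2.1, a2.2]
    · rcases hm _ _ hyq with h' | h'
      · left
        constructor <;> linarith [h'.1, h'.2, a1.1, a1.2]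
      · exact Or.inr (hVV' ⟨y, h, h'⟩)⟩
  exists_invariant := fun E hE => by
    obtain ⟨F, hF, hEF, hinv⟩ := X.line.space.exists_invariant hE.1
    refine ⟨{p | ∃ (g : G) (a b : X.line.space.carrier), (a, b) ∈ E ∧ p = (g • a, g • b)},
      ⟨X.line.space.subset_mem hF ?_, fun V hV => ?_⟩, fun p hp => ?_, ?_⟩
    · rintro _ ⟨g, a, b, h, rfl⟩
      exact hinv g a b (hEF h)
    · obtain ⟨V', hV', hVV', hinv'⟩ := X.line.exists_invariant_uniform V hV
      obtain ⟨n, hn⟩ := hE.2 V' hV'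
      refine ⟨n, ?_⟩
      rintro _ _ ⟨g, a, b, h, h'⟩
      obtain ⟨rfl, rfl⟩ := Prod.mk.inj h'
      exact (hn a b h).imp id fun h => hVV' (hinv' g a b h)
    · exact ⟨1, p.1, p.2, hp, by simp⟩
    · rintro g _ _ ⟨g', a, b, h, h'⟩
      obtain ⟨rfl, rfl⟩ := Prod.mk.inj h'
      exact ⟨g * g', a, b, h, by simp [mul_smul]⟩
  isBounded_smul := X.line.space.isBounded_smul
  isBounded_thickening := fun _ hE => X.line.space.isBounded_thickening hE.1

/-- The invariant subset `T × A` of `𝒪(X)₋`. -/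
def coneStrip (X : UnifBornCoarse G) (T : Set ℝ) (A : SubMulAction G X.space.carrier) :
    SubMulAction G X.coneMinus.carrier where
  carrier := {p | p.1 ∈ T ∧ p.2 ∈ A}
  smul_mem' g _ h := ⟨h.1, A.smul_mem g h.2⟩

/-- The cone `𝒪(X)`: the subset `[0,∞) × X` of `𝒪(X)₋`. -/
def cone (X : UnifBornCoarse G) : BornCoarse G := X.coneMinus.sub (X.coneStrip (Set.Ici 0) ⊤)

/-- The morphism `X → ℝ ⊗ X`, `x ↦ (0, x)`. -/
def zeroLine (X : UnifBornCoarse G) : X.space ⟶ X.line.space :=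
  { toFun := fun x => (0, x)
    map_smul := fun _ _ => rfl
    controlled := fun E hE => ⟨0, E, hE, by
      rintro _ _ ⟨p, hp, h⟩
      obtain ⟨rfl, rfl⟩ := Prod.mk.inj h
      exact ⟨by simp, hp⟩⟩
    proper := fun B hB => (isBounded_image_fst_and_snd.2 hB).2.subset
      (fun x hx => ⟨(0, x), hx, rfl⟩) : BornCoarse.Hom X.space X.line.space }

/-- The morphism `X → 𝒪(X)₋`, `x ↦ (0, x)`. -/
def zeroConeMinus (X : UnifBornCoarse G) : X.space ⟶ X.coneMinus :=
  { toFun := fun x => (0, x)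
    map_smul := fun _ _ => rfl
    controlled := fun E hE => ⟨BornCoarse.Hom.controlled X.zeroLine hE, fun V hV => ⟨0, by
      rintro _ _ ⟨p, hp, h⟩
      obtain ⟨rfl, rfl⟩ := Prod.mk.inj h
      simp⟩⟩
    proper := BornCoarse.Hom.proper X.zeroLine : BornCoarse.Hom X.space X.coneMinus }

/-- The inclusion `X → 𝒪(X)` of the base of the cone. -/
def toCone (X : UnifBornCoarse G) : X.space ⟶ X.cone :=
  BornCoarse.codRestrict X.zeroConeMinus _ (fun _ => ⟨le_refl (0 : ℝ), trivial⟩)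

/-- The morphism `𝒪(A) → 𝒪(X)₋` induced by the inclusion of an invariant subset `A`. -/
def coneOfSub (X : UnifBornCoarse G) (A : SubMulAction G X.space.carrier) :
    (X.sub A).cone ⟶ X.coneMinus :=
  BornCoarse.incl _ _ ≫
  ({ toFun := fun p => (p.1, (p.2 : A).1)
     map_smul := fun _ _ => rfl
     controlled := fun E hE => by
      obtain ⟨⟨r, F, hF, h⟩, hE'⟩ := hE
      refine ⟨⟨r, _, hF, ?_⟩, fun V hV => ?_⟩
      · rintro _ _ ⟨p, hp, h'⟩
        obtain ⟨rfl, rfl⟩ := Prod.mk.inj h'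
        exact ⟨(h _ _ hp).1, ⟨_, (h _ _ hp).2, rfl⟩⟩
      · obtain ⟨S, hS, T, hT, hST⟩ := exists_rect hV
        obtain ⟨n, hn⟩ := hE' _ (rect_mem hS (Filter.preimage_mem_comap hT))
        refine ⟨n, ?_⟩
        rintro _ _ ⟨p, hp, h'⟩
        obtain ⟨rfl, rfl⟩ := Prod.mk.inj h'
        exact (hn _ _ hp).imp id fun h => hST _ _ h.1 h.2
     proper := fun B hB => by
      have hB' := isBounded_image_fst_and_snd.2 hB
      refine isBounded_image_fst_and_snd.1 ⟨hB'.1.subset ?_, ?_⟩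
      · rintro _ ⟨p, hp, rfl⟩
        exact ⟨_, hp, rfl⟩
      · refine isBounded_image_subtype_val.1 (hB'.2.subset ?_)
        rintro _ ⟨_, ⟨p, hp, rfl⟩, rfl⟩
        exact ⟨_, hp, rfl⟩ } : BornCoarse.Hom (X.sub A).coneMinus X.coneMinus)

/-- The square of the decomposition of `ℝ ⊗ X` into `(-∞,0] × X` and `[0,∞) × X`. -/
def lineSquare (X : UnifBornCoarse G) : Square G where
  kA := BornCoarse.codRestrict X.zeroLine (X.strip (Set.Iic 0) ⊤) (fun _ => ⟨le_refl (0 : ℝ), trivial⟩)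
  kB := BornCoarse.codRestrict X.zeroLine (X.strip (Set.Ici 0) ⊤) (fun _ => ⟨le_refl (0 : ℝ), trivial⟩)
  a := X.line.space.incl _
  b := X.line.space.incl _
  comm := rfl

/-- The suspension map `susp : Yoˢ(ℝ ⊗ X) → Σ Yoˢ(X)`, the Mayer-Vietoris boundary of the
decomposition of `ℝ ⊗ X` into `(-∞,0] × X` and `[0,∞) × X`. -/
noncomputable def suspension (X : UnifBornCoarse G) (h : X.lineSquare.IsExcisive) :
    Yo.obj X.line.space ⟶ suspYo X.space :=
  X.lineSquare.boundary h

/-- The square of the decomposition of `𝒪(X)₋` into `(-∞,0] × X` and `𝒪(X)`. -/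
def coneSquare (X : UnifBornCoarse G) : Square G where
  kA := BornCoarse.codRestrict X.zeroConeMinus (X.coneStrip (Set.Iic 0) ⊤)
    (fun _ => ⟨le_refl (0 : ℝ), trivial⟩)
  kB := X.toCone
  a := X.coneMinus.incl _
  b := X.coneMinus.incl _
  comm := rfl

/-- The germs-at-`∞` object `𝒪^∞(X)`, the cofibre of `Yoˢ(X) → Yoˢ(𝒪(X))`. -/
noncomputable def germs (X : UnifBornCoarse G) : GSpX G :=
  motive.obj (cofib (yo₀.map X.toCone))

/-- The canonical map `Yoˢ(𝒪(X)) → 𝒪^∞(X)` of the cone sequence. -/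
noncomputable def coneToGerms (X : UnifBornCoarse G) : Yo.obj X.cone ⟶ X.germs :=
  motive.map (hpushInr _ _)

/-- The map from the push-out of `Yoˢ((-∞,0] × X) ← Yoˢ(X) → Yoˢ(𝒪(X))` to the cofibre
`𝒪^∞(X)`, i.e. to the push-out of `0 ← Yoˢ(X) → Yoˢ(𝒪(X))`. -/
noncomputable def unionToGerms (X : UnifBornCoarse G) :
    motive.obj X.coneSquare.union ⟶ X.germs :=
  motive.map (hpushMap (𝟙 _) (terminal.from _) (𝟙 _) (terminal.hom_ext _ _)
    ((Category.comp_id _).trans (Category.id_comp _).symm))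

/-- The map `c : 𝒪^∞(X) → Yoˢ(𝒪(X)₋)` out of the cofibre. The composition
`Yoˢ(X) → Yoˢ(𝒪(X)) → Yoˢ(𝒪(X)₋)` is trivialized by its factorization over the motive
of `(-∞,0] × X`. -/
noncomputable def c (X : UnifBornCoarse G) (h : IsIso X.unionToGerms) :
    X.germs ⟶ Yo.obj X.coneMinus :=
  inv X.unionToGerms ≫ motive.map X.coneSquare.compare

end UnifBornCoarse

/-! ### Excisive decompositions and cylindrical ends -/

/-- A decomposition `X = A ∪ B` into invariant subsets is coarsely excisive if for every entourage
`E` there is an entourage `F` with `E[A] ∩ E[B] ⊆ F[A ∩ B]`. -/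
def BornCoarse.IsCoarselyExcisive (X : BornCoarse G) (A B : SubMulAction G X.carrier) : Prop :=
  (∀ x, x ∈ A ∨ x ∈ B) ∧ ∀ E ∈ X.entourages, ∃ F ∈ X.entourages,
    thickening E (A : Set X.carrier) ∩ thickening E B ⊆ thickening F (A ⊓ B : SubMulAction _ _)

/-- A decomposition `X = A ∪ B` into invariant subsets is uniformly excisive if there are an
invariant uniform entourage `V` and a map `s` sending invariant subsets `W` of `V` to invariant
relations such that `W[A] ∩ W[B] ⊆ s(W)[A ∩ B]`, and such that for every uniform entourage `U`
there is an invariant uniform entourage `W ⊆ V` with `s(W) ⊆ U`. -/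
def UnifBornCoarse.IsUniformlyExcisive (X : UnifBornCoarse G)
    (A B : SubMulAction G X.space.carrier) : Prop :=
  (∀ x, x ∈ A ∨ x ∈ B) ∧ ∃ V ∈ 𝓤 X.space.carrier, IsInvariant G V ∧
    ∃ s : Set (X.space.carrier × X.space.carrier) → Set (X.space.carrier × X.space.carrier),
      (∀ W ⊆ V, IsInvariant G W → IsInvariant G (s W) ∧
        thickening W (A : Set X.space.carrier) ∩ thickening W B ⊆
          thickening (s W) (A ⊓ B : SubMulAction _ _)) ∧
      ∀ U ∈ 𝓤 X.space.carrier, ∃ W ∈ 𝓤 X.space.carrier, IsInvariant G W ∧ W ⊆ V ∧ s W ⊆ U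

variable (G) in
/-- A `G`-uniform bornological coarse space `W∞` with a coarsely and uniformly excisive
decomposition `(M∞, W)` such that, with `M = W ∩ M∞`, the piece `M∞` is a cylinder `[0,∞) ⊗ M` with
base `M`, and such that the inclusion `M → W` is a coarse equivalence. -/
structure CylindricalEnd where
  Winf : UnifBornCoarse G
  Minf : SubMulAction G Winf.space.carrier
  W : SubMulAction G Winf.space.carrier
  coarselyExcisive : Winf.space.IsCoarselyExcisive Minf W
  uniformlyExcisive : Winf.IsUniformlyExcisive Minf W
  cylinder : UnifBornCoarse.Iso (Winf.sub (W ⊓ Minf)).ray (Winf.sub Minf)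
  cylinder_zero : ∀ m : (W ⊓ Minf : SubMulAction G Winf.space.carrier),
    (BornCoarse.Hom.toFun cylinder.hom ⟨(0, m), ⟨le_refl (0 : ℝ), trivial⟩⟩ : Minf).1 = m.1
  coarseEquivalence : BornCoarse.IsCoarseEquivalence
    (Winf.space.subFunctor.map (homOfLE (inf_le_left : W ⊓ Minf ≤ W)))

namespace CylindricalEnd

variable (D : CylindricalEnd G)

/-- The intersection `M = W ∩ M∞`. -/
def M : UnifBornCoarse G := D.Winf.sub (D.W ⊓ D.Minf)

/-- The space `W`. -/
def spaceW : BornCoarse G := D.Winf.space.sub D.W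

/-- The inclusion `f : M → W`. -/
def f : D.M.space ⟶ D.spaceW :=
  D.Winf.space.subFunctor.map (homOfLE (inf_le_left : D.W ⊓ D.Minf ≤ D.W))

/-- The subset `Y₋ = (-∞,0] × W`. -/
def Yminus : SubMulAction G D.Winf.coneMinus.carrier := D.Winf.coneStrip (Set.Iic 0) D.W

/-- The subset `Y₊ = [0,∞) × W∞`, with the induced structures the cone `𝒪(W∞)`. -/
def Yplus : SubMulAction G D.Winf.coneMinus.carrier := D.Winf.coneStrip (Set.Ici 0) ⊤

/-- The subset `Y = (-∞,0] × W ∪ [0,∞) × W∞`. -/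
def Y : SubMulAction G D.Winf.coneMinus.carrier := D.Yminus ⊔ D.Yplus

/-- The subset `ℝ × W`. -/
def lineW : SubMulAction G D.Winf.coneMinus.carrier := D.Winf.coneStrip Set.univ D.W

/-- The subset `[0,∞) × W`. -/
def coneW : SubMulAction G D.Winf.coneMinus.carrier := D.Winf.coneStrip (Set.Ici 0) D.W

/-- The subset `[0,∞) × M∞`. -/
def coneMinf : SubMulAction G D.Winf.coneMinus.carrier := D.Winf.coneStrip (Set.Ici 0) D.Minf

/-- `Y` with the structures induced from `𝒪(W∞)₋`. -/
def spaceY : BornCoarse G := D.Winf.coneMinus.sub D.Y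

theorem lineW_le : D.lineW ≤ D.Y := fun p hp =>
  (le_total p.1 0).imp (fun h => ⟨h, hp.2⟩) (fun h => ⟨h, trivial⟩)

theorem coneMinf_le_Yplus : D.coneMinf ≤ D.Yplus := fun _ hp => ⟨hp.1, trivial⟩

theorem coneW_le_Yplus : D.coneW ≤ D.Yplus := fun _ hp => ⟨hp.1, trivial⟩

/-- The morphism `W → 𝒪(W∞)₋`, `w ↦ (0, w)`. -/
def baseW : D.spaceW ⟶ D.Winf.coneMinus := D.Winf.space.incl D.W ≫ D.Winf.zeroConeMinus

/-- The morphism `𝒪(M) → 𝒪(W∞)₋` induced by the inclusion. -/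
def coneM : D.M.cone ⟶ D.Winf.coneMinus := D.Winf.coneOfSub (D.W ⊓ D.Minf)

/-- The square of the decomposition of `Y` into `Y₋` and `Y₊`, with `Y₋ ∩ Y₊ ≅ W`. -/
def squareY : Square G where
  X := D.spaceY
  kA := BornCoarse.codRestrict D.baseW D.Yminus (fun w => ⟨le_refl (0 : ℝ), Subtype.prop w⟩)
  kB := BornCoarse.codRestrict D.baseW D.Yplus (fun _ => ⟨le_refl (0 : ℝ), trivial⟩)
  a := D.Winf.coneMinus.subFunctor.map (homOfLE le_sup_left)
  b := D.Winf.coneMinus.subFunctor.map (homOfLE le_sup_right)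
  comm := rfl

/-- The square of the decomposition of `Y` into `ℝ × W` and `[0,∞) × M∞`, with intersection
`𝒪(M)`. -/
def squareY' : Square G where
  X := D.spaceY
  kA := BornCoarse.codRestrict D.coneM D.lineW (fun p => ⟨trivial, (Subtype.prop p.1.2).1⟩)
  kB := BornCoarse.codRestrict D.coneM D.coneMinf
    (fun p => ⟨(Subtype.prop p).1, (Subtype.prop p.1.2).2⟩)
  a := D.Winf.coneMinus.subFunctor.map (homOfLE D.lineW_le)
  b := D.Winf.coneMinus.subFunctor.map (homOfLE (D.coneMinf_le_Yplus.trans le_sup_right))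
  comm := rfl

/-- The square of the decomposition of `𝒪(W∞)` into `[0,∞) × W` and `[0,∞) × M∞`, with
intersection `𝒪(M)`. -/
def squareO : Square G where
  X := D.Winf.cone
  kA := BornCoarse.codRestrict D.coneM D.coneW
    (fun p => ⟨(Subtype.prop p).1, (Subtype.prop p.1.2).1⟩)
  kB := BornCoarse.codRestrict D.coneM D.coneMinf
    (fun p => ⟨(Subtype.prop p).1, (Subtype.prop p.1.2).2⟩)
  a := D.Winf.coneMinus.subFunctor.map (homOfLE D.coneW_le_Yplus)
  b := D.Winf.coneMinus.subFunctor.map (homOfLE D.coneMinf_le_Yplus)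
  comm := rfl

/-- The map `s`, induced by the inclusion `𝒪(W∞) = Y₊ → Y`. -/
noncomputable def s : Yo.obj D.Winf.cone ⟶ Yo.obj D.spaceY :=
  Yo.map (D.Winf.coneMinus.subFunctor.map (homOfLE (le_sup_right : D.Yplus ≤ D.Y)))

/-- The boundary map `∂ : Yoˢ(Y) → Σ Yoˢ(W)` of the decomposition `(Y₋, Y₊)` of `Y`. -/
noncomputable def boundary (h : D.squareY.IsExcisive) : Yo.obj D.spaceY ⟶ suspYo D.spaceW :=
  D.squareY.boundary h

/-- The boundary map `∂' : Yoˢ(Y) → Σ Yoˢ(𝒪(M))` of the decomposition `(ℝ × W, [0,∞) × M∞)`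
of `Y`. -/
noncomputable def boundary' (h : D.squareY'.IsExcisive) : Yo.obj D.spaceY ⟶ suspYo D.M.cone :=
  D.squareY'.boundary h

/-- The boundary map `∂'' : Yoˢ(𝒪(W∞)) → Σ Yoˢ(𝒪(M))` of the decomposition
`([0,∞) × W, [0,∞) × M∞)` of `𝒪(W∞)`. -/
noncomputable def boundary'' (h : D.squareO.IsExcisive) :
    Yo.obj D.Winf.cone ⟶ suspYo D.M.cone :=
  D.squareO.boundary h

/-- The map `i`, induced by the inclusion of `Y` into `𝒪(W∞)₋` and the inverse of `c`. -/
noncomputable def i (h : IsIso D.Winf.unionToGerms) (hc : IsIso (D.Winf.c h)) :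
    Yo.obj D.spaceY ⟶ D.Winf.germs :=
  Yo.map (D.Winf.coneMinus.incl D.Y) ≫ inv (D.Winf.c h)

/-- The map `(t, m) ↦ (max t 0, m)`. -/
noncomputable def toRay (p : D.M.line.space.carrier) : D.M.ray.space.carrier :=
  ⟨(max p.1 0, p.2), ⟨Set.mem_Ici.2 (le_max_right p.1 0), trivial⟩⟩

/-- The map `(t, m) ↦ φ (max t 0, m)`. -/
noncomputable def onCylinder (p : D.M.line.space.carrier) : D.Winf.space.carrier :=
  (BornCoarse.Hom.toFun D.cylinder.hom (D.toRay p) : D.Minf).1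

/-- The morphism `ℝ ⊗ M → Y` which sends `(t, m)` to `(t, m)` for `t ≤ 0`, and to `(0, φ (t, m))`
for `t ≥ 0`, where `φ : [0,∞) ⊗ M ≅ M∞`. As `φ (0, m) = m`, it sends `(t, m)` to
`(min t 0, φ (max t 0, m))`. -/
noncomputable def jTilde : D.M.line.space ⟶ D.spaceY :=
  BornCoarse.codRestrict
    ({ toFun := fun p => (min p.1 0, D.onCylinder p)
       map_smul := fun g p => Prod.ext rfl
        (congrArg Subtype.val (BornCoarse.Hom.map_smul D.cylinder.hom g (D.toRay p)))
       controlled := fun E hE => by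
        obtain ⟨r, F, hF, h⟩ := hE
        have hE' : (fun q => (D.toRay q.1, D.toRay q.2)) '' E ∈ D.M.ray.space.entourages := by
          refine ⟨r, F, hF, ?_⟩
          rintro _ _ ⟨_, ⟨q, hq, rfl⟩, h'⟩
          obtain ⟨rfl, rfl⟩ := Prod.mk.inj h'
          exact ⟨(abs_max_sub_max_le_abs q.1.1 q.2.1 0).trans (h _ _ hq).1, (h _ _ hq).2⟩
        refine ⟨⟨r, _, BornCoarse.Hom.controlled D.cylinder.hom hE', ?_⟩, fun V hV => ⟨0, ?_⟩⟩
        · rintro _ _ ⟨q, hq, h'⟩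
          obtain ⟨rfl, rfl⟩ := Prod.mk.inj h'
          have h0 := (h _ _ hq).1
          refine ⟨(abs_min_sub_min_le_max q.1.1 0 q.2.1 0).trans (max_le h0 ?_),
            ⟨_, ⟨_, ⟨q, hq, rfl⟩, rfl⟩, rfl⟩⟩
          simpa using (abs_nonneg _).trans h0
        · rintro _ _ ⟨q, hq, h'⟩
          obtain ⟨rfl, rfl⟩ := Prod.mk.inj h'
          simp
       proper := fun B hB => by
        have hB' := isBounded_image_fst_and_snd.2 hB
        have h1 := BornCoarse.Hom.proper D.cylinder.hom
          (BornCoarse.Hom.proper (D.Winf.space.incl D.Minf) hB'.2)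
        have h2 := isBounded_image_fst_and_snd.2 (isBounded_image_subtype_val.2 h1)
        refine isBounded_image_fst_and_snd.1 ⟨(hB'.1.add h2.1).subset ?_, h2.2.subset ?_⟩
        · rintro _ ⟨p, hp, rfl⟩
          refine ⟨min p.1 0, ⟨_, hp, rfl⟩, max p.1 0,
            ⟨_, ⟨D.toRay p, ⟨_, hp, rfl⟩, rfl⟩, rfl⟩, ?_⟩
          exact (min_add_max p.1 0).trans (add_zero _)
        · rintro _ ⟨p, hp, rfl⟩
          exact ⟨_, ⟨D.toRay p, ⟨_, hp, rfl⟩, rfl⟩, rfl⟩ } :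
      BornCoarse.Hom D.M.line.space D.Winf.coneMinus) D.Y (fun p => by
        rcases le_total p.1 0 with h | h
        · refine Or.inl ⟨Set.mem_Iic.2 (min_le_right p.1 0), ?_⟩
          have hp : D.toRay p = ⟨(0, p.2), ⟨le_refl (0 : ℝ), trivial⟩⟩ :=
            Subtype.ext (Prod.ext (max_eq_right h) rfl)
          have : D.onCylinder p = p.2.1 := by
            unfold onCylinder
            rw [hp]
            exact D.cylinder_zero p.2
          change D.onCylinder p ∈ D.W
          rw [this]
          exact (Subtype.prop p.2).1
        · exact Or.inr ⟨(min_eq_right h).ge, trivial⟩)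

/-- The map `j : Σ Yoˢ(M) → Yoˢ(Y)`, the composition of the inverse of the suspension equivalence
`Yoˢ(ℝ ⊗ M) → Σ Yoˢ(M)` with `jTilde`. -/
noncomputable def j (h : D.M.lineSquare.IsExcisive) (hs : IsIso (D.M.suspension h)) :
    suspYo D.M.space ⟶ Yo.obj D.spaceY :=
  inv (D.M.suspension h) ≫ Yo.map D.jTilde

end CylindricalEnd

end CoarseMotives

/-! Everything is proved before localizing. Each equivalence is obtained from the statement that
some map of diagrams lies in the smallest localizer, and each identity from a strict identity
between maps of double mapping cylinders; `motive` then turns these into isomorphisms and equations.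
The comparison and collapse maps out of homotopy pushouts can therefore be manipulated although
`GSpX` is only a homotopy category.

Push-out squares. Excision is available only for big families, so one half of each decomposition is
replaced by a big family whose members all retract onto it by maps close to the identity
(`Square.motivicEquivalence_compare_of_family`). For the cuts at `t = 0` the members are `{t ≥ -n}`,
retracted by `(t, x) ↦ (max t 0, x)`. For the cuts along the end, points `φ (t, m)` are pushed down
to their foot `m`. Coarse and uniform excisiveness make height and foot controlled and uniformly
continuous on all of `W∞`. The members are the subsets of the cone on which the height is bounded
and tends to `0` at infinity; exactly this makes the push close to the identity for the hybrid
structure.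

Equivalences. Half-lines are flasque by translation, also `(-∞,0] × A` inside `𝒪(X)₋`, because the
hybrid condition says nothing for `t ≤ 0`. The terminal diagram is motivically empty, so the points
in suspensions and cofibres act as `0`; hence `susp` and `c` are equivalences. The end `M∞` is
flasque and `M → W` is an equivalence, so excision for `W∞ = M∞ ∪ W` makes the motive of `W∞`
vanish, and `𝒪(W∞)` agrees with the germs at infinity.

Commutativity. Mayer–Vietoris boundaries are natural for maps of squares. The inclusion `𝒪(W∞) → Y`
is such a map, with the identity on intersections; `jTilde` is one in two ways, with `M → W` and `M
→ 𝒪(M)` on intersections.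

Splitting. `ℝ ⊗ M` is glued from two empty motives along `M`, and `Y` from the empty motive `Y₋` and
from `Y₊` along `W ≃ M`. Adding `Y₊` as a coproduct summand to the first gluing and then discarding
the empty half `[0,∞) × M` gives the second. Binary coproducts, unlike general push-outs, survive
the passage to the localization. -/

namespace CoarseMotives

variable {G : Type u} [Group G]

/-! ### Homotopy pushouts of diagrams -/

section HomotopyPushout

variable {K A B X K' A' B' K'' A'' B'' : Diag G}

/-- The cylinder part of a homotopy pushout. -/
noncomputable def hpushCyl (f : K ⟶ A) (g : K ⟶ B) : cyl K ⟶ hpush f g :=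
  pushout.inl _ _

theorem cylInl_hpushCyl (f : K ⟶ A) (g : K ⟶ B) :
    cylInl K ≫ hpushCyl f g = f ≫ hpushInl f g := by
  have := coprod.inl ≫= (pushout.condition (f := coprod.desc (cylInl K) (cylInr K))
    (g := coprod.map f g))
  rw [coprod.inl_desc_assoc, coprod.inl_map_assoc] at this
  exact this

theorem cylInr_hpushCyl (f : K ⟶ A) (g : K ⟶ B) :
    cylInr K ≫ hpushCyl f g = g ≫ hpushInr f g := by
  have := coprod.inr ≫= (pushout.condition (f := coprod.desc (cylInl K) (cylInr K))
    (g := coprod.map f g))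
  rw [coprod.inr_desc_assoc, coprod.inr_map_assoc] at this
  exact this

theorem hpush_hom_ext {f : K ⟶ A} {g : K ⟶ B} {φ ψ : hpush f g ⟶ X}
    (hl : hpushInl f g ≫ φ = hpushInl f g ≫ ψ) (hr : hpushInr f g ≫ φ = hpushInr f g ≫ ψ)
    (hc : hpushCyl f g ≫ φ = hpushCyl f g ≫ ψ) : φ = ψ := by
  refine pushout.hom_ext hc (coprod.hom_ext ?_ ?_)
  · rw [← Category.assoc, ← Category.assoc]; exact hl
  · rw [← Category.assoc, ← Category.assoc]; exact hr

/-- The map out of a homotopy pushout given by a homotopy-commutative square. -/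
noncomputable def hpushLift (f : K ⟶ A) (g : K ⟶ B) (a : A ⟶ X) (b : B ⟶ X) (k : cyl K ⟶ X)
    (h₀ : cylInl K ≫ k = f ≫ a) (h₁ : cylInr K ≫ k = g ≫ b) : hpush f g ⟶ X :=
  pushout.desc k (coprod.desc a b) (by
    apply coprod.hom_ext
    · rw [coprod.inl_desc_assoc, coprod.inl_map_assoc, coprod.inl_desc, h₀]
    · rw [coprod.inr_desc_assoc, coprod.inr_map_assoc, coprod.inr_desc, h₁])

section

variable (f : K ⟶ A) (g : K ⟶ B) (a : A ⟶ X) (b : B ⟶ X) (k : cyl K ⟶ X)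
    (h₀ : cylInl K ≫ k = f ≫ a) (h₁ : cylInr K ≫ k = g ≫ b)

@[simp]
theorem hpushInl_lift : hpushInl f g ≫ hpushLift f g a b k h₀ h₁ = a :=
  (Category.assoc _ _ _).trans ((congrArg (coprod.inl ≫ ·) (pushout.inr_desc _ _ _)).trans
    (coprod.inl_desc _ _))

@[simp]
theorem hpushInl_lift_assoc {Z : Diag G} (z : X ⟶ Z) :
    hpushInl f g ≫ hpushLift f g a b k h₀ h₁ ≫ z = a ≫ z := by
  rw [← Category.assoc, hpushInl_lift]

@[simp]
theorem hpushInr_lift : hpushInr f g ≫ hpushLift f g a b k h₀ h₁ = b :=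
  (Category.assoc _ _ _).trans ((congrArg (coprod.inr ≫ ·) (pushout.inr_desc _ _ _)).trans
    (coprod.inr_desc _ _))

@[simp]
theorem hpushInr_lift_assoc {Z : Diag G} (z : X ⟶ Z) :
    hpushInr f g ≫ hpushLift f g a b k h₀ h₁ ≫ z = b ≫ z := by
  rw [← Category.assoc, hpushInr_lift]

@[simp]
theorem hpushCyl_lift : hpushCyl f g ≫ hpushLift f g a b k h₀ h₁ = k :=
  pushout.inl_desc _ _ _

@[simp]
theorem hpushCyl_lift_assoc {Z : Diag G} (z : X ⟶ Z) :
    hpushCyl f g ≫ hpushLift f g a b k h₀ h₁ ≫ z = k ≫ z := by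
  rw [← Category.assoc, hpushCyl_lift]

end

section

variable (f : K ⟶ A) (g : K ⟶ B) (a : A ⟶ X) (b : B ⟶ X) (h : f ≫ a = g ≫ b)

@[simp]
theorem hpushInl_desc : hpushInl f g ≫ hpushDesc f g a b h = a :=
  (Category.assoc _ _ _).trans ((congrArg (coprod.inl ≫ ·) (pushout.inr_desc _ _ _)).trans
    (coprod.inl_desc _ _))

@[simp]
theorem hpushInl_desc_assoc {Z : Diag G} (z : X ⟶ Z) :
    hpushInl f g ≫ hpushDesc f g a b h ≫ z = a ≫ z := by
  rw [← Category.assoc, hpushInl_desc]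

@[simp]
theorem hpushInr_desc : hpushInr f g ≫ hpushDesc f g a b h = b :=
  (Category.assoc _ _ _).trans ((congrArg (coprod.inr ≫ ·) (pushout.inr_desc _ _ _)).trans
    (coprod.inr_desc _ _))

@[simp]
theorem hpushInr_desc_assoc {Z : Diag G} (z : X ⟶ Z) :
    hpushInr f g ≫ hpushDesc f g a b h ≫ z = b ≫ z := by
  rw [← Category.assoc, hpushInr_desc]

@[simp]
theorem hpushCyl_desc : hpushCyl f g ≫ hpushDesc f g a b h = cylProj K ≫ f ≫ a :=
  pushout.inl_desc _ _ _

@[simp]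
theorem hpushCyl_desc_assoc {Z : Diag G} (z : X ⟶ Z) :
    hpushCyl f g ≫ hpushDesc f g a b h ≫ z = cylProj K ≫ f ≫ a ≫ z := by
  rw [← Category.assoc, hpushCyl_desc, Category.assoc, Category.assoc]

end

section

variable {f : K ⟶ A} {g : K ⟶ B} {f' : K' ⟶ A'} {g' : K' ⟶ B'}
  (κ : K ⟶ K') (α : A ⟶ A') (β : B ⟶ B') (hα : f ≫ α = κ ≫ f') (hβ : g ≫ β = κ ≫ g')

@[simp]
theorem hpushInl_map : hpushInl f g ≫ hpushMap κ α β hα hβ = α ≫ hpushInl f' g' := by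
  refine (Category.assoc _ _ _).trans ((congrArg (coprod.inl ≫ ·) (pushout.inr_desc _ _ _)).trans ?_)
  rw [coprod.inl_map_assoc]
  rfl

@[simp]
theorem hpushInl_map_assoc {Z : Diag G} (z : hpush f' g' ⟶ Z) :
    hpushInl f g ≫ hpushMap κ α β hα hβ ≫ z = α ≫ hpushInl f' g' ≫ z := by
  rw [← Category.assoc, hpushInl_map, Category.assoc]

@[simp]
theorem hpushInr_map : hpushInr f g ≫ hpushMap κ α β hα hβ = β ≫ hpushInr f' g' := by
  refine (Category.assoc _ _ _).trans ((congrArg (coprod.inr ≫ ·) (pushout.inr_desc _ _ _)).trans ?_)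
  rw [coprod.inr_map_assoc]
  rfl

@[simp]
theorem hpushInr_map_assoc {Z : Diag G} (z : hpush f' g' ⟶ Z) :
    hpushInr f g ≫ hpushMap κ α β hα hβ ≫ z = β ≫ hpushInr f' g' ≫ z := by
  rw [← Category.assoc, hpushInr_map, Category.assoc]

@[simp]
theorem hpushCyl_map : hpushCyl f g ≫ hpushMap κ α β hα hβ = cylMap κ ≫ hpushCyl f' g' :=
  pushout.inl_desc _ _ _

@[simp]
theorem hpushCyl_map_assoc {Z : Diag G} (z : hpush f' g' ⟶ Z) :
    hpushCyl f g ≫ hpushMap κ α β hα hβ ≫ z = cylMap κ ≫ hpushCyl f' g' ≫ z := by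
  rw [← Category.assoc, hpushCyl_map, Category.assoc]

end

theorem cylMap_proj_assoc (f : K ⟶ K') {Z : Diag G} (z : K' ⟶ Z) :
    cylMap f ≫ cylProj K' ≫ z = cylProj K ≫ f ≫ z := rfl

theorem cylMap_comp (f : K ⟶ K') (g : K' ⟶ K'') : cylMap f ≫ cylMap g = cylMap (f ≫ g) := by
  simp [cylMap]

theorem cylMap_id : cylMap (𝟙 K) = 𝟙 (cyl K) := by
  simp [cylMap]

theorem hpushMap_comp {f : K ⟶ A} {g : K ⟶ B} {f' : K' ⟶ A'} {g' : K' ⟶ B'}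
    {f'' : K'' ⟶ A''} {g'' : K'' ⟶ B''}
    (κ : K ⟶ K') (α : A ⟶ A') (β : B ⟶ B') (hα : f ≫ α = κ ≫ f') (hβ : g ≫ β = κ ≫ g')
    (κ' : K' ⟶ K'') (α' : A' ⟶ A'') (β' : B' ⟶ B'') (hα' : f' ≫ α' = κ' ≫ f'')
    (hβ' : g' ≫ β' = κ' ≫ g'')
    (hα'' : f ≫ α ≫ α' = (κ ≫ κ') ≫ f'') (hβ'' : g ≫ β ≫ β' = (κ ≫ κ') ≫ g'') :
    hpushMap κ α β hα hβ ≫ hpushMap κ' α' β' hα' hβ' =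
      hpushMap (κ ≫ κ') (α ≫ α') (β ≫ β') hα'' hβ'' := by
  apply hpush_hom_ext <;> simp [← cylMap_comp]

theorem hpushMap_desc {f : K ⟶ A} {g : K ⟶ B} {f' : K' ⟶ A'} {g' : K' ⟶ B'}
    (κ : K ⟶ K') (α : A ⟶ A') (β : B ⟶ B') (hα : f ≫ α = κ ≫ f') (hβ : g ≫ β = κ ≫ g')
    (a : A' ⟶ X) (b : B' ⟶ X) (h : f' ≫ a = g' ≫ b) (h' : f ≫ α ≫ a = g ≫ β ≫ b) :
    hpushMap κ α β hα hβ ≫ hpushDesc f' g' a b h = hpushDesc f g (α ≫ a) (β ≫ b) h' := by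
  apply hpush_hom_ext
  · simp
  · simp
  · rw [hpushCyl_map_assoc, hpushCyl_desc, hpushCyl_desc, cylMap_proj_assoc, reassoc_of% hα]

theorem hpushDesc_comp (f : K ⟶ A) (g : K ⟶ B) (a : A ⟶ X) (b : B ⟶ X) (h : f ≫ a = g ≫ b)
    (x : X ⟶ A') (h' : f ≫ a ≫ x = g ≫ b ≫ x) :
    hpushDesc f g a b h ≫ x = hpushDesc f g (a ≫ x) (b ≫ x) h' := by
  apply hpush_hom_ext <;> simp

theorem hpushMap_toSusp {f : K ⟶ A} {g : K ⟶ B} {f' : K' ⟶ A'} {g' : K' ⟶ B'}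
    (κ : K ⟶ K') (α : A ⟶ A') (β : B ⟶ B') (hα : f ≫ α = κ ≫ f') (hβ : g ≫ β = κ ≫ g') :
    hpushMap κ α β hα hβ ≫ hpushToSusp f' g' = hpushToSusp f g ≫ suspMap κ := by
  unfold hpushToSusp suspMap
  rw [hpushMap_comp, hpushMap_comp]
  · congr 1
    · exact terminal.hom_ext _ _
    · exact terminal.hom_ext _ _
  all_goals exact terminal.hom_ext _ _

end HomotopyPushout

/-! ### Motivic equivalences -/

-- Every closure property passes to the intersection of all localizers, since each one is verified
-- separately in every member.
variable (G) in
theorem motivicEquivalence_isLocalizer : IsLocalizer (motivicEquivalence G) where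
  objectwise _ _ f hf _ hW := hW.objectwise f hf
  generators _ _ f hf _ hW := hW.generators f hf
  twoOutOfThree :=
    { comp_mem := fun f g hf hg W hW =>
        haveI := hW.twoOutOfThree
        W.comp_mem f g (hf W hW) (hg W hW)
      of_postcomp := fun f g hg hfg W hW =>
        haveI := hW.twoOutOfThree
        W.of_postcomp f g (hg W hW) (hfg W hW)
      of_precomp := fun f g hf hfg W hW =>
        haveI := hW.twoOutOfThree
        W.of_precomp f g (hf W hW) (hfg W hW) }
  hpush _ _ _ _ _ _ f g f' g' κ α β hα hβ h₁ h₂ h₃ W hW :=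
    hW.hpush f g f' g' κ α β hα hβ (h₁ W hW) (h₂ W hW) (h₃ W hW)
  filtered :=
    { isStableUnderColimitsOfShape := fun _ _ _ =>
        { condition := fun X₁ X₂ c₁ c₂ h₁ h₂ f hf φ hφ W hW =>
            haveI := hW.filtered
            MorphismProperty.IsStableUnderColimitsOfShape.condition (W := W) X₁ X₂ c₁ c₂ h₁ h₂ f
              (fun j => hf j W hW) φ hφ } }

instance : (motivicEquivalence G).HasTwoOutOfThreeProperty :=
  (motivicEquivalence_isLocalizer G).twoOutOfThree

instance : MorphismProperty.IsStableUnderFilteredColimits.{u + 1, u + 1}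
    (motivicEquivalence G) :=
  (motivicEquivalence_isLocalizer G).filtered

theorem SHomotopic.of_map {X Y : SSet.{u}}
    (H : X ⊗ SSet.stdSimplex.obj (SimplexCategory.mk 1) ⟶ Y) :
    SHomotopic (SSet.ι₀ ≫ H) (SSet.ι₁ ≫ H) :=
  ⟨{ h := H
     h₀ := rfl
     h₁ := rfl
     -- The homotopy is relative to the empty subcomplex, so there is nothing to check.
     rel := by
      ext n x
      exact x.1.2.elim }⟩

theorem SHomotopic.exists_map {X Y : SSet.{u}} {f g : X ⟶ Y} (h : SHomotopic f g) :
    ∃ H : X ⊗ SSet.stdSimplex.obj (SimplexCategory.mk 1) ⟶ Y, SSet.ι₀ ≫ H = f ∧ SSet.ι₁ ≫ H = g :=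
  h.elim fun h => ⟨h.h, h.h₀, h.h₁⟩

theorem SHomotopic.precomp {X Y Z : SSet.{u}} (e : X ⟶ Y) {f g : Y ⟶ Z} (h : SHomotopic f g) :
    SHomotopic (e ≫ f) (e ≫ g) := by
  obtain ⟨H, rfl, rfl⟩ := h.exists_map
  exact .of_map (e ▷ _ ≫ H)

theorem SHomotopic.postcomp {X Y Z : SSet.{u}} {f g : X ⟶ Y} (h : SHomotopic f g) (e : Y ⟶ Z) :
    SHomotopic (f ≫ e) (g ≫ e) := by
  obtain ⟨H, rfl, rfl⟩ := h.exists_map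
  exact .of_map (H ≫ e)

theorem eqvGen_sHomotopic_precomp {X Y Z : SSet.{u}} (e : X ⟶ Y) {f g : Y ⟶ Z}
    (h : Relation.EqvGen SHomotopic f g) : Relation.EqvGen SHomotopic (e ≫ f) (e ≫ g) := by
  induction h with
  | rel a b h => exact .rel _ _ (h.precomp e)
  | refl a => exact .refl _
  | symm a b _ ih => exact .symm _ _ ih
  | trans a b c _ _ h1 h2 => exact .trans _ _ _ h1 h2

/-- A deformation retraction is a weak homotopy equivalence. -/
theorem IsWeakHomotopyEquivalence.of_deformation {X Y : SSet.{u}} (r : X ⟶ Y) (i : Y ⟶ X)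
    (hi : i ≫ r = 𝟙 Y) (h : SHomotopic (r ≫ i) (𝟙 X)) : IsWeakHomotopyEquivalence r := by
  intro Z _
  -- Injectivity on homotopy classes needs only the section `i`; surjectivity is where the homotopy
  -- enters.
  refine ⟨fun a b hab => ?_, fun a => ⟨i ≫ a, ?_⟩⟩
  · have := eqvGen_sHomotopic_precomp i hab
    rwa [reassoc_of% hi, reassoc_of% hi] at this
  · have := h.postcomp a
    rw [Category.assoc, Category.id_comp] at this
    exact .rel _ _ this

theorem IsWeakHomotopyEquivalence.of_isIso {X Y : SSet.{u}} (f : X ⟶ Y) [IsIso f] :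
    IsWeakHomotopyEquivalence f := by
  refine .of_deformation f (inv f) (by simp) ?_
  rw [IsIso.hom_inv_id]
  exact .of_map (CartesianMonoidalCategory.fst _ _)

section

variable {K A B X K' A' B' : Diag G}

theorem motivicEquivalence_of_isIso {A B : Diag G} (f : A ⟶ B) [IsIso f] :
    motivicEquivalence G f :=
  (motivicEquivalence_isLocalizer G).objectwise f fun _ => .of_isIso _

instance : (motivicEquivalence G).ContainsIdentities :=
  ⟨fun _ => motivicEquivalence_of_isIso _⟩

/-- A homotopy of diagrams restricts to a simplicial homotopy at every object, so `r` is an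
objectwise weak equivalence. -/
theorem motivicEquivalence_of_deformation {A B : Diag G} (r : A ⟶ B) (i : B ⟶ A)
    (hi : i ≫ r = 𝟙 B) (H : cyl A ⟶ A) (h₀ : cylInl A ≫ H = r ≫ i) (h₁ : cylInr A ≫ H = 𝟙 A) :
    motivicEquivalence G r := by
  refine (motivicEquivalence_isLocalizer G).objectwise r fun q =>
    .of_deformation _ (i.app q) (congrArg (fun f => NatTrans.app f q) hi) ?_
  have e₀ : SSet.ι₀ ≫ H.app q = r.app q ≫ i.app q := congrArg (fun f => NatTrans.app f q) h₀
  have e₁ : SSet.ι₁ ≫ H.app q = 𝟙 (A.obj q) := congrArg (fun f => NatTrans.app f q) h₁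
  rw [← e₀, ← e₁]
  exact .of_map _

theorem motivicEquivalence_hpushMap {f : K ⟶ A} {g : K ⟶ B} {f' : K' ⟶ A'} {g' : K' ⟶ B'}
    {κ : K ⟶ K'} {α : A ⟶ A'} {β : B ⟶ B'} (hα : f ≫ α = κ ≫ f') (hβ : g ≫ β = κ ≫ g')
    (h₁ : motivicEquivalence G κ) (h₂ : motivicEquivalence G α) (h₃ : motivicEquivalence G β) :
    motivicEquivalence G (hpushMap κ α β hα hβ) :=
  (motivicEquivalence_isLocalizer G).hpush _ _ _ _ _ _ _ hα hβ h₁ h₂ h₃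

end

/-! ### Mapping cylinders and the symmetry of homotopy pushouts -/

/-- The functor `K ↦ K × Δ[1]`. -/
noncomputable def cylFunctor : Diag G ⥤ Diag G :=
  (Functor.whiskeringRight _ _ _).obj (tensorRight (SSet.stdSimplex.obj (SimplexCategory.mk 1)))

/-- The product with `Δ[1]` is a left adjoint, simplicial sets being cartesian closed, and colimits
of diagrams are objectwise. Homotopies on a gluing can therefore be defined piece by piece. -/
instance : PreservesColimitsOfSize.{0, 0} (cylFunctor (G := G)) := by
  unfold cylFunctor
  infer_instance

theorem cylMap_coprod_hom_ext {A B X : Diag G} {φ ψ : cyl (A ⨿ B) ⟶ X}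
    (h₁ : cylMap coprod.inl ≫ φ = cylMap coprod.inl ≫ ψ)
    (h₂ : cylMap coprod.inr ≫ φ = cylMap coprod.inr ≫ ψ) : φ = ψ :=
  BinaryCofan.IsColimit.hom_ext
    (mapIsColimitOfPreservesOfIsColimit (cylFunctor (G := G)) _ _ (coprodIsCoprod A B)) h₁ h₂

theorem exists_cylMap_coprod_desc {A B X : Diag G} (a : cyl A ⟶ X) (b : cyl B ⟶ X) :
    ∃ φ : cyl (A ⨿ B) ⟶ X, cylMap coprod.inl ≫ φ = a ∧ cylMap coprod.inr ≫ φ = b := by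
  obtain ⟨φ, h⟩ := BinaryCofan.IsColimit.desc'
    (mapIsColimitOfPreservesOfIsColimit (cylFunctor (G := G)) _ _ (coprodIsCoprod A B)) a b
  exact ⟨φ, h⟩

section

variable {K A B X : Diag G} {f : K ⟶ A} {g : K ⟶ B}

theorem isPushout_cyl_hpush (f : K ⟶ A) (g : K ⟶ B) :
    IsPushout (cylMap (coprod.desc (cylInl K) (cylInr K))) (cylMap (coprod.map f g))
      (cylMap (hpushCyl f g)) (cylMap (pushout.inr _ _ : A ⨿ B ⟶ hpush f g)) :=
  (IsPushout.of_hasPushout (coprod.desc (cylInl K) (cylInr K)) (coprod.map f g)).map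
    (cylFunctor (G := G))

/-- A homotopy on the double mapping cylinder amounts to homotopies on `A`, `B` and the cylinder
which agree at both ends, because taking cylinders preserves the defining push-out and coproduct. -/
theorem exists_cyl_hpush_desc (a : cyl A ⟶ X) (b : cyl B ⟶ X) (k : cyl (cyl K) ⟶ X)
    (h₀ : cylMap (cylInl K) ≫ k = cylMap f ≫ a) (h₁ : cylMap (cylInr K) ≫ k = cylMap g ≫ b) :
    ∃ φ : cyl (hpush f g) ⟶ X, cylMap (hpushInl f g) ≫ φ = a ∧ cylMap (hpushInr f g) ≫ φ = b ∧
      cylMap (hpushCyl f g) ≫ φ = k := by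
  obtain ⟨c, rfl, rfl⟩ := exists_cylMap_coprod_desc a b
  have w : cylMap (coprod.desc (cylInl K) (cylInr K)) ≫ k = cylMap (coprod.map f g) ≫ c := by
    apply cylMap_coprod_hom_ext
    · rw [← Category.assoc, ← Category.assoc, cylMap_comp, cylMap_comp, coprod.inl_desc, h₀,
        coprod.inl_map, ← cylMap_comp, Category.assoc]
    · rw [← Category.assoc, ← Category.assoc, cylMap_comp, cylMap_comp, coprod.inr_desc, h₁,
        coprod.inr_map, ← cylMap_comp, Category.assoc]
  refine ⟨(isPushout_cyl_hpush f g).desc k c w, ?_, ?_, (isPushout_cyl_hpush f g).inl_desc _ _ _⟩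
  · rw [hpushInl, ← cylMap_comp, Category.assoc, (isPushout_cyl_hpush f g).inr_desc]
  · rw [hpushInr, ← cylMap_comp, Category.assoc, (isPushout_cyl_hpush f g).inr_desc]

end

/-- The minimum `Δ[1] × Δ[1] → Δ[1]`. -/
def simplexMin : SSet.stdSimplex.{u}.obj (SimplexCategory.mk 1) ⊗
    SSet.stdSimplex.obj (SimplexCategory.mk 1) ⟶ SSet.stdSimplex.obj (SimplexCategory.mk 1) where
  app _ := TypeCat.ofHom (fun x => SSet.stdSimplex.objEquiv.symm (SimplexCategory.Hom.mk
    (SSet.stdSimplex.asOrderHom x.1 ⊓ SSet.stdSimplex.asOrderHom x.2)))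
  naturality _ _ _ := rfl

/-- The contraction `K × Δ[1] × Δ[1] → K × Δ[1]` onto the end `0`. -/
noncomputable def cylContract (K : Diag G) : cyl (cyl K) ⟶ cyl K where
  app q := (α_ (K.obj q) _ _).hom ≫ K.obj q ◁ simplexMin
  naturality _ _ _ := rfl

theorem cylMap_cylInl_contract (K : Diag G) :
    cylMap (cylInl K) ≫ cylContract K = cylProj K ≫ cylInl K := by
  ext q n x
  refine Prod.ext rfl (SSet.stdSimplex.objEquiv.injective ?_)
  ext i : 3
  exact bot_inf_eq (α := Fin 2) _

theorem cylMap_cylInr_contract (K : Diag G) :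
    cylMap (cylInr K) ≫ cylContract K = 𝟙 _ := by
  ext q n x
  refine Prod.ext rfl (SSet.stdSimplex.objEquiv.injective ?_)
  ext i : 3
  exact top_inf_eq (α := Fin 2) _

theorem cylInl_contract (K : Diag G) :
    cylInl (cyl K) ≫ cylContract K = cylProj K ≫ cylInl K := by
  ext q n x
  refine Prod.ext rfl (SSet.stdSimplex.objEquiv.injective ?_)
  ext i : 3
  exact inf_bot_eq (α := Fin 2) _

theorem cylInr_contract (K : Diag G) :
    cylInr (cyl K) ≫ cylContract K = 𝟙 _ := by
  ext q n x
  refine Prod.ext rfl (SSet.stdSimplex.objEquiv.injective ?_)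
  ext i : 3
  exact inf_top_eq (α := Fin 2) _

section

variable {K A B X : Diag G}

/-- The projection of a mapping cylinder is a motivic equivalence. -/
theorem motivicEquivalence_mappingCylinder (f : K ⟶ A) :
    motivicEquivalence G (hpushDesc f (𝟙 K) (𝟙 A) f
      ((Category.comp_id f).trans (Category.id_comp f).symm)) := by
  -- The deformation is constant on `A`, contracts the cylinder onto its end `0`, and moves the copy
  -- of `K` at the end `1` along the cylinder. At time `0` everything lies in `A`, and at time `1`
  -- it is the identity.
  obtain ⟨H, hl, hr, hc⟩ := exists_cyl_hpush_desc (f := f) (g := 𝟙 K)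
    (cylProj A ≫ hpushInl f (𝟙 K)) (hpushCyl f (𝟙 K)) (cylContract K ≫ hpushCyl f (𝟙 K))
    (by rw [← Category.assoc, cylMap_cylInl_contract, cylMap_proj_assoc, Category.assoc,
          cylInl_hpushCyl])
    (by rw [← Category.assoc, cylMap_cylInr_contract, cylMap_id])
  refine motivicEquivalence_of_deformation _ (hpushInl f (𝟙 K)) (hpushInl_desc _ _ _ _ _) H ?_ ?_
  · apply hpush_hom_ext
    · rw [← Category.assoc, ← cylInl_map, Category.assoc, hl, hpushInl_desc_assoc, ← Category.assoc,
        cylInl_proj]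
    · rw [← Category.assoc, ← cylInl_map, Category.assoc, hr, hpushInr_desc_assoc, cylInl_hpushCyl]
    · rw [← Category.assoc, ← cylInl_map, Category.assoc, hc, hpushCyl_desc_assoc, ← Category.assoc,
        cylInl_contract, Category.assoc, cylInl_hpushCyl]
      simp
  · apply hpush_hom_ext
    · rw [← Category.assoc, ← cylInr_map, Category.assoc, hl, ← Category.assoc,
        cylInr_proj, Category.id_comp, Category.comp_id]
    · rw [← Category.assoc, ← cylInr_map, Category.assoc, hr, cylInr_hpushCyl, Category.id_comp,
        Category.comp_id]
    · rw [← Category.assoc, ← cylInr_map, Category.assoc, hc, ← Category.assoc,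
        cylInr_contract, Category.id_comp, Category.comp_id]

end

section

variable {K A B X : Diag G}

/-- Homotopy pushouts are invariant under equivalences, so `g` may be replaced by `𝟙 K`. What
remains is the mapping cylinder of `f`, where the inclusion of `A` is a section of the projection.
-/
theorem motivicEquivalence_hpushInl (f : K ⟶ A) {g : K ⟶ B} (hg : motivicEquivalence G g) :
    motivicEquivalence G (hpushInl f g) := by
  have h₁ : motivicEquivalence G (hpushInl f (𝟙 K)) := by
    refine (motivicEquivalence G).of_postcomp _ _ (motivicEquivalence_mappingCylinder f) ?_
    rw [hpushInl_desc]
    exact MorphismProperty.id_mem _ _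
  have h₂ : motivicEquivalence G (hpushMap (f := f) (g := 𝟙 K) (f' := f) (g' := g) (𝟙 K) (𝟙 A) g
      ((Category.comp_id f).trans (Category.id_comp f).symm) rfl) :=
    motivicEquivalence_hpushMap _ _ (MorphismProperty.id_mem _ _) (MorphismProperty.id_mem _ _) hg
  have h₃ := (motivicEquivalence G).comp_mem _ _ h₁ h₂
  rwa [hpushInl_map, Category.id_comp] at h₃

/-- The double mapping cylinder of `f` and `g` subdivided at the middle of the cylinder. -/
noncomputable abbrev hpushSubdiv (f : K ⟶ A) (g : K ⟶ B) : Diag G :=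
  hpush f (hpushInr g (𝟙 K))

/-- The reflection of the subdivided double mapping cylinder. -/
noncomputable def hpushSubdivFlip (f : K ⟶ A) (g : K ⟶ B) : hpushSubdiv f g ⟶ hpushSubdiv g f :=
  hpushLift _ _ (hpushInl f (𝟙 K) ≫ hpushInr _ _)
    (hpushLift _ _ (hpushInl _ _) (hpushInr f (𝟙 K) ≫ hpushInr _ _) (hpushCyl _ _)
      (cylInl_hpushCyl _ _) ((cylInr_hpushCyl _ _).trans (Category.id_comp _).symm))
    (hpushCyl f (𝟙 K) ≫ hpushInr _ _)
    (by rw [← Category.assoc, cylInl_hpushCyl, Category.assoc])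
    (by rw [← Category.assoc, cylInr_hpushCyl, hpushInr_lift, Category.id_comp])

/-- The simplicial interval has no automorphism exchanging its ends, so a plain double mapping
cylinder cannot be reflected. After the subdivision both halves have their end `1` at the middle
copy of `K`, and exchanging them is strictly involutive. -/
theorem hpushSubdivFlip_comp (f : K ⟶ A) (g : K ⟶ B) :
    hpushSubdivFlip f g ≫ hpushSubdivFlip g f = 𝟙 _ := by
  unfold hpushSubdivFlip
  apply hpush_hom_ext
  · simp
  · apply hpush_hom_ext <;> simp
  · simp

instance (f : K ⟶ A) (g : K ⟶ B) : IsIso (hpushSubdivFlip f g) :=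
  ⟨_, hpushSubdivFlip_comp f g, hpushSubdivFlip_comp g f⟩

/-- The collapse of half of the cylinder of the subdivided double mapping cylinder. -/
noncomputable def hpushSubdivCollapse (f : K ⟶ A) (g : K ⟶ B) : hpushSubdiv f g ⟶ hpush f g :=
  hpushMap (𝟙 K) (𝟙 A) (hpushDesc g (𝟙 K) (𝟙 B) g
      ((Category.comp_id g).trans (Category.id_comp g).symm))
    ((Category.comp_id f).trans (Category.id_comp f).symm)
    ((hpushInr_desc _ _ _ _ _).trans (Category.id_comp g).symm)

theorem motivicEquivalence_hpushSubdivCollapse (f : K ⟶ A) (g : K ⟶ B) :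
    motivicEquivalence G (hpushSubdivCollapse f g) :=
  motivicEquivalence_hpushMap _ _ (MorphismProperty.id_mem _ _) (MorphismProperty.id_mem _ _)
    (motivicEquivalence_mappingCylinder g)

/-- The comparison with a strictly commuting square is constant along the cylinders, so it does not
see which half is which. -/
theorem hpushSubdivFlip_collapse_desc (f : K ⟶ A) (g : K ⟶ B) (a : A ⟶ X) (b : B ⟶ X)
    (h : f ≫ a = g ≫ b) :
    hpushSubdivFlip f g ≫ hpushSubdivCollapse g f ≫ hpushDesc g f b a h.symm =
      hpushSubdivCollapse f g ≫ hpushDesc f g a b h := by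
  unfold hpushSubdivFlip hpushSubdivCollapse
  apply hpush_hom_ext
  · simp
  · apply hpush_hom_ext
    · simp
    -- On the middle copy of `K` the two sides go around the square in the two different ways.
    · simpa using h
    · simp [cylMap_id]
  · simp [cylMap_id]

/-- Being a homotopy pushout square is symmetric. -/
theorem motivicEquivalence_hpushDesc_symm {f : K ⟶ A} {g : K ⟶ B} {a : A ⟶ X} {b : B ⟶ X}
    {h : f ≫ a = g ≫ b} (hd : motivicEquivalence G (hpushDesc f g a b h)) :
    motivicEquivalence G (hpushDesc g f b a h.symm) := by
  refine (motivicEquivalence G).of_precomp _ _ (motivicEquivalence_hpushSubdivCollapse g f) ?_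
  refine (motivicEquivalence G).of_precomp _ _ (motivicEquivalence_of_isIso (hpushSubdivFlip f g)) ?_
  rw [hpushSubdivFlip_collapse_desc f g a b h]
  exact (motivicEquivalence G).comp_mem _ _ (motivicEquivalence_hpushSubdivCollapse f g) hd

/-! ### Coproducts as homotopy pushouts over the empty diagram -/

variable (G) in
/-- The cylinder on the empty diagram is empty. -/
noncomputable def isInitialCyl : IsInitial (cyl (⊥_ (Diag G))) :=
  IsInitial.isInitialObj (cylFunctor (G := G)) _ initialIsInitial

/-- The map from a coproduct to the corresponding homotopy pushout. -/
noncomputable def coprodToHpush (f : ⊥_ (Diag G) ⟶ A) (g : ⊥_ (Diag G) ⟶ B) :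
    A ⨿ B ⟶ hpush f g :=
  coprod.desc (hpushInl f g) (hpushInr f g)

/-- There is no cylinder to insert over the empty diagram, so the homotopy pushout is the strict
coproduct. -/
instance (f : ⊥_ (Diag G) ⟶ A) (g : ⊥_ (Diag G) ⟶ B) : IsIso (coprodToHpush f g) := by
  refine ⟨hpushLift f g coprod.inl coprod.inr
    ((isInitialCyl G).to _)
    (initialIsInitial.hom_ext _ _) (initialIsInitial.hom_ext _ _), ?_, ?_⟩
  · unfold coprodToHpush
    apply coprod.hom_ext
    · rw [coprod.inl_desc_assoc, hpushInl_lift, Category.comp_id]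
    · rw [coprod.inr_desc_assoc, hpushInr_lift, Category.comp_id]
  · unfold coprodToHpush
    apply hpush_hom_ext
    · rw [hpushInl_lift_assoc, coprod.inl_desc, Category.comp_id]
    · rw [hpushInr_lift_assoc, coprod.inr_desc, Category.comp_id]
    · exact (isInitialCyl G).hom_ext _ _

/-- A localizer is closed under homotopy pushouts, and coproducts are those over the empty diagram.
-/
theorem motivicEquivalence_coprodMap {A' B' : Diag G} {α : A ⟶ A'} {β : B ⟶ B'}
    (hα : motivicEquivalence G α) (hβ : motivicEquivalence G β) :
    motivicEquivalence G (coprod.map α β) := by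
  have h : coprodToHpush (initial.to A) (initial.to B) ≫
      hpushMap (𝟙 _) α β (initialIsInitial.hom_ext _ _) (initialIsInitial.hom_ext _ _) =
      coprod.map α β ≫ coprodToHpush (initial.to A') (initial.to B') := by
    apply coprod.hom_ext <;> simp [coprodToHpush]
  refine (motivicEquivalence G).of_postcomp _ _
    (motivicEquivalence_of_isIso (coprodToHpush (initial.to A') (initial.to B'))) ?_
  rw [← h]
  exact (motivicEquivalence G).comp_mem _ _ (motivicEquivalence_of_isIso _)
    (motivicEquivalence_hpushMap _ _ (MorphismProperty.id_mem _ _) hα hβ)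

end

/-! ### Filtered colimits -/

section Filtered

/-- A localizer is closed under filtered colimits indexed by categories in the universe `u + 1`;
passing to an equivalent index category covers smaller shapes such as `ℕ` or the index of a big
family. -/
theorem motivicEquivalence_colimitsOfShape_le {J : Type*} [Category* J] [IsFiltered J]
    {J' : Type (u + 1)} [Category.{u + 1} J'] (e : J' ≌ J) :
    (motivicEquivalence G).colimitsOfShape J ≤ motivicEquivalence G := by
  have : IsFiltered J' := IsFiltered.of_equivalence e.symm
  rw [← MorphismProperty.colimitsOfShape_eq_of_equivalence _ e]
  exact MorphismProperty.colimitsOfShape_le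

/-- A filtered category is connected, so the constant diagram has colimit `A`, and the induced map
of colimits does not depend on the chosen index. This collapses a big family whose members are all
equivalent to one space. -/
theorem motivicEquivalence_of_const {J : Type u} [Category.{u} J] [IsFiltered J]
    {F : J ⥤ Diag G} {A : Diag G} (α : (Functor.const J).obj A ⟶ F)
    (h : ∀ j, motivicEquivalence G (α.app j)) (j₀ : J) :
    motivicEquivalence G (α.app j₀ ≫ colimit.ι F j₀ : A ⟶ colimit F) := by
  have := IsFiltered.isConnected J
  have key : ∀ {j k : J} (_ : j ⟶ k), (α.app j ≫ colimit.ι F j : A ⟶ colimit F) =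
      α.app k ≫ colimit.ι F k := by
    intro j k f
    rw [← colimit.w F f, ← Category.assoc, ← α.naturality f]
    exact (Category.assoc _ _ _).trans (Category.id_comp _)
  refine motivicEquivalence_colimitsOfShape_le (AsSmall.equiv : J ≌ AsSmall.{u + 1} J).symm _
    (.mk' _ _ _ _ (isColimitConstCocone J A) (colimit.isColimit F) α h _ (fun j => ?_))
  refine (Category.id_comp _).trans ?_
  exact (key (IsFiltered.leftToMax j₀ j)).trans (key (IsFiltered.rightToMax j₀ j)).symm

end Filtered

/-! ### The terminal diagram is motivically empty -/

section Pointed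

/-- The inclusion of the free diagrams on an inclusion of upward closed sets. -/
noncomputable def freeOnMap {S T : UpperSet (ℤ × ℤ)} (h : ∀ q ∈ S, q ∈ T)
    (Z : (BornCoarse G)ᵒᵖ ⥤ SSet.{u + 1}) : (freeOn S).obj Z ⟶ (freeOn T).obj Z :=
  Functor.whiskerLeft (CategoryTheory.Prod.fst (ℤ × ℤ) (BornCoarse G)ᵒᵖ)
    (Functor.whiskerRight
      ({ app := fun _ => TypeCat.ofHom (fun x => ⟨⟨h _ x.down.down⟩⟩) } :
        indicator S ⟶ indicator T)
      (SimplicialObject.const _)) ▷ _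

theorem antidiagonal_mono {n m : ℕ} (h : n ≤ m) :
    ∀ q ∈ UpperSet.Ici ((-n, -n - 1) : ℤ × ℤ), q ∈ UpperSet.Ici ((-m, -m - 1) : ℤ × ℤ) := by
  intro q hq
  rw [UpperSet.mem_Ici_iff] at hq ⊢
  refine le_trans ⟨?_, ?_⟩ hq <;> simp <;> omega

/-- The exhaustion of a constant diagram by free diagrams at positions off the diagonal. -/
noncomputable def offDiagonal (Z : (BornCoarse G)ᵒᵖ ⥤ SSet.{u + 1}) : ℕ ⥤ Diag G where
  obj n := (freeOn (UpperSet.Ici ((-n, -n - 1) : ℤ × ℤ))).obj Z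
  map h := freeOnMap (antidiagonal_mono (leOfHom h)) Z
  map_id _ := rfl
  map_comp _ _ := rfl

/-- The constant diagram as a cocone over its exhaustion. -/
noncomputable def offDiagonalCocone (Z : (BornCoarse G)ᵒᵖ ⥤ SSet.{u + 1}) :
    Cocone (offDiagonal Z) where
  pt := CategoryTheory.Prod.snd (ℤ × ℤ) (BornCoarse G)ᵒᵖ ⋙ Z
  ι :=
    { app := fun _ => CartesianMonoidalCategory.snd _ _
      naturality := fun _ _ _ => rfl }

/-- The sets `{q | (-n, -n-1) ≤ q}` exhaust `ℤ × ℤ`, although none of the points `(-n, -n-1)` lies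
on the diagonal. At a fixed position the free diagram is empty at first and then stays equal to `Z`.
-/
noncomputable def isColimitOffDiagonalCocone (Z : (BornCoarse G)ᵒᵖ ⥤ SSet.{u + 1}) :
    IsColimit (offDiagonalCocone Z) := by
  refine evaluationJointlyReflectsColimits _ fun q => evaluationJointlyReflectsColimits _ fun k =>
    Types.FilteredColimit.isColimitOf _ _ ?_ ?_
  · intro x
    refine ⟨(max (-q.1.1).toNat (-q.1.2 - 1).toNat), ⟨⟨⟨?_⟩⟩, x⟩, rfl⟩
    rw [UpperSet.mem_Ici_iff]
    refine ⟨?_, ?_⟩ <;> simp <;> omega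
  · intro i j x y h
    refine ⟨max i j, homOfLE (le_max_left i j), homOfLE (le_max_right i j), ?_⟩
    exact Prod.ext (ULift.ext _ _ (Subsingleton.elim _ _)) h

/-- The free diagrams in the exhaustion sit at off-diagonal positions, so each is motivically empty,
and so is their filtered colimit. -/
theorem motivicEquivalence_initial_to_const (Z : (BornCoarse G)ᵒᵖ ⥤ SSet.{u + 1}) :
    motivicEquivalence G (initial.to (CategoryTheory.Prod.snd (ℤ × ℤ) (BornCoarse G)ᵒᵖ ⋙ Z)) := by
  have := IsFiltered.isConnected ℕ
  refine motivicEquivalence_colimitsOfShape_le (AsSmall.equiv : ℕ ≌ AsSmall.{u + 1} ℕ).symm _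
    (.mk' _ _ _ _ (isColimitConstCocone ℕ (⊥_ (Diag G))) (isColimitOffDiagonalCocone Z)
      { app := fun n => initial.to ((offDiagonal Z).obj n)
        naturality := fun _ _ _ => initialIsInitial.hom_ext _ _ } (fun n => ?_) _
      (fun _ => initialIsInitial.hom_ext _ _))
  exact (motivicEquivalence_isLocalizer G).generators _
    (.reduced _ (by simp; omega) Z)

-- The terminal diagram is constant in the position, hence motivically empty. This makes the theory
-- pointed: any motivically empty piece may be replaced by a point.
variable (G) in
theorem motivicEquivalence_initial_to_terminal :
    motivicEquivalence G (initial.to (⊤_ (Diag G))) := by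
  have hT : IsTerminal (CategoryTheory.Prod.snd (ℤ × ℤ) (BornCoarse G)ᵒᵖ ⋙
      (⊤_ ((BornCoarse G)ᵒᵖ ⥤ SSet.{u + 1}))) :=
    IsTerminal.isTerminalObj ((Functor.whiskeringLeft _ _ _).obj
      (CategoryTheory.Prod.snd (ℤ × ℤ) (BornCoarse G)ᵒᵖ)) _ terminalIsTerminal
  have h : initial.to (⊤_ (Diag G)) = initial.to _ ≫ (hT.uniqueUpToIso terminalIsTerminal).hom :=
    initialIsInitial.hom_ext _ _
  rw [h]
  exact (motivicEquivalence G).comp_mem _ _ (motivicEquivalence_initial_to_const _)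
    (motivicEquivalence_of_isIso _)

theorem motivicEquivalence_terminal_from {A : Diag G}
    (h : motivicEquivalence G (initial.to A)) : motivicEquivalence G (terminal.from A) := by
  refine (motivicEquivalence G).of_precomp _ _ h ?_
  rw [initialIsInitial.hom_ext (initial.to A ≫ terminal.from A) (initial.to _)]
  exact motivicEquivalence_initial_to_terminal G

theorem motivicEquivalence_of_initial {A B : Diag G} (f : A ⟶ B)
    (hA : motivicEquivalence G (initial.to A)) (hB : motivicEquivalence G (initial.to B)) :
    motivicEquivalence G f := by
  refine (motivicEquivalence G).of_precomp _ _ hA ?_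
  rwa [initialIsInitial.hom_ext (initial.to A ≫ f) (initial.to B)]

end Pointed

/-! ### Coproducts of motives -/

section Coproducts

instance : (motive (G := G)).IsLocalization (motivicEquivalence G) :=
  inferInstanceAs ((motivicEquivalence G).Q.IsLocalization _)

theorem isIso_motive_map {A B : Diag G} {f : A ⟶ B} (h : motivicEquivalence G f) :
    IsIso (motive.map f) :=
  Localization.inverts motive (motivicEquivalence G) f h

/-- A limit cone of shape a pair in the opposite category as a colimit cofan. -/
def isColimitUnopOfIsLimit {C : Type*} [Category* C] {F : Discrete WalkingPair ⥤ Cᵒᵖ} {c : Cone F}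
    (hc : IsLimit c) : IsColimit (BinaryCofan.mk (c.π.app ⟨.left⟩).unop (c.π.app ⟨.right⟩).unop) :=
  let cone {T : C} (a : (F.obj ⟨.left⟩).unop ⟶ T) (b : (F.obj ⟨.right⟩).unop ⟶ T) : Cone F :=
    { pt := op T
      π := Discrete.natTrans (fun j => match j with
        | ⟨.left⟩ => a.op
        | ⟨.right⟩ => b.op) }
  BinaryCofan.isColimitMk (fun s => (hc.lift (cone s.inl s.inr)).unop)
    (fun s => Quiver.Hom.op_inj (hc.fac (cone s.inl s.inr) ⟨.left⟩))
    (fun s => Quiver.Hom.op_inj (hc.fac (cone s.inl s.inr) ⟨.right⟩))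
    (fun s m h₁ h₂ => Quiver.Hom.op_inj (hc.hom_ext fun j => by
      rw [Quiver.Hom.op_unop, hc.fac]
      match j with
      | ⟨.left⟩ => exact congrArg Quiver.Hom.op h₁
      | ⟨.right⟩ => exact congrArg Quiver.Hom.op h₂))

/-- Transport of `motivicEquivalence_coprodMap` to arbitrary coproduct cocones, the form in which
stability is required for the opposite class. -/
theorem motivicEquivalence_of_isColimit {A B P A' B' P' : Diag G} {i : A ⟶ P} {j : B ⟶ P}
    {i' : A' ⟶ P'} {j' : B' ⟶ P'} (hP : IsColimit (BinaryCofan.mk i j))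
    (hP' : IsColimit (BinaryCofan.mk i' j')) {α : A ⟶ A'} {β : B ⟶ B'}
    (hα : motivicEquivalence G α) (hβ : motivicEquivalence G β) {φ : P ⟶ P'}
    (h₁ : i ≫ φ = α ≫ i') (h₂ : j ≫ φ = β ≫ j') : motivicEquivalence G φ := by
  let e : A ⨿ B ≅ P := (coprodIsCoprod A B).coconePointUniqueUpToIso hP
  let e' : A' ⨿ B' ≅ P' := (coprodIsCoprod A' B').coconePointUniqueUpToIso hP'
  have hi : coprod.inl ≫ e.hom = i :=
    (coprodIsCoprod A B).comp_coconePointUniqueUpToIso_hom hP ⟨.left⟩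
  have hj : coprod.inr ≫ e.hom = j :=
    (coprodIsCoprod A B).comp_coconePointUniqueUpToIso_hom hP ⟨.right⟩
  have hi' : coprod.inl ≫ e'.hom = i' :=
    (coprodIsCoprod A' B').comp_coconePointUniqueUpToIso_hom hP' ⟨.left⟩
  have hj' : coprod.inr ≫ e'.hom = j' :=
    (coprodIsCoprod A' B').comp_coconePointUniqueUpToIso_hom hP' ⟨.right⟩
  refine (motivicEquivalence G).of_precomp _ _ (motivicEquivalence_of_isIso e.hom) ?_
  have w : e.hom ≫ φ = coprod.map α β ≫ e'.hom := by
    apply coprod.hom_ext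
    · rw [reassoc_of% hi, h₁, coprod.inl_map_assoc, hi']
    · rw [reassoc_of% hj, h₂, coprod.inr_map_assoc, hj']
  rw [w]
  exact (motivicEquivalence G).comp_mem _ _ (motivicEquivalence_coprodMap hα hβ)
    (motivicEquivalence_of_isIso e'.hom)

instance : (motivicEquivalence G).op.IsStableUnderProductsOfShape WalkingPair where
  condition _ _ _ _ hc₁ hc₂ _ hf _ hφ :=
    motivicEquivalence_of_isColimit (isColimitUnopOfIsLimit hc₂) (isColimitUnopOfIsLimit hc₁)
      (hf ⟨.left⟩) (hf ⟨.right⟩) (congrArg Quiver.Hom.unop (hφ ⟨.left⟩))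
      (congrArg Quiver.Hom.unop (hφ ⟨.right⟩))

/-- A localization functor preserves the finite products under which the inverted class is stable;
this is applied in the opposite category. -/
instance : PreservesColimitsOfShape (Discrete WalkingPair) (motive (G := G)) := by
  have : PreservesLimitsOfShape (Discrete WalkingPair) (motive (G := G)).op :=
    Localization.preservesProductsOfShape _ (motivicEquivalence G).op WalkingPair
  have : PreservesLimitsOfShape (Discrete WalkingPair)ᵒᵖ (motive (G := G)).op :=
    preservesLimitsOfShape_of_equiv (Discrete.opposite _).symm _
  exact preservesColimitsOfShape_of_op _ _

/-- A motivic equivalence out of a coproduct exhibits its target as a coproduct of motives. -/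
theorem nonempty_isColimit_motive {A B X : Diag G} (a : A ⟶ X) (b : B ⟶ X)
    (h : motivicEquivalence G (coprod.desc a b)) :
    Nonempty (IsColimit (BinaryCofan.mk (motive.map a) (motive.map b))) := by
  let e : motive.obj (A ⨿ B) ≅ motive.obj X :=
    @asIso _ _ _ _ (motive.map (coprod.desc a b)) (isIso_motive_map h)
  refine ⟨IsColimit.ofIsoColimit
    (mapIsColimitOfPreservesOfIsColimit (motive (G := G)) _ _ (coprodIsCoprod A B))
    (BinaryCofan.ext e ?_ ?_)⟩
  · exact (motive.map_comp _ _).symm.trans (congrArg motive.map (coprod.inl_desc a b))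
  · exact (motive.map_comp _ _).symm.trans (congrArg motive.map (coprod.inr_desc a b))

end Coproducts

/-! ### Homological properties of motives -/

namespace BornCoarse

theorem hom_ext {X Y : BornCoarse G} {f g : X ⟶ Y} (h : ∀ x, Hom.toFun f x = Hom.toFun g x) :
    f = g :=
  Hom.ext (funext h)

theorem comp_incl_injective {T X : BornCoarse G} {A : SubMulAction G X.carrier}
    {f g : T ⟶ X.sub A} (h : f ≫ X.incl A = g ≫ X.incl A) : f = g :=
  hom_ext fun x => Subtype.ext (congrArg (fun k => Hom.toFun k x) h)

theorem motivicEquivalence_yo_of_isCoarseEquivalence {X Y : BornCoarse G} {f : X ⟶ Y}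
    (h : IsCoarseEquivalence f) : motivicEquivalence G (yo₀.map f) :=
  (motivicEquivalence_isLocalizer G).generators _ (.coarse _ _ _ f h)

theorem motivicEquivalence_initial_yo_of_isFlasque {X : BornCoarse G} (h : X.IsFlasque) :
    motivicEquivalence G (initial.to (yo₀.obj X)) :=
  (motivicEquivalence_isLocalizer G).generators _ (.flasque _ _ h)

end BornCoarse

/-- Excision for a square whose corners are coarsely equivalent to the members of a complementary
pair. -/
theorem Square.motivicEquivalence_compare_of_bigFamily (S : Square G)
    (𝒴 : S.X.BigFamily) (Z : SubMulAction G S.X.carrier) (hZ : 𝒴.IsComplementary Z)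
    (α : S.A ⟶ S.X.sub Z) (hα : BornCoarse.IsCoarseEquivalence α) (wα : α ≫ S.X.incl Z = S.a)
    (β : ∀ i, S.B ⟶ S.X.sub (𝒴.Y i)) (hβ : ∀ i, BornCoarse.IsCoarseEquivalence (β i))
    (wβ : ∀ i, β i ≫ S.X.incl (𝒴.Y i) = S.b)
    (κ : ∀ i, S.K ⟶ S.X.sub (Z ⊓ 𝒴.Y i)) (hκ : ∀ i, BornCoarse.IsCoarseEquivalence (κ i))
    (wκ : ∀ i, κ i ≫ S.X.incl (Z ⊓ 𝒴.Y i) = S.kA ≫ S.a) :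
    motivicEquivalence G S.compare := by
  obtain ⟨i₀⟩ := 𝒴.nonempty
  -- All members are equivalent to the one space `S.B`, and all their intersections with `Z` to
  -- `S.K`, so both colimits are compared with constant diagrams.
  let β' : (Functor.const 𝒴.I).obj (yo₀.obj S.B) ⟶ 𝒴.functor ⋙ S.X.subFunctor ⋙ yo₀ :=
    { app := fun i => yo₀.map (β i)
      naturality := fun i j h => (Category.id_comp _).trans <| by
        refine Eq.trans ?_ (yo₀.map_comp _ _)
        refine congrArg yo₀.map (BornCoarse.comp_incl_injective ?_)
        exact (wβ j).trans (wβ i).symm }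
  let κ' : (Functor.const 𝒴.I).obj (yo₀.obj S.K) ⟶ 𝒴.interFunctor Z ⋙ S.X.subFunctor ⋙ yo₀ :=
    { app := fun i => yo₀.map (κ i)
      naturality := fun i j h => (Category.id_comp _).trans <| by
        refine Eq.trans ?_ (yo₀.map_comp _ _)
        refine congrArg yo₀.map (BornCoarse.comp_incl_injective ?_)
        exact (wκ j).trans (wκ i).symm }
  let b : yo₀.obj S.B ⟶ 𝒴.yoFamily (0, 0) := β'.app i₀ ≫ colimit.ι _ i₀
  let k : yo₀.obj S.K ⟶ 𝒴.yoInter Z (0, 0) := κ'.app i₀ ≫ colimit.ι _ i₀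
  have hb : motivicEquivalence G b := motivicEquivalence_of_const β'
    (fun i => BornCoarse.motivicEquivalence_yo_of_isCoarseEquivalence (hβ i)) i₀
  have hk : motivicEquivalence G k := motivicEquivalence_of_const κ'
    (fun i => BornCoarse.motivicEquivalence_yo_of_isCoarseEquivalence (hκ i)) i₀
  have w₁ : yo₀.map S.kA ≫ yo₀.map α = k ≫ 𝒴.yoInterToSub Z (0, 0) := by
    refine Eq.trans ?_ (Category.assoc _ _ _).symm
    have e : (colimit.ι (𝒴.interFunctor Z ⋙ S.X.subFunctor ⋙ yo₀) i₀ : _ ⟶ 𝒴.yoInter Z (0, 0)) ≫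
        𝒴.yoInterToSub Z (0, 0) = (S.X.subFunctor ⋙ yo₀).map
          (homOfLE inf_le_left : (𝒴.interFunctor Z).obj i₀ ⟶ Z) := colimit.ι_desc _ _
    refine Eq.trans ?_ (congrArg (κ'.app i₀ ≫ ·) e.symm)
    refine (yo₀.map_comp _ _).symm.trans (Eq.trans ?_ (yo₀.map_comp _ _))
    refine congrArg yo₀.map (BornCoarse.comp_incl_injective ?_)
    exact (congrArg (S.kA ≫ ·) wα).trans (wκ i₀).symm
  have w₂ : yo₀.map S.kB ≫ b = k ≫ 𝒴.yoInterToFamily Z (0, 0) := by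
    refine Eq.trans ?_ (Category.assoc _ _ _).symm
    refine Eq.trans ?_ (congrArg (κ'.app i₀ ≫ ·) (ι_colimMap _ _).symm)
    refine (Category.assoc _ _ _).symm.trans (Eq.trans ?_ (Category.assoc _ _ _))
    refine congrArg (· ≫ colimit.ι (𝒴.functor ⋙ S.X.subFunctor ⋙ yo₀) i₀) ?_
    refine (yo₀.map_comp _ _).symm.trans (Eq.trans ?_ (yo₀.map_comp _ _))
    refine congrArg yo₀.map (BornCoarse.comp_incl_injective ?_)
    exact (congrArg (S.kB ≫ ·) (wβ i₀)).trans (S.comm.symm.trans (wκ i₀).symm)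
  -- The comparison map of `S` is an equivalence of homotopy pushouts followed by the excision
  -- generator.
  have e : hpushMap k (yo₀.map α) b w₁ w₂ ≫ hpushDesc _ _ _ _ (𝒴.yo_comm Z (0, 0)) =
      S.compare := by
    unfold Square.compare
    have e₁ : yo₀.map α ≫ yo₀.map (S.X.incl Z) = yo₀.map S.a := by
      rw [← Functor.map_comp, wα]
    have e₂ : b ≫ 𝒴.yoFamilyToSpace (0, 0) = yo₀.map S.b := by
      refine (Category.assoc _ _ _).trans ?_
      refine (congrArg (β'.app i₀ ≫ ·) (colimit.ι_desc _ _)).trans ?_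
      refine (yo₀.map_comp _ _).symm.trans (congrArg yo₀.map (wβ i₀))
    rw [hpushMap_desc]
    · congr 1
    · rw [e₁, e₂, ← Functor.map_comp, ← Functor.map_comp, S.comm]
  rw [← e]
  exact (motivicEquivalence G).comp_mem _ _
    (motivicEquivalence_hpushMap _ _ hk
      (BornCoarse.motivicEquivalence_yo_of_isCoarseEquivalence hα) hb)
    ((motivicEquivalence_isLocalizer G).generators _ (.excision _ _ 𝒴 Z hZ))

/-! ### Embeddings and retractions of bornological coarse spaces -/

namespace BornCoarse

variable {A B X Y P : BornCoarse G}

/-- A morphism which identifies its domain with its image with the induced structures. -/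
structure IsEmbedding (a : A ⟶ X) : Prop where
  injective : Function.Injective (Hom.toFun a)
  mem_entourages : ∀ ⦃E : Set (A.carrier × A.carrier)⦄,
    (fun p : A.carrier × A.carrier => (Hom.toFun a p.1, Hom.toFun a p.2)) '' E ∈ X.entourages →
      E ∈ A.entourages
  isBounded_image : ∀ ⦃B : Set A.carrier⦄, IsBounded B → IsBounded (Hom.toFun a '' B)

theorem isEmbedding_id (X : BornCoarse G) : IsEmbedding (𝟙 X) where
  injective := Function.injective_id
  mem_entourages E h := X.subset_mem h fun p hp => ⟨p, hp, rfl⟩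
  isBounded_image B hB := hB.subset (by rintro _ ⟨x, hx, rfl⟩; exact hx)

theorem isEmbedding_incl (X : BornCoarse G) (A : SubMulAction G X.carrier) :
    IsEmbedding (X.incl A) where
  injective := Subtype.val_injective
  mem_entourages _ h := h
  isBounded_image _ hB := isBounded_image_subtype_val.2 hB

theorem IsEmbedding.comp {f : A ⟶ X} {g : X ⟶ P} (hf : IsEmbedding f) (hg : IsEmbedding g) :
    IsEmbedding (f ≫ g) where
  injective := hg.injective.comp hf.injective
  mem_entourages E h := hf.mem_entourages (hg.mem_entourages (P.subset_mem h (by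
    rintro _ ⟨_, ⟨p, hp, rfl⟩, rfl⟩
    exact ⟨p, hp, rfl⟩)))
  isBounded_image B hB := (hg.isBounded_image (hf.isBounded_image hB)).subset (by
    rintro _ ⟨x, hx, rfl⟩
    exact ⟨_, ⟨x, hx, rfl⟩, rfl⟩)

/-- `a` identifies `A` with a subset of `Z` onto which `Z` retracts, by a retraction which is close
to the identity. -/
structure IsRetract (a : A ⟶ P) (Z : SubMulAction G P.carrier) : Prop where
  isEmbedding : IsEmbedding a
  mem : ∀ t, Hom.toFun a t ∈ Z
  exists_retraction : ∃ ρ : P.carrier → P.carrier,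
    (∀ z ∈ Z, ∃ t, Hom.toFun a t = ρ z) ∧
    (∀ t, ρ (Hom.toFun a t) = Hom.toFun a t) ∧
    (∀ g : G, ∀ z ∈ Z, ρ (g • z) = g • ρ z) ∧
    (∀ E ∈ P.entourages, {p | ∃ x ∈ Z, ∃ y ∈ Z, (x, y) ∈ E ∧ p = (ρ x, ρ y)} ∈ P.entourages) ∧
    {p : P.carrier × P.carrier | p.2 ∈ Z ∧ p.1 = ρ p.2} ∈ P.entourages

/-- The preimage of an invariant subset. -/
def comap (f : X ⟶ P) (Z : SubMulAction G P.carrier) : SubMulAction G X.carrier where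
  carrier := Hom.toFun f ⁻¹' Z
  smul_mem' g x hx := by
    have : Hom.toFun f (g • x) ∈ Z := by
      rw [Hom.map_smul]
      exact Z.smul_mem g hx
    exact this

/-- The inverse is the retraction read in `A` through the embedding. One composite is the identity
because the retraction fixes the image of `A`; the other is close to the identity by assumption. -/
theorem IsRetract.exists_isCoarseEquivalence {a : A ⟶ X} {ι : X ⟶ P}
    {Z : SubMulAction G P.carrier} (h : IsRetract (a ≫ ι) Z) (hι : IsEmbedding ι) :
    ∃ α : A ⟶ X.sub (comap ι Z), IsCoarseEquivalence α ∧ α ≫ X.incl (comap ι Z) = a := by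
  obtain ⟨ρ, hρ, hρa, hρs, hρc, hρi⟩ := h.exists_retraction
  choose r hr using hρ
  let α : A ⟶ X.sub (comap ι Z) := codRestrict a _ h.mem
  let β : X.sub (comap ι Z) ⟶ A :=
    { toFun := fun z => r (Hom.toFun ι z.1) z.2
      map_smul := fun g z => h.isEmbedding.injective (by
        refine (hr _ _).trans (Eq.trans ?_ (Hom.map_smul (a ≫ ι) g _).symm)
        refine Eq.trans ?_ (congrArg (g • ·) (hr _ z.2).symm)
        exact (congrArg ρ (Hom.map_smul ι g z.1)).trans (hρs g _ z.2))
      controlled := fun E hE => h.isEmbedding.mem_entourages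
        (P.subset_mem (hρc _ (ι.controlled hE)) (by
          rintro _ ⟨_, ⟨p, hp, rfl⟩, rfl⟩
          refine ⟨_, p.1.2, _, p.2.2, ⟨_, ⟨p, hp, rfl⟩, rfl⟩, Prod.ext (hr _ _) (hr _ _)⟩))
      proper := fun B hB => by
        -- A point retracted into `B` lies in the thickening of the image of `B` by the inverse of
        -- the closeness entourage.
        have h₁ := P.isBounded_thickening (P.inv_mem hρi) (h.isEmbedding.isBounded_image hB)
        refine isBounded_image_subtype_val.1 ((ι.proper h₁).subset ?_)
        rintro _ ⟨z, hz, rfl⟩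
        exact ⟨_, ⟨_, hz, rfl⟩, z.2, hr _ _⟩ : Hom (X.sub (comap ι Z)) A }
  refine ⟨α, ⟨β, ?_, ?_⟩, rfl⟩
  · refine A.subset_mem A.diag_mem ?_
    rintro _ ⟨t, rfl⟩
    exact h.isEmbedding.injective ((hr _ _).trans (hρa t))
  · refine hι.mem_entourages (P.subset_mem hρi ?_)
    rintro _ ⟨_, ⟨_, ⟨z, rfl⟩, rfl⟩, rfl⟩
    exact ⟨z.2, hr _ _⟩

end BornCoarse

/-- Excision for a square which is embedded into an ambient space. -/
theorem Square.motivicEquivalence_compare_of_family (S : Square G) {P : BornCoarse G}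
    (ι : S.X ⟶ P) (hι : BornCoarse.IsEmbedding ι) {I : Type u} [Preorder I] [IsDirectedOrder I]
    [Nonempty I] (Z : SubMulAction G P.carrier) (Y : I → SubMulAction G P.carrier)
    (mono : Monotone Y)
    (big : ∀ E ∈ P.entourages, ∀ i, ∃ j, ∀ x y : S.X.carrier, BornCoarse.Hom.toFun ι y ∈ Y i →
      (BornCoarse.Hom.toFun ι x, BornCoarse.Hom.toFun ι y) ∈ E → BornCoarse.Hom.toFun ι x ∈ Y j)
    (cover : ∃ i, ∀ x, BornCoarse.Hom.toFun ι x ∈ Z ∨ BornCoarse.Hom.toFun ι x ∈ Y i)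
    (hA : BornCoarse.IsRetract (S.a ≫ ι) Z) (hB : ∀ i, BornCoarse.IsRetract (S.b ≫ ι) (Y i))
    (hK : ∀ i, BornCoarse.IsRetract ((S.kA ≫ S.a) ≫ ι) (Z ⊓ Y i)) :
    motivicEquivalence G S.compare := by
  obtain ⟨α, hα, wα⟩ := hA.exists_isCoarseEquivalence hι
  choose β hβ wβ using fun i => (hB i).exists_isCoarseEquivalence hι
  choose κ hκ wκ using fun i => (hK i).exists_isCoarseEquivalence hι
  exact S.motivicEquivalence_compare_of_bigFamily
    { I := I
      Y := fun i => BornCoarse.comap ι (Y i)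
      mono := fun i j h x hx => mono h hx
      big := fun E hE i => by
        obtain ⟨j, hj⟩ := big _ (ι.controlled hE) i
        refine ⟨j, ?_⟩
        rintro x ⟨y, hy, hxy⟩
        exact hj x y hy ⟨_, hxy, rfl⟩ }
    (BornCoarse.comap ι Z) cover α hα wα β hβ wβ κ hκ wκ

/-! ### Decompositions along a height function -/

namespace BornCoarse

/-- A controlled invariant height function `h` on `P`, together with an equivariant controlled
self-map `ρ` which on each set `{h ≥ -n}` is close to the identity. -/
structure IsHeight (P : BornCoarse G) (h : P.carrier → ℝ) (ρ : P.carrier → P.carrier) : Prop where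
  smul : ∀ (g : G) (x : P.carrier), h (g • x) = h x
  controlled : ∀ E ∈ P.entourages, ∃ R : ℝ, ∀ x y, (x, y) ∈ E → |h x - h y| ≤ R
  retraction_smul : ∀ (g : G) (x : P.carrier), ρ (g • x) = g • ρ x
  retraction_controlled : ∀ E ∈ P.entourages,
    {p | ∃ x y, (x, y) ∈ E ∧ p = (ρ x, ρ y)} ∈ P.entourages
  retraction_close : ∀ n : ℕ, {p : P.carrier × P.carrier | -(n : ℝ) ≤ h p.2 ∧ p.1 = ρ p.2} ∈
    P.entourages

theorem isRetract_of_range {A P : BornCoarse G} {a : A ⟶ P} {Z : SubMulAction G P.carrier}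
    (ha : IsEmbedding a) (h : ∀ t, Hom.toFun a t ∈ Z) (h' : ∀ z ∈ Z, ∃ t, Hom.toFun a t = z) :
    IsRetract a Z where
  isEmbedding := ha
  mem := h
  exists_retraction := by
    refine ⟨id, h', fun _ => rfl, fun _ _ _ => rfl, fun E hE => P.subset_mem hE ?_,
      P.subset_mem P.diag_mem fun p hp => hp.2⟩
    rintro _ ⟨x, _, y, _, hxy, rfl⟩
    exact hxy

end BornCoarse

/-- The sublevel cut `{h ≥ 0}` is thickened to the family `{h ≥ -n}`, which is big because the
height is controlled. On each member `ρ` is close to the identity, so the member retracts onto `S.B`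
and its intersection with `Z` onto `S.K`. -/
theorem Square.motivicEquivalence_compare_of_height (S : Square G) {P : BornCoarse G}
    {h : P.carrier → ℝ} {ρ : P.carrier → P.carrier} (H : P.IsHeight h ρ)
    (ι : S.X ⟶ P) (hι : BornCoarse.IsEmbedding ι) (Z Y₀ : SubMulAction G P.carrier)
    (hX : ∀ x, BornCoarse.Hom.toFun ι x ∈ Y₀)
    (cover : ∀ x, BornCoarse.Hom.toFun ι x ∈ Z ∨ 0 ≤ h (BornCoarse.Hom.toFun ι x))
    (hA : BornCoarse.IsEmbedding (S.a ≫ ι)) (hA₁ : ∀ t, BornCoarse.Hom.toFun (S.a ≫ ι) t ∈ Z)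
    (hA₂ : ∀ z ∈ Z, ∃ t, BornCoarse.Hom.toFun (S.a ≫ ι) t = z)
    (hB : BornCoarse.IsEmbedding (S.b ≫ ι))
    (hB₁ : ∀ t, ρ (BornCoarse.Hom.toFun (S.b ≫ ι) t) = BornCoarse.Hom.toFun (S.b ≫ ι) t ∧
      0 ≤ h (BornCoarse.Hom.toFun (S.b ≫ ι) t))
    (hB₂ : ∀ y ∈ Y₀, ∃ t, BornCoarse.Hom.toFun (S.b ≫ ι) t = ρ y)
    (hK : BornCoarse.IsEmbedding ((S.kA ≫ S.a) ≫ ι))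
    (hK₂ : ∀ y ∈ Z, ∃ t, BornCoarse.Hom.toFun ((S.kA ≫ S.a) ≫ ι) t = ρ y) :
    motivicEquivalence G S.compare := by
  -- Points of `S.K` are viewed in `S.B`, where `ρ` is the identity and the height is nonnegative.
  have hkb : ∀ t, BornCoarse.Hom.toFun ((S.kA ≫ S.a) ≫ ι) t =
      BornCoarse.Hom.toFun (S.b ≫ ι) (BornCoarse.Hom.toFun S.kB t) := by
    intro t
    rw [S.comm]
    rfl
  refine S.motivicEquivalence_compare_of_family ι hι (I := ULift.{u} ℕ) Z
    (fun n => { carrier := {x | x ∈ Y₀ ∧ -(n.down : ℝ) ≤ h x}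
                smul_mem' := fun g x hx => ⟨Y₀.smul_mem g hx.1, by rw [H.smul]; exact hx.2⟩ })
    ?_ ?_ ?_ (BornCoarse.isRetract_of_range hA hA₁ hA₂) (fun n => ?_) (fun n => ?_)
  · intro n m hnm x hx
    have : (n.down : ℝ) ≤ m.down := by exact_mod_cast hnm
    exact ⟨hx.1, by linarith [hx.2]⟩
  · intro E hE n
    obtain ⟨R, hR⟩ := H.controlled E hE
    obtain ⟨m, hm⟩ := exists_nat_ge ((n.down : ℝ) + R)
    refine ⟨⟨m⟩, fun x y hy hxy => ⟨hX x, ?_⟩⟩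
    have h₁ := abs_le.1 (hR _ _ hxy)
    have h₂ := hy.2
    change -(m : ℝ) ≤ _
    linarith [h₁.1]
  · refine ⟨⟨0⟩, fun x => (cover x).imp_right fun hx => ⟨hX x, ?_⟩⟩
    simpa using hx
  · refine ⟨hB, fun t => ⟨hX _, ?_⟩, ρ, fun z hz => hB₂ z hz.1, fun t => (hB₁ t).1,
      fun g z _ => H.retraction_smul g z, fun E hE =>
        P.subset_mem (H.retraction_controlled E hE) ?_,
      P.subset_mem (H.retraction_close n.down) fun p hp => ⟨hp.1.2, hp.2⟩⟩
    · exact le_trans (by simp) (hB₁ t).2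
    · rintro _ ⟨x, _, y, _, hxy, rfl⟩
      exact ⟨x, y, hxy, rfl⟩
  · refine ⟨hK, fun t => ⟨hA₁ _, hX _, ?_⟩, ρ, fun z hz => hK₂ z hz.1, fun t => ?_,
      fun g z _ => H.retraction_smul g z, fun E hE =>
        P.subset_mem (H.retraction_controlled E hE) ?_,
      P.subset_mem (H.retraction_close n.down) fun p hp => ⟨hp.1.2.2, hp.2⟩⟩
    · rw [hkb]
      exact le_trans (by simp) (hB₁ _).2
    · rw [hkb]
      exact (hB₁ _).1
    · rintro _ ⟨x, _, y, _, hxy, rfl⟩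
      exact ⟨x, y, hxy, rfl⟩

namespace UnifBornCoarse

variable (X : UnifBornCoarse G)

theorem isHeight_line : X.line.space.IsHeight (fun p => p.1) (fun p => (max p.1 0, p.2)) where
  smul _ _ := rfl
  controlled E hE := by
    obtain ⟨r, F, -, h⟩ := hE
    exact ⟨r, fun x y hxy => (h x y hxy).1⟩
  retraction_smul _ _ := rfl
  retraction_controlled E hE := by
    obtain ⟨r, F, hF, h⟩ := hE
    refine ⟨r, F, hF, ?_⟩
    rintro _ _ ⟨x, y, hxy, h'⟩
    obtain ⟨rfl, rfl⟩ := Prod.mk.inj h'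
    exact ⟨(abs_max_sub_max_le_abs x.1 y.1 0).trans (h _ _ hxy).1, (h _ _ hxy).2⟩
  retraction_close n := by
    refine ⟨n, _, X.space.diag_mem, ?_⟩
    rintro x y ⟨hy, hx⟩
    obtain rfl : x = (max y.1 0, y.2) := hx
    refine ⟨?_, rfl⟩
    have hn : (0 : ℝ) ≤ n := n.cast_nonneg
    have hy' : -(n : ℝ) ≤ y.1 := hy
    rcases le_total y.1 0 with h | h
    · rw [abs_le]
      simp only [max_eq_right h]
      constructor <;> linarith
    · simp [max_eq_left h]

theorem isHeight_coneMinus : X.coneMinus.IsHeight (fun p => p.1) (fun p => (max p.1 0, p.2)) where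
  smul _ _ := rfl
  controlled E hE := X.isHeight_line.controlled E hE.1
  retraction_smul _ _ := rfl
  retraction_controlled E hE := by
    refine ⟨X.isHeight_line.retraction_controlled E hE.1, fun V hV => ?_⟩
    obtain ⟨S, hS, T, hT, hST⟩ := exists_rect hV
    obtain ⟨ε, hε, hS⟩ := Metric.mem_uniformity_dist.1 hS
    obtain ⟨n, hn⟩ := hE.2 _ (rect_mem (Metric.dist_mem_uniformity hε) hT)
    refine ⟨n, ?_⟩
    rintro _ _ ⟨x, y, hxy, h'⟩
    obtain ⟨rfl, rfl⟩ := Prod.mk.inj h'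
    -- The same `n` works: `max · 0` keeps coordinates `≤ n` below `n`, and being `1`-Lipschitz it
    -- preserves `ε`-closeness.
    have h0 : (0 : ℝ) ≤ n := n.cast_nonneg
    rcases hn x y hxy with h | h
    · exact Or.inl ⟨max_le h.1 h0, max_le h.2 h0⟩
    · refine Or.inr (hST _ _ (hS ?_) h.2)
      rw [Real.dist_eq]
      refine (abs_max_sub_max_le_abs x.1 y.1 0).trans_lt ?_
      have := h.1
      rwa [Set.mem_ofPred_eq, Real.dist_eq] at this
  retraction_close n := by
    -- Only points with `t < 0` are moved, and they end at `t = 0`; the uniform condition is void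
    -- there, so the bound `0` suffices.
    refine ⟨X.isHeight_line.retraction_close n, fun V hV => ⟨0, ?_⟩⟩
    rintro x y ⟨-, hx⟩
    obtain rfl : x = (max y.1 0, y.2) := hx
    rcases le_total y.1 0 with h | h
    · left
      simp [h]
    · right
      have : ((max y.1 0, y.2) : ℝ × X.space.carrier) = y := Prod.ext (max_eq_left h) rfl
      rw [this]
      exact refl_mem_uniformity hV

theorem isEmbedding_zeroLine : BornCoarse.IsEmbedding X.zeroLine where
  injective _ _ h := congrArg Prod.snd h
  mem_entourages E hE := by
    obtain ⟨r, F, hF, h⟩ := hE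
    exact X.space.subset_mem hF fun p hp => (h _ _ ⟨p, hp, rfl⟩).2
  isBounded_image B hB := by
    refine isBounded_image_fst_and_snd.1 ⟨(Bornology.isBounded_singleton (x := (0 : ℝ))).subset ?_,
      hB.subset ?_⟩
    · rintro _ ⟨_, ⟨x, hx, rfl⟩, rfl⟩
      rfl
    · rintro _ ⟨_, ⟨x, hx, rfl⟩, rfl⟩
      exact hx

theorem isEmbedding_zeroConeMinus : BornCoarse.IsEmbedding X.zeroConeMinus where
  injective := X.isEmbedding_zeroLine.injective
  mem_entourages _ hE := X.isEmbedding_zeroLine.mem_entourages hE.1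
  isBounded_image := X.isEmbedding_zeroLine.isBounded_image

theorem motivicEquivalence_lineSquare : motivicEquivalence G X.lineSquare.compare := by
  refine X.lineSquare.motivicEquivalence_compare_of_height X.isHeight_line (𝟙 _)
    (BornCoarse.isEmbedding_id _) (X.strip (Set.Iic 0) ⊤) ⊤ (fun _ => trivial)
    (fun x => (le_total x.1 0).imp (fun h => ⟨h, trivial⟩) id)
    (BornCoarse.isEmbedding_incl _ _) (fun t => t.2) (fun z hz => ⟨⟨z, hz⟩, rfl⟩)
    (BornCoarse.isEmbedding_incl _ _) (fun t => ⟨Prod.ext (max_eq_left t.2.1) rfl, t.2.1⟩)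
    (fun y _ => ⟨⟨(max y.1 0, y.2), le_max_right y.1 0, trivial⟩, rfl⟩) X.isEmbedding_zeroLine
    (fun y hy => ⟨y.2, Prod.ext (max_eq_right hy.1).symm rfl⟩)

theorem motivicEquivalence_coneSquare : motivicEquivalence G X.coneSquare.compare := by
  refine X.coneSquare.motivicEquivalence_compare_of_height X.isHeight_coneMinus (𝟙 _)
    (BornCoarse.isEmbedding_id _) (X.coneStrip (Set.Iic 0) ⊤) ⊤ (fun _ => trivial)
    (fun x => (le_total x.1 0).imp (fun h => ⟨h, trivial⟩) id)
    (BornCoarse.isEmbedding_incl _ _) (fun t => t.2) (fun z hz => ⟨⟨z, hz⟩, rfl⟩)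
    (BornCoarse.isEmbedding_incl _ _) (fun t => ⟨Prod.ext (max_eq_left t.2.1) rfl, t.2.1⟩)
    (fun y _ => ⟨⟨(max y.1 0, y.2), le_max_right y.1 0, trivial⟩, rfl⟩) X.isEmbedding_zeroConeMinus
    (fun y hy => ⟨y.2, Prod.ext (max_eq_right hy.1).symm rfl⟩)

end UnifBornCoarse

theorem CylindricalEnd.motivicEquivalence_squareY (D : CylindricalEnd G) :
    motivicEquivalence G D.squareY.compare := by
  refine D.squareY.motivicEquivalence_compare_of_height D.Winf.isHeight_coneMinus
    (D.Winf.coneMinus.incl D.Y) (BornCoarse.isEmbedding_incl _ _) D.Yminus D.Y (fun x => x.2)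
    (fun x => x.2.imp_right fun h => h.1)
    (BornCoarse.isEmbedding_incl _ D.Yminus) (fun t => t.2) (fun z hz => ⟨⟨z, hz⟩, rfl⟩)
    (BornCoarse.isEmbedding_incl _ D.Yplus) (fun t => ⟨Prod.ext (max_eq_left t.2.1) rfl, t.2.1⟩)
    (fun y _ => ⟨⟨(max y.1 0, y.2), le_max_right y.1 0, trivial⟩, rfl⟩)
    ((BornCoarse.isEmbedding_incl _ _).comp D.Winf.isEmbedding_zeroConeMinus)
    (fun y hy => ⟨⟨y.2, hy.2⟩, Prod.ext (max_eq_right hy.1).symm rfl⟩)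

/-! ### Flasque half-lines -/

namespace BornCoarse

theorem isCoarseEquivalence_of_inverse {X Y : BornCoarse G} {f : X ⟶ Y} (g : Y ⟶ X)
    (h₁ : f ≫ g = 𝟙 X) (h₂ : g ≫ f = 𝟙 Y) : IsCoarseEquivalence f := by
  refine ⟨g, ?_, ?_⟩
  · rw [h₁]
    refine X.subset_mem X.diag_mem ?_
    rintro _ ⟨x, rfl⟩
    rfl
  · rw [h₂]
    refine Y.subset_mem Y.diag_mem ?_
    rintro _ ⟨x, rfl⟩
    rfl

theorem motivicEquivalence_initial_yo_of_isCoarseEquivalence {X Y : BornCoarse G} {f : X ⟶ Y}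
    (hf : IsCoarseEquivalence f) (h : motivicEquivalence G (initial.to (yo₀.obj X))) :
    motivicEquivalence G (initial.to (yo₀.obj Y)) := by
  rw [initialIsInitial.hom_ext (initial.to (yo₀.obj Y)) (initial.to _ ≫ yo₀.map f)]
  exact (motivicEquivalence G).comp_mem _ _ h (motivicEquivalence_yo_of_isCoarseEquivalence hf)

end BornCoarse

namespace UnifBornCoarse

variable (X : UnifBornCoarse G)

/-- The translation of a half-line by `σ`. -/
def shift (T : Set ℝ) (σ : ℝ) (hT : ∀ t ∈ T, t + σ ∈ T) (A : SubMulAction G X.space.carrier) :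
    X.line.space.sub (X.strip T A) ⟶ X.line.space.sub (X.strip T A) :=
  { toFun := fun p : X.strip T A =>
      (⟨(p.1.1 + σ, p.1.2), hT _ p.2.1, p.2.2⟩ : X.strip T A)
    map_smul := fun _ _ => rfl
    controlled := fun E hE => by
      obtain ⟨r, F, hF, h⟩ := hE
      refine ⟨r, F, hF, ?_⟩
      rintro _ _ ⟨_, ⟨p, hp, rfl⟩, h'⟩
      obtain ⟨rfl, rfl⟩ := Prod.mk.inj h'
      have := h _ _ ⟨p, hp, rfl⟩
      exact ⟨(congrArg abs (add_sub_add_right_eq_sub _ _ _)).trans_le this.1, this.2⟩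
    proper := fun B hB => by
      have hB' := isBounded_image_fst_and_snd.2 (isBounded_image_subtype_val.2 hB)
      refine isBounded_image_subtype_val.1 (isBounded_image_fst_and_snd.1
        ⟨(hB'.1.add (isBounded_singleton (x := -σ))).subset ?_, hB'.2.subset ?_⟩)
      · rintro _ ⟨_, ⟨p, hp, rfl⟩, rfl⟩
        exact ⟨_, ⟨_, ⟨_, hp, rfl⟩, rfl⟩, _, rfl, add_neg_cancel_right _ _⟩
      · rintro _ ⟨_, ⟨p, hp, rfl⟩, rfl⟩
        exact ⟨_, ⟨_, hp, rfl⟩, rfl⟩ :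
      BornCoarse.Hom (X.line.space.sub (X.strip T A)) (X.line.space.sub (X.strip T A)) }

theorem shift_iterate (T : Set ℝ) (σ : ℝ) (hT : ∀ t ∈ T, t + σ ∈ T)
    (A : SubMulAction G X.space.carrier) (n : ℕ)
    (p : (X.line.space.sub (X.strip T A)).carrier) :
    ((BornCoarse.Hom.toFun (X.shift T σ hT A))^[n] p).1 = (p.1.1 + n * σ, p.1.2) := by
  induction n with
  | zero => exact Prod.ext ((congrArg (p.1.1 + ·) (by simp)).trans (add_zero _)).symm rfl
  | succ n ih =>
    rw [Function.iterate_succ_apply']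
    change (_ + σ, _) = _
    rw [ih]
    refine Prod.ext ?_ rfl
    change p.1.1 + n * σ + σ = p.1.1 + ((n + 1 : ℕ) : ℝ) * σ
    push_cast
    ring

/-- Translation by `σ = ±1` away from the origin treats both half-lines at once. It moves points by
distance `1`, its iterates preserve all distances, and it leaves every bounded set. -/
theorem isFlasque_strip (T : Set ℝ) (σ : ℝ) (hσ : |σ| = 1) (hT : ∀ t, t ∈ T ↔ 0 ≤ σ * t)
    (A : SubMulAction G X.space.carrier) : (X.line.space.sub (X.strip T A)).IsFlasque := by
  have hσ' : σ * σ = 1 := by rw [← abs_mul_abs_self, hσ, one_mul]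
  have hT' : ∀ t ∈ T, t + σ ∈ T := by
    intro t ht
    rw [hT] at ht ⊢
    rw [mul_add]
    linarith
  refine ⟨X.shift T σ hT' A, ?_, ?_, ?_⟩
  · refine ⟨1, _, X.space.diag_mem, ?_⟩
    rintro _ _ ⟨_, ⟨p, rfl⟩, h'⟩
    obtain ⟨rfl, rfl⟩ := Prod.mk.inj h'
    have h₁ : |p.1.1 + σ - p.1.1| ≤ 1 := by rw [add_sub_cancel_left, hσ]
    exact ⟨h₁, rfl⟩
  · rintro E ⟨r, F, hF, h⟩
    refine ⟨r, F, hF, ?_⟩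
    rintro _ _ ⟨_, hq, h'⟩
    obtain ⟨n, p, hp, rfl⟩ := Set.mem_iUnion.1 hq
    obtain ⟨rfl, rfl⟩ := Prod.mk.inj h'
    have := h _ _ ⟨p, hp, rfl⟩
    have e₁ := X.shift_iterate T σ hT' A n p.1
    have e₂ := X.shift_iterate T σ hT' A n p.2
    rw [e₁, e₂]
    exact ⟨(congrArg abs (add_sub_add_right_eq_sub _ _ _)).trans_le this.1, this.2⟩
  · intro B hB
    have hB' := isBounded_image_fst_and_snd.2 (isBounded_image_subtype_val.2 hB)
    obtain ⟨R, hR⟩ := hB'.1.exists_norm_le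
    -- After `n` steps the real coordinate has absolute value at least `n`, hence larger than the
    -- bound `R` on `B`.
    obtain ⟨n, hn⟩ := exists_nat_gt R
    refine ⟨n, ?_⟩
    rw [Set.eq_empty_iff_forall_notMem]
    rintro _ ⟨⟨p, rfl⟩, hp⟩
    have h₁ := hR _ ⟨_, ⟨_, hp, rfl⟩, rfl⟩
    have e := X.shift_iterate T σ hT' A n p
    rw [e, Real.norm_eq_abs] at h₁
    have h₂ : σ * (p.1.1 + n * σ) ≤ |p.1.1 + n * σ| := by
      refine (le_abs_self _).trans ?_
      rw [abs_mul, hσ, one_mul]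
    have h₃ : σ * (p.1.1 + n * σ) = σ * p.1.1 + n * (σ * σ) := by ring
    rw [h₃, hσ', mul_one] at h₂
    have h₄ := (hT _).1 p.2.1
    linarith

theorem motivicEquivalence_initial_strip_Ici (A : SubMulAction G X.space.carrier) :
    motivicEquivalence G (initial.to (yo₀.obj (X.line.space.sub (X.strip (Set.Ici 0) A)))) :=
  BornCoarse.motivicEquivalence_initial_yo_of_isFlasque
    (X.isFlasque_strip _ 1 (by simp) (fun t => by simp) A)

theorem motivicEquivalence_initial_strip_Iic (A : SubMulAction G X.space.carrier) :
    motivicEquivalence G (initial.to (yo₀.obj (X.line.space.sub (X.strip (Set.Iic 0) A)))) :=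
  BornCoarse.motivicEquivalence_initial_yo_of_isFlasque
    (X.isFlasque_strip _ (-1) (by simp) (fun t => by simp) A)

/-- On the half-line `(-∞,0]` the hybrid coarse structure is the original one. -/
def stripToConeStrip (A : SubMulAction G X.space.carrier) :
    X.line.space.sub (X.strip (Set.Iic 0) A) ⟶ X.coneMinus.sub (X.coneStrip (Set.Iic 0) A) :=
  { toFun := fun p : X.strip (Set.Iic 0) A => (⟨p.1, p.2⟩ : X.coneStrip (Set.Iic 0) A)
    map_smul := fun _ _ => rfl
    controlled := fun E hE => by
      refine ⟨X.line.space.subset_mem hE ?_, fun V hV => ⟨0, ?_⟩⟩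
      · rintro _ ⟨_, ⟨p, hp, rfl⟩, rfl⟩
        exact ⟨p, hp, rfl⟩
      · rintro _ _ ⟨_, ⟨p, hp, rfl⟩, h'⟩
        obtain ⟨rfl, rfl⟩ := Prod.mk.inj h'
        exact Or.inl ⟨p.1.2.1.trans (by simp), p.2.2.1.trans (by simp)⟩
    proper := fun _ hB => hB :
      BornCoarse.Hom (X.line.space.sub (X.strip (Set.Iic 0) A))
        (X.coneMinus.sub (X.coneStrip (Set.Iic 0) A)) }

/-- The inverse of `stripToConeStrip`. -/
def coneStripToStrip (A : SubMulAction G X.space.carrier) :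
    X.coneMinus.sub (X.coneStrip (Set.Iic 0) A) ⟶ X.line.space.sub (X.strip (Set.Iic 0) A) :=
  { toFun := fun p : X.coneStrip (Set.Iic 0) A => (⟨p.1, p.2⟩ : X.strip (Set.Iic 0) A)
    map_smul := fun _ _ => rfl
    controlled := fun E hE => by
      refine X.line.space.subset_mem hE.1 ?_
      rintro _ ⟨_, ⟨p, hp, rfl⟩, rfl⟩
      exact ⟨p, hp, rfl⟩
    proper := fun _ hB => hB :
      BornCoarse.Hom (X.coneMinus.sub (X.coneStrip (Set.Iic 0) A))
        (X.line.space.sub (X.strip (Set.Iic 0) A)) }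

theorem motivicEquivalence_initial_coneStrip_Iic (A : SubMulAction G X.space.carrier) :
    motivicEquivalence G (initial.to (yo₀.obj (X.coneMinus.sub (X.coneStrip (Set.Iic 0) A)))) :=
  BornCoarse.motivicEquivalence_initial_yo_of_isCoarseEquivalence
    (BornCoarse.isCoarseEquivalence_of_inverse (f := X.stripToConeStrip A) (X.coneStripToStrip A)
      rfl rfl)
    (X.motivicEquivalence_initial_strip_Iic A)

end UnifBornCoarse

/-! ### The retraction of a space with a cylindrical end -/

namespace CylindricalEnd

variable (D : CylindricalEnd G)

open Classical in
/-- The height and the foot of a point, which are `t` and `m` at the point `φ (t, m)` of the end,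
and `0` and `w` at a point `w` of `W`. -/
noncomputable def coords (x : D.Winf.space.carrier) : ℝ × D.Winf.space.carrier :=
  if h : x ∈ D.Minf then
    ((BornCoarse.Hom.toFun D.cylinder.inv ⟨x, h⟩ : D.M.strip (Set.Ici 0) ⊤).1.1,
      ((BornCoarse.Hom.toFun D.cylinder.inv ⟨x, h⟩ : D.M.strip (Set.Ici 0) ⊤).1.2 :
        (D.W ⊓ D.Minf : SubMulAction G D.Winf.space.carrier)).1)
  else (0, x)

/-- The height of a point in the cylindrical end. -/
noncomputable def height (x : D.Winf.space.carrier) : ℝ := (D.coords x).1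

/-- The retraction of `W∞` onto `W` along the cylindrical end. -/
noncomputable def foot (x : D.Winf.space.carrier) : D.Winf.space.carrier := (D.coords x).2

theorem hom_inv_apply (x : (D.Winf.sub D.Minf).space.carrier) :
    BornCoarse.Hom.toFun D.cylinder.hom (BornCoarse.Hom.toFun D.cylinder.inv x) = x :=
  congrArg (fun k => BornCoarse.Hom.toFun k x) D.cylinder.inv_hom_id

theorem inv_hom_apply (p : D.M.ray.space.carrier) :
    BornCoarse.Hom.toFun D.cylinder.inv (BornCoarse.Hom.toFun D.cylinder.hom p) = p :=
  congrArg (fun k => BornCoarse.Hom.toFun k p) D.cylinder.hom_inv_id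

/-- The point of the cylinder `[0,∞) × M` corresponding to a point of the end. -/
noncomputable def toCylinder (x : D.Winf.space.carrier) (h : x ∈ D.Minf) :
    D.M.strip (Set.Ici 0) ⊤ := BornCoarse.Hom.toFun D.cylinder.inv ⟨x, h⟩

theorem height_of_mem {x : D.Winf.space.carrier} (h : x ∈ D.Minf) :
    D.height x = (D.toCylinder x h).1.1 := by
  unfold height coords
  rw [dif_pos h]
  rfl

theorem foot_of_mem {x : D.Winf.space.carrier} (h : x ∈ D.Minf) :
    D.foot x = ((D.toCylinder x h).1.2 :
      (D.W ⊓ D.Minf : SubMulAction G D.Winf.space.carrier)).1 := by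
  unfold foot coords
  rw [dif_pos h]
  rfl

/-- The point `m` at the foot of the cylinder. -/
def base (m : (D.W ⊓ D.Minf : SubMulAction G D.Winf.space.carrier)) :
    D.M.strip (Set.Ici 0) ⊤ := ⟨(0, m), le_refl (0 : ℝ), trivial⟩

theorem toCylinder_of_mem_inf {x : D.Winf.space.carrier} (hx : x ∈ D.W ⊓ D.Minf) :
    D.toCylinder x hx.2 = D.base ⟨x, hx⟩ := by
  have h : (⟨x, hx.2⟩ : D.Minf) = BornCoarse.Hom.toFun D.cylinder.hom (D.base ⟨x, hx⟩) :=
    Subtype.ext (D.cylinder_zero ⟨x, hx⟩).symm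
  unfold toCylinder
  rw [h]
  exact D.inv_hom_apply _

/-- On the overlap `M` the two descriptions of the coordinates agree because `φ (0, m) = m`. -/
theorem height_of_mem_W {x : D.Winf.space.carrier} (hx : x ∈ D.W) : D.height x = 0 := by
  by_cases h : x ∈ D.Minf
  · rw [D.height_of_mem h, D.toCylinder_of_mem_inf ⟨hx, h⟩]
    rfl
  · unfold height coords
    rw [dif_neg h]

theorem foot_of_mem_W {x : D.Winf.space.carrier} (hx : x ∈ D.W) : D.foot x = x := by
  by_cases h : x ∈ D.Minf
  · rw [D.foot_of_mem h, D.toCylinder_of_mem_inf ⟨hx, h⟩]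
    rfl
  · unfold foot coords
    rw [dif_neg h]

theorem mem_W_or (x : D.Winf.space.carrier) : x ∈ D.W ∨ x ∈ D.Minf :=
  (D.coarselyExcisive.1 x).symm

theorem foot_mem_inf {x : D.Winf.space.carrier} (h : x ∈ D.Minf) : D.foot x ∈ D.W ⊓ D.Minf := by
  rw [D.foot_of_mem h]
  exact Subtype.prop _

theorem foot_mem_W (x : D.Winf.space.carrier) : D.foot x ∈ D.W := by
  rcases D.mem_W_or x with h | h
  · rwa [D.foot_of_mem_W h]
  · exact (D.foot_mem_inf h).1

theorem height_nonneg (x : D.Winf.space.carrier) : 0 ≤ D.height x := by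
  rcases D.mem_W_or x with h | h
  · rw [D.height_of_mem_W h]
  · rw [D.height_of_mem h]
    exact (D.toCylinder x h).2.1

theorem toCylinder_smul (g : G) {x : D.Winf.space.carrier} (h : x ∈ D.Minf) :
    D.toCylinder (g • x) (D.Minf.smul_mem g h) = g • D.toCylinder x h :=
  BornCoarse.Hom.map_smul D.cylinder.inv g ⟨x, h⟩

theorem height_smul (g : G) (x : D.Winf.space.carrier) : D.height (g • x) = D.height x := by
  rcases D.mem_W_or x with h | h
  · rw [D.height_of_mem_W h, D.height_of_mem_W (D.W.smul_mem g h)]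
  · rw [D.height_of_mem h, D.height_of_mem (D.Minf.smul_mem g h), D.toCylinder_smul]
    rfl

theorem foot_smul (g : G) (x : D.Winf.space.carrier) : D.foot (g • x) = g • D.foot x := by
  rcases D.mem_W_or x with h | h
  · rw [D.foot_of_mem_W h, D.foot_of_mem_W (D.W.smul_mem g h)]
  · rw [D.foot_of_mem h, D.foot_of_mem (D.Minf.smul_mem g h), D.toCylinder_smul]
    rfl

/-! ### Coarse and uniform control of height and foot -/

theorem coarse_end {E : Set (D.Winf.space.carrier × D.Winf.space.carrier)}
    (hE : E ∈ D.Winf.space.entourages) : ∃ R : ℝ, ∃ F ∈ D.Winf.space.entourages,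
      ∀ x ∈ D.Minf, ∀ y ∈ D.Minf, (x, y) ∈ E →
        |D.height x - D.height y| ≤ R ∧ (D.foot x, D.foot y) ∈ F := by
  have hE' : {p : D.Minf × D.Minf | (p.1.1, p.2.1) ∈ E} ∈ (D.Winf.sub D.Minf).space.entourages :=
    D.Winf.space.subset_mem hE (by
      rintro _ ⟨p, hp, rfl⟩
      exact hp)
  obtain ⟨R, F, hF, h⟩ := D.cylinder.inv.controlled hE'
  refine ⟨R, _, hF, fun x hx y hy hxy => ?_⟩
  have := h _ _ ⟨_, ⟨(⟨x, hx⟩, ⟨y, hy⟩), hxy, rfl⟩, rfl⟩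
  rw [D.height_of_mem hx, D.height_of_mem hy, D.foot_of_mem hx, D.foot_of_mem hy]
  exact ⟨this.1, ⟨_, this.2, rfl⟩⟩

/-- This is where coarse excisiveness enters: `E`-close points `x` of the end and `y` of `W` are
both near a point `m` of `M`, whose height is `0` and whose foot is `m`, so control on the end alone
suffices. -/
theorem coarse_mixed {E : Set (D.Winf.space.carrier × D.Winf.space.carrier)}
    (hE : E ∈ D.Winf.space.entourages) : ∃ R : ℝ, ∃ F ∈ D.Winf.space.entourages,
      ∀ x ∈ D.Minf, ∀ y ∈ D.W, (x, y) ∈ E → D.height x ≤ R ∧ (D.foot x, y) ∈ F := by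
  -- The diagonal is added so that `x` itself lies in the thickening of `M∞`.
  obtain ⟨F, hF, hEF⟩ := D.coarselyExcisive.2 _ (D.Winf.space.union_mem hE D.Winf.space.diag_mem)
  obtain ⟨R, F', hF', h⟩ := D.coarse_end hF
  refine ⟨R, _, D.Winf.space.comp_mem hF' (D.Winf.space.comp_mem (D.Winf.space.inv_mem hF) hE),
    fun x hx y hy hxy => ?_⟩
  obtain ⟨m, hm, hxm⟩ := hEF ⟨⟨x, hx, Or.inr rfl⟩, ⟨y, hy, Or.inl hxy⟩⟩
  have := h x hx m hm.1 hxm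
  rw [D.height_of_mem_W hm.2, D.foot_of_mem_W hm.2, sub_zero] at this
  exact ⟨(le_abs_self _).trans this.1, m, this.2, x, hxm, hxy⟩

theorem coarse_coords {E : Set (D.Winf.space.carrier × D.Winf.space.carrier)}
    (hE : E ∈ D.Winf.space.entourages) : ∃ R : ℝ, ∃ F ∈ D.Winf.space.entourages,
      ∀ x y, (x, y) ∈ E → |D.height x - D.height y| ≤ R ∧ (D.foot x, D.foot y) ∈ F := by
  obtain ⟨R₁, F₁, hF₁, h₁⟩ := D.coarse_end hE
  obtain ⟨R₂, F₂, hF₂, h₂⟩ := D.coarse_mixed hE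
  obtain ⟨R₃, F₃, hF₃, h₃⟩ := D.coarse_mixed (D.Winf.space.inv_mem hE)
  -- The entries `0` and `E` serve the pairs inside `W`, where the height vanishes and the foot is
  -- the identity.
  refine ⟨max (max R₁ 0) (max R₂ R₃), (F₁ ∪ E) ∪ (F₂ ∪ {p | (p.2, p.1) ∈ F₃}),
    D.Winf.space.union_mem (D.Winf.space.union_mem hF₁ hE)
      (D.Winf.space.union_mem hF₂ (D.Winf.space.inv_mem hF₃)), fun x y hxy => ?_⟩
  rcases D.mem_W_or x with hx | hx <;> rcases D.mem_W_or y with hy | hy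
  · rw [D.height_of_mem_W hx, D.height_of_mem_W hy, D.foot_of_mem_W hx, D.foot_of_mem_W hy]
    exact ⟨by simp, Or.inl (Or.inr hxy)⟩
  · obtain ⟨a, b⟩ := h₃ y hy x hx hxy
    rw [D.height_of_mem_W hx, D.foot_of_mem_W hx, zero_sub, abs_neg,
      abs_of_nonneg (D.height_nonneg y)]
    exact ⟨a.trans (by simp), Or.inr (Or.inr b)⟩
  · obtain ⟨a, b⟩ := h₂ x hx y hy hxy
    rw [D.height_of_mem_W hy, D.foot_of_mem_W hy, sub_zero, abs_of_nonneg (D.height_nonneg x)]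
    exact ⟨a.trans (by simp), Or.inr (Or.inl b)⟩
  · obtain ⟨a, b⟩ := h₁ x hx y hy hxy
    exact ⟨a.trans (by simp), Or.inl (Or.inl b)⟩

theorem uniform_end {ε : ℝ} (hε : 0 < ε)
    {V : Set (D.Winf.space.carrier × D.Winf.space.carrier)} (hV : V ∈ 𝓤 D.Winf.space.carrier) :
    ∃ U ∈ 𝓤 D.Winf.space.carrier, ∀ x ∈ D.Minf, ∀ y ∈ D.Minf, (x, y) ∈ U →
        |D.height x - D.height y| < ε ∧ (D.foot x, D.foot y) ∈ V := by
  have hV' : {p : D.M.space.carrier × D.M.space.carrier | ((p.1 : (D.W ⊓ D.Minf :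
      SubMulAction G D.Winf.space.carrier)).1, (p.2 : (D.W ⊓ D.Minf :
      SubMulAction G D.Winf.space.carrier)).1) ∈ V} ∈ 𝓤 D.M.space.carrier :=
    Filter.preimage_mem_comap hV
  have hR := UnifBornCoarse.rect_mem (Metric.dist_mem_uniformity hε) hV'
  have hR' : {p : D.M.ray.space.carrier × D.M.ray.space.carrier |
      ((p.1 : D.M.strip (Set.Ici 0) ⊤).1, (p.2 : D.M.strip (Set.Ici 0) ⊤).1) ∈ _} ∈
      𝓤 D.M.ray.space.carrier := Filter.preimage_mem_comap hR
  obtain ⟨U, hU, hUU⟩ := uniformContinuous_def.1 D.cylinder.uniformContinuous_inv _ hR'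
  refine ⟨U, hU, fun x hx y hy hxy => ?_⟩
  have : ((⟨x, hx⟩ : D.Minf), (⟨y, hy⟩ : D.Minf)) ∈ _ := hUU hxy
  obtain ⟨a, b⟩ := this
  rw [D.height_of_mem hx, D.height_of_mem hy, D.foot_of_mem hx, D.foot_of_mem hy]
  rw [Set.mem_ofPred_eq, Real.dist_eq] at a
  exact ⟨a, b⟩

/-- The uniform analogue of `coarse_mixed`, with uniform excisiveness supplying the nearby point of
`M`. -/
theorem uniform_mixed {ε : ℝ} (hε : 0 < ε)
    {V : Set (D.Winf.space.carrier × D.Winf.space.carrier)} (hV : V ∈ 𝓤 D.Winf.space.carrier) :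
    ∃ U ∈ 𝓤 D.Winf.space.carrier, ∀ x ∈ D.Minf, ∀ y ∈ D.W, (x, y) ∈ U →
        D.height x < ε ∧ (D.foot x, y) ∈ V := by
  obtain ⟨V', hV', hVV'⟩ := comp_mem_uniformity_sets hV
  obtain ⟨V'', hV'', hVV''⟩ := comp_mem_uniformity_sets hV'
  obtain ⟨U, hU, h⟩ := D.uniform_end hε hV'
  obtain ⟨-, V₀, hV₀, -, s, hs, hs'⟩ := D.uniformlyExcisive
  -- The relation `s U'` must be small in two ways: for the control on the end, and to go back from
  -- `m` to `x` inside `V''`. The chain is `foot x`, `m`, `x`, `y`, with the last two steps in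
  -- `V''`.
  obtain ⟨U', hU', hinv, hUV, hsU⟩ := hs' _ (Filter.inter_mem hU (symm_le_uniformity hV''))
  refine ⟨U' ∩ V'', Filter.inter_mem hU' hV'', fun x hx y hy hxy => ?_⟩
  obtain ⟨m, hm, hxm⟩ := (hs U' hUV hinv).2 ⟨⟨x, hx, refl_mem_uniformity hU'⟩, ⟨y, hy, hxy.1⟩⟩
  have := h x hx m hm.1 (hsU hxm).1
  rw [D.height_of_mem_W hm.2, D.foot_of_mem_W hm.2, sub_zero] at this
  exact ⟨(le_abs_self _).trans_lt this.1,
    hVV' ⟨m, this.2, hVV'' ⟨x, (hsU hxm).2, hxy.2⟩⟩⟩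

theorem uniform_coords {ε : ℝ} (hε : 0 < ε)
    {V : Set (D.Winf.space.carrier × D.Winf.space.carrier)} (hV : V ∈ 𝓤 D.Winf.space.carrier) :
    ∃ U ∈ 𝓤 D.Winf.space.carrier, ∀ x y, (x, y) ∈ U →
        |D.height x - D.height y| < ε ∧ (D.foot x, D.foot y) ∈ V := by
  obtain ⟨U₁, hU₁, h₁⟩ := D.uniform_end hε hV
  obtain ⟨U₂, hU₂, h₂⟩ := D.uniform_mixed hε hV
  obtain ⟨U₃, hU₃, h₃⟩ := D.uniform_mixed hε (symm_le_uniformity hV)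
  refine ⟨(U₁ ∩ V) ∩ (U₂ ∩ {p | (p.2, p.1) ∈ U₃}), Filter.inter_mem (Filter.inter_mem hU₁ hV)
    (Filter.inter_mem hU₂ (symm_le_uniformity hU₃)), fun x y hxy => ?_⟩
  rcases D.mem_W_or x with hx | hx <;> rcases D.mem_W_or y with hy | hy
  · rw [D.height_of_mem_W hx, D.height_of_mem_W hy, D.foot_of_mem_W hx, D.foot_of_mem_W hy]
    exact ⟨by simpa using hε, hxy.1.2⟩
  · obtain ⟨a, b⟩ := h₃ y hy x hx hxy.2.2
    rw [D.height_of_mem_W hx, D.foot_of_mem_W hx, zero_sub, abs_neg,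
      abs_of_nonneg (D.height_nonneg y)]
    exact ⟨a, b⟩
  · obtain ⟨a, b⟩ := h₂ x hx y hy hxy.2.1
    rw [D.height_of_mem_W hy, D.foot_of_mem_W hy, sub_zero, abs_of_nonneg (D.height_nonneg x)]
    exact ⟨a, b⟩
  · exact h₁ x hx y hy hxy.1.1

/-! ### Closeness of the foot map to the identity at small height -/

theorem cylinder_hom_base (m : (D.W ⊓ D.Minf : SubMulAction G D.Winf.space.carrier)) :
    (BornCoarse.Hom.toFun D.cylinder.hom (D.base m) : D.Minf).1 = m.1 := D.cylinder_zero m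

theorem cylinder_hom_toCylinder {x : D.Winf.space.carrier} (h : x ∈ D.Minf) :
    (BornCoarse.Hom.toFun D.cylinder.hom (D.toCylinder x h) : D.Minf).1 = x :=
  congrArg Subtype.val (D.hom_inv_apply ⟨x, h⟩)

/-- In the cylinder the points `(0, m)` and `(t, m)` with `t ≤ R` form an entourage, and `φ` is
controlled. -/
theorem coarse_foot (R : ℝ) : {p : D.Winf.space.carrier × D.Winf.space.carrier |
    D.height p.2 ≤ R ∧ p.1 = D.foot p.2} ∈ D.Winf.space.entourages := by
  have hE : {p : D.M.strip (Set.Ici 0) ⊤ × D.M.strip (Set.Ici 0) ⊤ |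
      p.1 = D.base p.2.1.2 ∧ p.2.1.1 ≤ R} ∈ D.M.ray.space.entourages := by
    refine ⟨R, _, D.M.space.diag_mem, ?_⟩
    rintro _ _ ⟨⟨p, q⟩, ⟨hp, hq⟩, h'⟩
    obtain ⟨rfl, rfl⟩ := Prod.mk.inj h'
    have h0 : (0 : ℝ) ≤ q.1.1 := q.2.1
    obtain rfl : p = D.base q.1.2 := hp
    refine ⟨?_, rfl⟩
    change |0 - q.1.1| ≤ R
    rw [zero_sub, abs_neg, abs_of_nonneg h0]
    exact hq
  refine D.Winf.space.subset_mem (D.Winf.space.union_mem (D.cylinder.hom.controlled hE)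
    D.Winf.space.diag_mem) ?_
  rintro ⟨y, x⟩ ⟨hx, hy⟩
  obtain rfl : y = D.foot x := hy
  change D.height x ≤ R at hx
  rcases D.mem_W_or x with h | h
  · exact Or.inr (D.foot_of_mem_W h)
  · left
    refine ⟨_, ⟨(D.base (D.toCylinder x h).1.2, D.toCylinder x h), ⟨rfl, ?_⟩, rfl⟩, ?_⟩
    · rw [D.height_of_mem h] at hx
      exact hx
    · refine Prod.ext ?_ (D.cylinder_hom_toCylinder h)
      exact (D.cylinder_hom_base _).trans (D.foot_of_mem h).symm

/-- Uniform continuity of `φ`, applied to `(0, m)` and `(t, m)`, gives an `ε` which does not depend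
on `m`. It is what turns decay of the height into hybrid closeness. -/
theorem uniform_foot {V : Set (D.Winf.space.carrier × D.Winf.space.carrier)}
    (hV : V ∈ 𝓤 D.Winf.space.carrier) : ∃ ε > 0, ∀ x, D.height x < ε → (D.foot x, x) ∈ V := by
  have hV' : {p : (D.Winf.sub D.Minf).space.carrier × (D.Winf.sub D.Minf).space.carrier |
      ((p.1 : D.Minf).1, (p.2 : D.Minf).1) ∈ V} ∈ 𝓤 (D.Winf.sub D.Minf).space.carrier :=
    Filter.preimage_mem_comap hV
  obtain ⟨U, hU, hUU⟩ := uniformContinuous_def.1 D.cylinder.uniformContinuous_hom _ hV'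
  obtain ⟨S, hS, T, hT, hST⟩ := UnifBornCoarse.exists_rect hU
  obtain ⟨ε, hε, hS⟩ := Metric.mem_uniformity_dist.1 hS
  refine ⟨ε, hε, fun x hx => ?_⟩
  rcases D.mem_W_or x with h | h
  · rw [D.foot_of_mem_W h]
    exact refl_mem_uniformity hV
  · have h0 : (0 : ℝ) ≤ (D.toCylinder x h).1.1 := (D.toCylinder x h).2.1
    rw [D.height_of_mem h] at hx
    have h₁ : ((D.base (D.toCylinder x h).1.2).1, (D.toCylinder x h).1) ∈ U := by
      refine hST _ _ (hS ?_) (refl_mem_uniformity hT)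
      rw [Real.dist_eq]
      change |0 - (D.toCylinder x h).1.1| < ε
      rwa [zero_sub, abs_neg, abs_of_nonneg h0]
    have h₂ : ((BornCoarse.Hom.toFun D.cylinder.hom (D.base (D.toCylinder x h).1.2) : D.Minf).1,
      (BornCoarse.Hom.toFun D.cylinder.hom (D.toCylinder x h) : D.Minf).1) ∈ V :=
      hUU (a := (D.base (D.toCylinder x h).1.2, D.toCylinder x h)) h₁
    have e : (D.foot x, x) =
        ((BornCoarse.Hom.toFun D.cylinder.hom (D.base (D.toCylinder x h).1.2) : D.Minf).1,
          (BornCoarse.Hom.toFun D.cylinder.hom (D.toCylinder x h) : D.Minf).1) :=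
      Prod.ext ((D.foot_of_mem h).trans (D.cylinder_hom_base _).symm)
        (D.cylinder_hom_toCylinder h).symm
    rwa [e]

end CylindricalEnd

/-! ### Decompositions along the cylindrical end -/

namespace UnifBornCoarse

/-- The uniform structure on `A` is induced, so its entourages extend to entourages of `X`; hence
the hybrid condition in `X` implies the one in `A`. -/
theorem isEmbedding_coneOfSub (X : UnifBornCoarse G) (A : SubMulAction G X.space.carrier) :
    BornCoarse.IsEmbedding (X.coneOfSub A) where
  injective := by
    rintro ⟨⟨t, x⟩, hp⟩ ⟨⟨s, y⟩, hq⟩ h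
    obtain ⟨h₁, h₂⟩ := Prod.mk.inj h
    exact Subtype.ext (Prod.ext h₁ (Subtype.ext h₂))
  mem_entourages E hE := by
    obtain ⟨⟨r, F, hF, h⟩, hE'⟩ := hE
    refine ⟨⟨r, {p | ((p.1 : A).1, (p.2 : A).1) ∈ F}, X.space.subset_mem hF ?_, ?_⟩,
      fun V hV => ?_⟩
    · rintro _ ⟨p, hp, rfl⟩
      exact hp
    · rintro _ _ ⟨p, hp, h'⟩
      obtain ⟨rfl, rfl⟩ := Prod.mk.inj h'
      exact h _ _ ⟨p, hp, rfl⟩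
    · obtain ⟨S, hS, T, hT, hST⟩ := exists_rect (α := (X.sub A).space.carrier) hV
      obtain ⟨T', hT', hTT'⟩ := Filter.mem_comap.1 hT
      obtain ⟨n, hn⟩ := hE' _ (rect_mem hS hT')
      refine ⟨n, ?_⟩
      rintro _ _ ⟨p, hp, h'⟩
      obtain ⟨rfl, rfl⟩ := Prod.mk.inj h'
      exact (hn _ _ ⟨p, hp, rfl⟩).imp id fun h => hST _ _ h.1 (hTT' h.2)
  isBounded_image B hB := by
    have hB' := isBounded_image_fst_and_snd.2 (isBounded_image_subtype_val.2 hB)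
    refine isBounded_image_fst_and_snd.1 ⟨hB'.1.subset ?_,
      (isBounded_image_subtype_val.2 hB'.2).subset ?_⟩
    · rintro _ ⟨_, ⟨p, hp, rfl⟩, rfl⟩
      exact ⟨_, ⟨p, hp, rfl⟩, rfl⟩
    · rintro _ ⟨_, ⟨p, hp, rfl⟩, rfl⟩
      exact ⟨_, ⟨_, ⟨p, hp, rfl⟩, rfl⟩, rfl⟩

end UnifBornCoarse

/-- The square with its two legs exchanged. -/
def Square.flip (S : Square G) : Square G where
  kA := S.kB
  kB := S.kA
  a := S.b
  b := S.a
  comm := S.comm.symm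

theorem Square.motivicEquivalence_compare_of_flip {S : Square G}
    (h : motivicEquivalence G S.flip.compare) : motivicEquivalence G S.compare :=
  motivicEquivalence_hpushDesc_symm h

namespace CylindricalEnd

variable (D : CylindricalEnd G)

/-- The map `(t, x) ↦ (t, ρ x)`, where `ρ` is the retraction onto `W`. -/
noncomputable def coneFoot (p : D.Winf.coneMinus.carrier) : D.Winf.coneMinus.carrier :=
  (p.1, D.foot p.2)

theorem coneFoot_controlled {E : Set (D.Winf.coneMinus.carrier × D.Winf.coneMinus.carrier)}
    (hE : E ∈ D.Winf.coneMinus.entourages) :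
    {p | ∃ x y, (x, y) ∈ E ∧ p = (D.coneFoot x, D.coneFoot y)} ∈
      D.Winf.coneMinus.entourages := by
  obtain ⟨⟨r, F, hF, h⟩, hE'⟩ := hE
  obtain ⟨R, F', hF', h'⟩ := D.coarse_coords hF
  refine ⟨⟨r, F', hF', ?_⟩, fun V hV => ?_⟩
  · rintro _ _ ⟨x, y, hxy, e⟩
    obtain ⟨rfl, rfl⟩ := Prod.mk.inj e
    exact ⟨(h _ _ hxy).1, (h' _ _ (h _ _ hxy).2).2⟩
  · obtain ⟨S, hS, T, hT, hST⟩ := UnifBornCoarse.exists_rect (α := D.Winf.space.carrier) hV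
    obtain ⟨U, hU, hUT⟩ := D.uniform_coords one_pos hT
    obtain ⟨n, hn⟩ := hE' _ (UnifBornCoarse.rect_mem hS hU)
    refine ⟨n, ?_⟩
    rintro _ _ ⟨x, y, hxy, e⟩
    obtain ⟨rfl, rfl⟩ := Prod.mk.inj e
    exact (hn _ _ hxy).imp id fun h => hST _ _ h.1 (hUT _ _ h.2).2

/-- The height is bounded on `C`, and tends to `0` at `∞`. -/
def Decays (C : SubMulAction G D.Winf.coneMinus.carrier) : Prop :=
  (∃ R, ∀ p ∈ C, D.height p.2 ≤ R) ∧ ∀ ε > 0, ∃ n : ℕ, ∀ p ∈ C, (n : ℝ) < p.1 → D.height p.2 < ε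

variable {D}

theorem Decays.sup {C C' : SubMulAction G D.Winf.coneMinus.carrier} (h : D.Decays C)
    (h' : D.Decays C') : D.Decays (C ⊔ C') := by
  obtain ⟨⟨R, hR⟩, hε⟩ := h
  obtain ⟨⟨R', hR'⟩, hε'⟩ := h'
  refine ⟨⟨max R R', fun p hp => ?_⟩, fun ε hε₀ => ?_⟩
  · rcases hp with hp | hp
    · exact (hR p hp).trans (le_max_left _ _)
    · exact (hR' p hp).trans (le_max_right _ _)
  · obtain ⟨n, hn⟩ := hε ε hε₀
    obtain ⟨n', hn'⟩ := hε' ε hε₀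
    refine ⟨max n n', fun p hp hpn => ?_⟩
    rw [Nat.cast_max, max_lt_iff] at hpn
    rcases hp with hp | hp
    · exact hn p hp hpn.1
    · exact hn' p hp hpn.2

theorem Decays.of_le_W {C : SubMulAction G D.Winf.coneMinus.carrier} (h : ∀ p ∈ C, p.2 ∈ D.W) :
    D.Decays C :=
  ⟨⟨0, fun p hp => (D.height_of_mem_W (h p hp)).le⟩, fun ε hε => ⟨0, fun p hp _ => by
    rwa [D.height_of_mem_W (h p hp)]⟩⟩

/-- Boundedness of the height gives coarse closeness to the foot. For a given uniform entourage, the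
height is below the `ε` of `uniform_foot` once `t` is large, which is the hybrid condition. -/
theorem Decays.coneFoot_close {C : SubMulAction G D.Winf.coneMinus.carrier} (h : D.Decays C) :
    {p : D.Winf.coneMinus.carrier × D.Winf.coneMinus.carrier |
      p.2 ∈ C ∧ p.1 = D.coneFoot p.2} ∈ D.Winf.coneMinus.entourages := by
  obtain ⟨⟨R, hR⟩, hε⟩ := h
  refine ⟨⟨0, _, D.coarse_foot R, ?_⟩, fun V hV => ?_⟩
  · rintro x y ⟨hy, hx⟩
    obtain rfl : x = D.coneFoot y := hx
    refine ⟨?_, hR y hy, rfl⟩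
    change |y.1 - y.1| ≤ 0
    rw [sub_self, abs_zero]
  · obtain ⟨S, hS, T, hT, hST⟩ := UnifBornCoarse.exists_rect (α := D.Winf.space.carrier) hV
    obtain ⟨ε, hε₀, hεT⟩ := D.uniform_foot hT
    obtain ⟨n, hn⟩ := hε ε hε₀
    refine ⟨n, ?_⟩
    rintro x y ⟨hy, hx⟩
    obtain rfl : x = D.coneFoot y := hx
    rcases le_or_gt y.1 (n : ℝ) with h | h
    · exact Or.inl ⟨h, h⟩
    · exact Or.inr (hST _ _ (refl_mem_uniformity hS) (hεT _ (hn y hy h)))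

/-- The part in `Y₀` of the thickening of `C` by an invariant relation. -/
def thicken {E : Set (D.Winf.coneMinus.carrier × D.Winf.coneMinus.carrier)}
    (hE : IsInvariant G E) (C Y₀ : SubMulAction G D.Winf.coneMinus.carrier) :
    SubMulAction G D.Winf.coneMinus.carrier where
  carrier := {p | p ∈ Y₀ ∧ ∃ q ∈ C, (p, q) ∈ E}
  smul_mem' g p := by
    rintro ⟨hp, q, hq, hpq⟩
    exact ⟨Y₀.smul_mem g hp, g • q, C.smul_mem g hq, hE g p q hpq⟩

/-- This makes the decaying subsets a big family. A hybrid entourage is uniformly small far out, and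
the height is uniformly continuous, so the height of a thickening still tends to `0`. -/
theorem Decays.thicken {C : SubMulAction G D.Winf.coneMinus.carrier} (h : D.Decays C)
    {E : Set (D.Winf.coneMinus.carrier × D.Winf.coneMinus.carrier)}
    (hE : E ∈ D.Winf.coneMinus.entourages) (hinv : IsInvariant G E)
    (Y₀ : SubMulAction G D.Winf.coneMinus.carrier) : D.Decays (thicken hinv C Y₀) := by
  obtain ⟨⟨R, hR⟩, hε⟩ := h
  obtain ⟨⟨r, F, hF, hr⟩, hE'⟩ := hE
  obtain ⟨R', F', -, h'⟩ := D.coarse_coords hF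
  refine ⟨⟨R + R', ?_⟩, fun ε hε₀ => ?_⟩
  · rintro p ⟨-, q, hq, hpq⟩
    have h₁ := (abs_le.1 (h' _ _ (hr _ _ hpq).2).1).2
    linarith [hR q hq]
  · obtain ⟨n, hn⟩ := hε (ε / 2) (half_pos hε₀)
    -- One half of `ε` pays for the height of `q`, the other for the change from `q` to `p`; no
    -- control of the foot is needed.
    obtain ⟨U, hU, hU'⟩ := D.uniform_coords (half_pos hε₀) Filter.univ_mem
    obtain ⟨m, hm⟩ := hE' _ (UnifBornCoarse.rect_mem (Metric.dist_mem_uniformity one_pos) hU)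
    -- Beyond `n + r` the partner `q` is still beyond `n`, where `C` is low; beyond `m` the pair
    -- must lie in the uniform entourage.
    obtain ⟨k, hk⟩ := exists_nat_ge (max (n + r) m)
    refine ⟨k, ?_⟩
    rintro p ⟨-, q, hq, hpq⟩ hp
    have h₁ := (le_max_left _ _).trans hk
    have h₂ := (le_max_right _ _).trans hk
    have h₃ := (abs_le.1 (hr _ _ hpq).1).2
    rcases hm _ _ hpq with h | h
    · exact absurd h.1 (not_le.2 (h₂.trans_lt hp))
    · have h₄ := (abs_lt.1 (hU' _ _ h.2).1).2
      have h₅ := hn q hq (by linarith)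
      linarith

variable (D) in
/-- Excision for decompositions of subspaces of the cone into a part over `W` and the cone over
the end. -/
theorem motivicEquivalence_compare_of_end (S : Square G) (ι : S.X ⟶ D.Winf.coneMinus)
    (hι : BornCoarse.IsEmbedding ι) (A₀ Y₀ : SubMulAction G D.Winf.coneMinus.carrier)
    (hX : ∀ x, BornCoarse.Hom.toFun ι x ∈ Y₀) (hAY : A₀ ≤ Y₀) (hAW : ∀ p ∈ A₀, p.2 ∈ D.W)
    (hfoot : ∀ p ∈ Y₀, D.coneFoot p ∈ A₀) (cover : ∀ p ∈ Y₀, p ∈ D.coneMinf ∨ p ∈ A₀)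
    (hA : BornCoarse.IsRetract (S.a ≫ ι) D.coneMinf)
    (hB : BornCoarse.IsEmbedding (S.b ≫ ι)) (hB₁ : ∀ t, BornCoarse.Hom.toFun (S.b ≫ ι) t ∈ A₀)
    (hB₂ : ∀ z ∈ A₀, ∃ t, BornCoarse.Hom.toFun (S.b ≫ ι) t = z)
    (hK : BornCoarse.IsEmbedding ((S.kA ≫ S.a) ≫ ι))
    (hK₂ : ∀ z ∈ D.coneMinf, ∃ t, BornCoarse.Hom.toFun ((S.kA ≫ S.a) ≫ ι) t = D.coneFoot z) :
    motivicEquivalence G S.compare := by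
  have hkb : ∀ t, BornCoarse.Hom.toFun ((S.kA ≫ S.a) ≫ ι) t =
      BornCoarse.Hom.toFun (S.b ≫ ι) (BornCoarse.Hom.toFun S.kB t) := by
    intro t
    rw [S.comm]
    rfl
  have hfix : ∀ p ∈ A₀, D.coneFoot p = p := fun p hp =>
    Prod.ext rfl (D.foot_of_mem_W (hAW p hp))
  -- Hybrid entourages shrink at arbitrary rates, so the family consists of all invariant decaying
  -- subsets rather than a chosen sequence; finite unions make it directed.
  let I := {C : SubMulAction G D.Winf.coneMinus.carrier // (A₀ ≤ C ∧ C ≤ Y₀) ∧ D.Decays C}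
  have : Nonempty I := ⟨⟨A₀, ⟨le_rfl, hAY⟩, .of_le_W hAW⟩⟩
  have : IsDirectedOrder I := ⟨fun C C' =>
    ⟨⟨C.1 ⊔ C'.1, ⟨C.2.1.1.trans le_sup_left, sup_le C.2.1.2 C'.2.1.2⟩, C.2.2.sup C'.2.2⟩,
      (le_sup_left : C.1 ≤ _), (le_sup_right : C'.1 ≤ _)⟩⟩
  refine S.motivicEquivalence_compare_of_family ι hι (I := I) D.coneMinf (fun C => C.1)
    (fun _ _ h => h) ?_ ⟨⟨A₀, ⟨le_rfl, hAY⟩, .of_le_W hAW⟩, fun x => cover _ (hX x)⟩ hA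
    (fun C => ?_) (fun C => ?_)
  · intro E hE C
    obtain ⟨E', hE', hEE', hinv⟩ := D.Winf.coneMinus.exists_invariant hE
    refine ⟨⟨C.1 ⊔ thicken hinv C.1 Y₀,
      ⟨C.2.1.1.trans le_sup_left, sup_le C.2.1.2 fun p hp => hp.1⟩,
      C.2.2.sup (C.2.2.thicken hE' hinv Y₀)⟩, fun x y hy hxy => Or.inr ?_⟩
    exact ⟨hX x, _, hy, hEE' hxy⟩
  · refine ⟨hB, fun t => C.2.1.1 (hB₁ t), D.coneFoot, fun z hz => hB₂ _ (hfoot z (C.2.1.2 hz)),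
      fun t => hfix _ (hB₁ t), fun g z _ => Prod.ext rfl (D.foot_smul g z.2),
      fun E hE => D.Winf.coneMinus.subset_mem (D.coneFoot_controlled hE) ?_,
      C.2.2.coneFoot_close⟩
    rintro _ ⟨x, _, y, _, hxy, rfl⟩
    exact ⟨x, y, hxy, rfl⟩
  · refine ⟨hK, fun t => ⟨hA.mem _, ?_⟩, D.coneFoot, fun z hz => hK₂ _ hz.1,
      fun t => ?_, fun g z _ => Prod.ext rfl (D.foot_smul g z.2),
      fun E hE => D.Winf.coneMinus.subset_mem (D.coneFoot_controlled hE) ?_,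
      D.Winf.coneMinus.subset_mem C.2.2.coneFoot_close fun p hp => ⟨hp.1.2, hp.2⟩⟩
    · rw [hkb]
      exact C.2.1.1 (hB₁ _)
    · rw [hkb]
      exact hfix _ (hB₁ _)
    · rintro _ ⟨x, _, y, _, hxy, rfl⟩
      exact ⟨x, y, hxy, rfl⟩

variable (D)

theorem mem_range_coneM {z : D.Winf.coneMinus.carrier} (hz : z ∈ D.coneMinf) :
    ∃ t, BornCoarse.Hom.toFun D.coneM t = D.coneFoot z :=
  ⟨(⟨(z.1, (⟨D.foot z.2, D.foot_mem_inf hz.2⟩ :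
    (D.W ⊓ D.Minf : SubMulAction G D.Winf.space.carrier))), hz.1, trivial⟩ :
      D.M.coneStrip (Set.Ici 0) ⊤), rfl⟩

theorem motivicEquivalence_squareY' : motivicEquivalence G D.squareY'.compare := by
  refine Square.motivicEquivalence_compare_of_flip ?_
  refine D.motivicEquivalence_compare_of_end _ (D.Winf.coneMinus.incl D.Y)
    (BornCoarse.isEmbedding_incl _ _) D.lineW D.Y (fun x => x.2) D.lineW_le (fun p hp => hp.2)
    (fun p _ => ⟨trivial, D.foot_mem_W p.2⟩) (fun p hp => ?_)
    (BornCoarse.isRetract_of_range (BornCoarse.isEmbedding_incl _ D.coneMinf) (fun t => t.2)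
      (fun z hz => ⟨⟨z, hz⟩, rfl⟩))
    (BornCoarse.isEmbedding_incl _ D.lineW) (fun t => t.2) (fun z hz => ⟨⟨z, hz⟩, rfl⟩)
    (D.Winf.isEmbedding_coneOfSub _) (fun z hz => D.mem_range_coneM hz)
  -- A point of `Y` which is not over `W` can only lie in `Y₊`, hence in the cone over the end.
  rcases D.mem_W_or p.2 with h | h
  · exact Or.inr ⟨trivial, h⟩
  · rcases hp with hp | hp
    · exact Or.inr ⟨trivial, hp.2⟩
    · exact Or.inl ⟨hp.1, h⟩

theorem motivicEquivalence_squareO : motivicEquivalence G D.squareO.compare := by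
  refine Square.motivicEquivalence_compare_of_flip ?_
  refine D.motivicEquivalence_compare_of_end _ (D.Winf.coneMinus.incl D.Yplus)
    (BornCoarse.isEmbedding_incl _ _) D.coneW D.Yplus (fun x => x.2) D.coneW_le_Yplus
    (fun p hp => hp.2) (fun p hp => ⟨hp.1, D.foot_mem_W p.2⟩)
    (fun p hp => (D.mem_W_or p.2).symm.imp (fun h => ⟨hp.1, h⟩) (fun h => ⟨hp.1, h⟩))
    (BornCoarse.isRetract_of_range (BornCoarse.isEmbedding_incl _ D.coneMinf) (fun t => t.2)
      (fun z hz => ⟨⟨z, hz⟩, rfl⟩))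
    (BornCoarse.isEmbedding_incl _ D.coneW) (fun t => t.2) (fun z hz => ⟨⟨z, hz⟩, rfl⟩)
    (D.Winf.isEmbedding_coneOfSub _) (fun z hz => D.mem_range_coneM hz)

end CylindricalEnd

/-! ### A space with a cylindrical end is motivically empty -/

namespace CylindricalEnd

variable (D : CylindricalEnd G)

/-- The square of the decomposition of `W∞` into `M∞` and `W`. -/
def endSquare : Square G where
  X := D.Winf.space
  kA := D.Winf.space.subFunctor.map (homOfLE (inf_le_right : D.W ⊓ D.Minf ≤ D.Minf))
  kB := D.f
  a := D.Winf.space.incl D.Minf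
  b := D.Winf.space.incl D.W
  comm := rfl

/-- The members `{height ≤ n}` are thickenings of `W` along the cylinder. They form a big family
since the height is controlled, and the foot map retracts them onto `W`. -/
theorem motivicEquivalence_endSquare : motivicEquivalence G D.endSquare.compare := by
  refine D.endSquare.motivicEquivalence_compare_of_family (𝟙 _) (BornCoarse.isEmbedding_id _)
    (I := ULift.{u} ℕ) D.Minf
    (fun n => { carrier := {x | D.height x ≤ n.down}
                smul_mem' := fun g x hx => (D.height_smul g x).trans_le hx })
    ?_ ?_ ?_ (BornCoarse.isRetract_of_range (BornCoarse.isEmbedding_incl _ D.Minf) (fun t => t.2)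
      (fun z hz => ⟨⟨z, hz⟩, rfl⟩)) (fun n => ?_) (fun n => ?_)
  · intro n m hnm x hx
    have : (n.down : ℝ) ≤ m.down := by exact_mod_cast hnm
    exact le_trans (show D.height x ≤ n.down from hx) this
  · intro E hE n
    obtain ⟨R, F, -, hR⟩ := D.coarse_coords hE
    obtain ⟨m, hm⟩ := exists_nat_ge ((n.down : ℝ) + R)
    refine ⟨⟨m⟩, fun x y hy hxy => ?_⟩
    have h₁ := abs_le.1 (hR _ _ hxy).1
    have h₂ : D.height y ≤ n.down := hy
    change D.height x ≤ m
    have h₃ : D.height x - D.height y ≤ R := h₁.2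
    linarith
  · refine ⟨⟨0⟩, fun x => (D.mem_W_or x).symm.imp id fun hx => ?_⟩
    exact (D.height_of_mem_W hx).trans_le (by simp)
  · refine ⟨BornCoarse.isEmbedding_incl _ D.W, fun t => ?_, D.foot,
      fun z _ => ⟨⟨D.foot z, D.foot_mem_W z⟩, rfl⟩, fun t => D.foot_of_mem_W t.2,
      fun g z _ => D.foot_smul g z, fun E hE => ?_,
      D.Winf.space.subset_mem (D.coarse_foot n.down) fun p hp => hp⟩
    · exact (D.height_of_mem_W t.2).trans_le (by simp)
    · obtain ⟨R, F, hF, h⟩ := D.coarse_coords hE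
      refine D.Winf.space.subset_mem hF ?_
      rintro _ ⟨x, _, y, _, hxy, rfl⟩
      exact (h x y hxy).2
  · refine ⟨BornCoarse.isEmbedding_incl _ (D.W ⊓ D.Minf), fun t => ⟨t.2.2, ?_⟩, D.foot,
      fun z hz => ⟨⟨D.foot z, D.foot_mem_inf hz.1⟩, rfl⟩, fun t => D.foot_of_mem_W t.2.1,
      fun g z _ => D.foot_smul g z, fun E hE => ?_,
      D.Winf.space.subset_mem (D.coarse_foot n.down) fun p hp => ⟨hp.1.2, hp.2⟩⟩
    · exact (D.height_of_mem_W t.2.1).trans_le (by simp)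
    · obtain ⟨R, F, hF, h⟩ := D.coarse_coords hE
      refine D.Winf.space.subset_mem hF ?_
      rintro _ ⟨x, _, y, _, hxy, rfl⟩
      exact (h x y hxy).2

/-- The end is isomorphic to `[0,∞) ⊗ M`, which is flasque. Since `M → W` is an equivalence, so is
its push-out `M∞ → W∞`. -/
theorem motivicEquivalence_initial_Winf :
    motivicEquivalence G (initial.to (yo₀.obj D.Winf.space)) := by
  have h₀ : motivicEquivalence G (initial.to (yo₀.obj (D.Winf.space.sub D.Minf))) :=
    BornCoarse.motivicEquivalence_initial_yo_of_isCoarseEquivalence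
      (BornCoarse.isCoarseEquivalence_of_inverse D.cylinder.inv D.cylinder.hom_inv_id
        D.cylinder.inv_hom_id)
      (D.M.motivicEquivalence_initial_strip_Ici ⊤)
  have h₁ := motivicEquivalence_hpushInl (yo₀.map D.endSquare.kA)
    (BornCoarse.motivicEquivalence_yo_of_isCoarseEquivalence D.coarseEquivalence)
  have h₂ := (motivicEquivalence G).comp_mem _ _ h₁ D.motivicEquivalence_endSquare
  have h₃ := (motivicEquivalence G).comp_mem _ _ h₀ h₂
  exact (congrArg (fun f => motivicEquivalence G f) (initialIsInitial.hom_ext _ _)).mp h₃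

end CylindricalEnd

/-! ### Naturality of the Mayer-Vietoris boundary -/

theorem comp_inv_comp_of_comm {C : Type*} [Category* C] {A A' X X' P P' : C} {u : A ⟶ A'}
    {x : X ⟶ X'} {p : A ⟶ P} {p' : A' ⟶ P'} {σ : P ⟶ P'} {a : A ⟶ X} {b : A' ⟶ X'} [IsIso a]
    [IsIso b] (h₁ : u ≫ b = a ≫ x) (h₂ : u ≫ p' = p ≫ σ) :
    x ≫ inv b ≫ p' = (inv a ≫ p) ≫ σ := by
  rw [Category.assoc, ← h₂, IsIso.eq_inv_comp, ← reassoc_of% h₁, IsIso.hom_inv_id_assoc]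

/-- A map of squares. -/
structure Square.Map (S T : Square G) where
  k : S.K ⟶ T.K
  α : S.A ⟶ T.A
  β : S.B ⟶ T.B
  x : S.X ⟶ T.X
  hα : S.kA ≫ α = k ≫ T.kA
  hβ : S.kB ≫ β = k ≫ T.kB
  ha : S.a ≫ x = α ≫ T.a
  hb : S.b ≫ x = β ≫ T.b

namespace Square.Map

variable {S T : Square G} (F : S.Map T)

/-- The induced map on homotopy pushouts. -/
noncomputable def union : S.union ⟶ T.union :=
  hpushMap (yo₀.map F.k) (yo₀.map F.α) (yo₀.map F.β)
    (by rw [← Functor.map_comp, F.hα, Functor.map_comp])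
    (by rw [← Functor.map_comp, F.hβ, Functor.map_comp])

theorem union_compare : F.union ≫ T.compare = S.compare ≫ yo₀.map F.x := by
  have ha := congrArg yo₀.map F.ha
  have hb := congrArg yo₀.map F.hb
  have hS := congrArg yo₀.map S.comm
  rw [Functor.map_comp, Functor.map_comp] at ha hb hS
  unfold union Square.compare
  rw [hpushMap_desc, hpushDesc_comp]
  · congr 1
    · exact ha.symm
    · exact hb.symm
  · rw [reassoc_of% hS]
  · rw [← ha, ← hb, reassoc_of% hS]

theorem union_toSusp :
    F.union ≫ hpushToSusp (yo₀.map T.kA) (yo₀.map T.kB) =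
      hpushToSusp (yo₀.map S.kA) (yo₀.map S.kB) ≫ suspMap (yo₀.map F.k) :=
  hpushMap_toSusp _ _ _ _ _

/-- The boundary inverts the comparison map and then collapses to the suspension; a map of squares
commutes strictly with both. -/
theorem boundary_naturality (hS : S.IsExcisive) (hT : T.IsExcisive) :
    Yo.map F.x ≫ T.boundary hT = S.boundary hS ≫ suspYoMap F.k := by
  have h₁ := congrArg motive.map F.union_compare
  have h₂ := congrArg motive.map F.union_toSusp
  rw [Functor.map_comp, Functor.map_comp] at h₁ h₂
  exact @comp_inv_comp_of_comm _ _ _ _ _ _ _ _ _ _ _ _ _ _ _ hS hT h₁ h₂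

end Square.Map

theorem suspYoMap_id (X : BornCoarse G) : suspYoMap (𝟙 X) = 𝟙 _ := by
  have : suspMap (yo₀.map (𝟙 X)) = 𝟙 _ := by
    unfold suspMap
    apply hpush_hom_ext <;> simp [cylMap_id]
  rw [suspYoMap, this]
  exact motive.map_id _

/-! ### The germs at infinity and the suspension -/

section

variable {K A B C K' A' : Diag G}

/-- The mirror image of `motivicEquivalence_hpushInl`, obtained from the mapping cylinder of `g`
through the symmetry of homotopy pushouts. -/
theorem motivicEquivalence_hpushInr {f : K ⟶ A} (hf : motivicEquivalence G f) (g : K ⟶ B) :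
    motivicEquivalence G (hpushInr f g) := by
  have h₁ : motivicEquivalence G (hpushInr (𝟙 K) g) := by
    refine (motivicEquivalence G).of_postcomp _ _
      (motivicEquivalence_hpushDesc_symm (motivicEquivalence_mappingCylinder g)) ?_
    rw [hpushInr_desc]
    exact MorphismProperty.id_mem _ _
  have h₂ : motivicEquivalence G (hpushMap (f := 𝟙 K) (g := g) (f' := f) (g' := g) (𝟙 K) f (𝟙 B)
      rfl ((Category.comp_id g).trans (Category.id_comp g).symm)) :=
    motivicEquivalence_hpushMap _ _ (MorphismProperty.id_mem _ _) hf (MorphismProperty.id_mem _ _)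
  have h₃ := (motivicEquivalence G).comp_mem _ _ h₁ h₂
  rwa [hpushInr_map, Category.id_comp] at h₃

/-! ### Gluing lemmas for the splitting of the motive of `Y` -/

theorem motivicEquivalence_coprodInl (h : motivicEquivalence G (initial.to B)) :
    motivicEquivalence G (coprod.inl : A ⟶ A ⨿ B) := by
  have h₁ := motivicEquivalence_hpushInl (initial.to A) h
  refine (motivicEquivalence G).of_postcomp _ _
    (motivicEquivalence_of_isIso (coprodToHpush (initial.to A) (initial.to B))) ?_
  rwa [coprodToHpush, coprod.inl_desc]

/-- Gluing a homotopy pushout of `A ← K → B` to a coproduct summand. -/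
noncomputable def coprodHpush (f : K ⟶ A) (g : K ⟶ B) (C : Diag G) :
    C ⨿ hpush f g ⟶ hpush f (g ≫ (coprod.inr : B ⟶ C ⨿ B)) :=
  coprod.desc (coprod.inl ≫ hpushInr _ _) (hpushMap (𝟙 K) (𝟙 A) coprod.inr
    ((Category.comp_id f).trans (Category.id_comp f).symm) (Category.id_comp _).symm)

/-- The gluing takes place inside the summand `B` of `C ⨿ B` and does not touch `C`, so this holds
strictly. -/
instance (f : K ⟶ A) (g : K ⟶ B) (C : Diag G) : IsIso (coprodHpush f g C) := by
  refine ⟨hpushLift _ _ (hpushInl f g ≫ coprod.inr) (coprod.map (𝟙 C) (hpushInr f g))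
    (hpushCyl f g ≫ coprod.inr) ?_ ?_, ?_, ?_⟩
  · rw [← Category.assoc, cylInl_hpushCyl, Category.assoc]
  · rw [← Category.assoc, cylInr_hpushCyl, Category.assoc, Category.assoc, coprod.inr_map]
  · unfold coprodHpush
    apply coprod.hom_ext
    · rw [coprod.inl_desc_assoc, Category.assoc, hpushInr_lift, coprod.inl_map, Category.id_comp,
        Category.comp_id]
    · rw [coprod.inr_desc_assoc, Category.comp_id]
      apply hpush_hom_ext <;> simp [cylMap_id]
  · unfold coprodHpush
    apply hpush_hom_ext
    · rw [hpushInl_lift_assoc, Category.assoc, coprod.inr_desc, hpushInl_map, Category.id_comp,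
        Category.comp_id]
    · rw [hpushInr_lift_assoc, Category.comp_id]
      apply coprod.hom_ext
      · rw [coprod.inl_map_assoc, Category.id_comp, coprod.inl_desc]
      · rw [coprod.inr_map_assoc, coprod.inr_desc, hpushInr_map]
    · rw [hpushCyl_lift_assoc, Category.assoc, coprod.inr_desc, hpushCyl_map, cylMap_id,
        Category.id_comp, Category.comp_id]

/-- The source is the gluing of `A` to `C ⨿ B` along `K`. Discarding the motivically empty `B` and
replacing `K` and `A` by equivalent objects gives the target. This is the splitting in abstract
form. -/
theorem motivicEquivalence_coprod_hpush {f : K ⟶ A} {g : K ⟶ B} {f' : K' ⟶ A'} {g' : K' ⟶ C}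
    {κ : K ⟶ K'} {α : A ⟶ A'} {β : B ⟶ C} (hα : f ≫ α = κ ≫ f') (hβ : g ≫ β = κ ≫ g')
    (h₁ : motivicEquivalence G κ) (h₂ : motivicEquivalence G α)
    (hB : motivicEquivalence G (initial.to B)) :
    motivicEquivalence G (coprod.desc (hpushInr f' g') (hpushMap κ α β hα hβ)) := by
  have h₃ : motivicEquivalence G (coprod.desc (𝟙 C) β) := by
    refine (motivicEquivalence G).of_precomp _ _ (motivicEquivalence_coprodInl hB) ?_
    rw [coprod.inl_desc]
    exact MorphismProperty.id_mem _ _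
  have hβ' : (g ≫ (coprod.inr : B ⟶ C ⨿ B)) ≫ coprod.desc (𝟙 C) β = κ ≫ g' := by
    rw [Category.assoc, coprod.inr_desc, hβ]
  have h₄ := (motivicEquivalence G).comp_mem _ _ (motivicEquivalence_of_isIso (coprodHpush f g C))
    (motivicEquivalence_hpushMap hα hβ' h₁ h₂ h₃)
  have e : coprodHpush f g C ≫ hpushMap κ α (coprod.desc (𝟙 C) β) hα hβ' =
      coprod.desc (hpushInr f' g') (hpushMap κ α β hα hβ) := by
    unfold coprodHpush
    apply coprod.hom_ext
    · rw [coprod.inl_desc_assoc, Category.assoc, hpushInr_map, coprod.inl_desc_assoc,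
        coprod.inl_desc, Category.id_comp]
    · rw [coprod.inr_desc_assoc, coprod.inr_desc]
      apply hpush_hom_ext
      · simp
      · rw [hpushInr_map_assoc, hpushInr_map, coprod.inr_desc_assoc, hpushInr_map]
      · simp [cylMap_id]
  rwa [e] at h₄

theorem motivicEquivalence_coprodDesc_of_comp {B' P X : Diag G} {a : A ⟶ X} {b : B ⟶ X}
    {p : A ⟶ P} {q : B' ⟶ P} {x : P ⟶ X} {y : B' ⟶ B} (h : motivicEquivalence G (coprod.desc p q))
    (hx : motivicEquivalence G x) (hy : motivicEquivalence G y) (hp : p ≫ x = a)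
    (hq : q ≫ x = y ≫ b) : motivicEquivalence G (coprod.desc a b) := by
  refine (motivicEquivalence G).of_precomp _ _
    (motivicEquivalence_coprodMap (MorphismProperty.id_mem _ A) hy) ?_
  have e : coprod.map (𝟙 A) y ≫ coprod.desc a b = coprod.desc p q ≫ x := by
    rw [coprod.map_desc, coprod.desc_comp, hp, hq, Category.id_comp]
  rw [e]
  exact (motivicEquivalence G).comp_mem _ _ h hx

end

theorem comp_inv_comp_eq {C : Type*} [Category* C] {X Y Z T : C} {u : X ⟶ Y} {e : Y ⟶ Z} [IsIso e]
    {p : X ⟶ Z} {k : Y ⟶ T} {q : X ⟶ T} (h₁ : u ≫ e = p) (h₂ : u ≫ k = q) :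
    p ≫ inv e ≫ k = q := by
  rw [← h₁, Category.assoc, IsIso.hom_inv_id_assoc, h₂]

theorem inv_comp_comp_eq {C : Type*} [Category* C] {X Y Z T : C} {e : X ⟶ Y} [IsIso e]
    {y : X ⟶ Z} {b : Z ⟶ T} {k : Y ⟶ T} (h : y ≫ b = e ≫ k) : (inv e ≫ y) ≫ b = k := by
  rw [Category.assoc, h, IsIso.inv_hom_id_assoc]

namespace UnifBornCoarse

variable (X : UnifBornCoarse G)

/-- Both half-lines are flasque, so collapsing them to points is an equivalence. -/
theorem isIso_suspension (h : X.lineSquare.IsExcisive) : IsIso (X.suspension h) := by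
  have h₁ : IsIso (motive.map (hpushToSusp (yo₀.map X.lineSquare.kA) (yo₀.map X.lineSquare.kB))) :=
    isIso_motive_map (motivicEquivalence_hpushMap _ _ (MorphismProperty.id_mem _ _)
      (motivicEquivalence_terminal_from (X.motivicEquivalence_initial_strip_Iic ⊤))
      (motivicEquivalence_terminal_from (X.motivicEquivalence_initial_strip_Ici ⊤)))
  exact IsIso.comp_isIso' (@IsIso.inv_isIso _ _ _ _ _ h) h₁

theorem isIso_unionToGerms : IsIso X.unionToGerms :=
  isIso_motive_map (motivicEquivalence_hpushMap _ _ (MorphismProperty.id_mem _ _)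
    (motivicEquivalence_terminal_from (X.motivicEquivalence_initial_coneStrip_Iic ⊤))
    (MorphismProperty.id_mem _ _))

theorem isIso_c (h : IsIso X.unionToGerms) : IsIso (X.c h) := by
  have h₂ : IsIso (motive.map X.coneSquare.compare) :=
    isIso_motive_map X.motivicEquivalence_coneSquare
  exact IsIso.comp_isIso' (IsIso.inv_isIso) h₂

/-- When the motive of `X` vanishes, forming the cofibre glues along an equivalence `Yoˢ(X) → 0` and
changes nothing. -/
theorem isIso_coneToGerms (h : motivicEquivalence G (initial.to (yo₀.obj X.space))) :
    IsIso X.coneToGerms :=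
  isIso_motive_map (motivicEquivalence_hpushInr (motivicEquivalence_terminal_from h) _)

/-- Both maps come from the inclusion of `𝒪(X)` into the homotopy pushout over `(-∞,0] × X`. -/
theorem coneToGerms_c (h : IsIso X.unionToGerms) :
    X.coneToGerms ≫ X.c h = Yo.map (X.coneMinus.incl (X.coneStrip (Set.Ici 0) ⊤)) := by
  have h₁ : motive.map (hpushInr (yo₀.map X.coneSquare.kA) (yo₀.map X.coneSquare.kB)) ≫
      X.unionToGerms = X.coneToGerms :=
    (motive.map_comp _ _).symm.trans
      (congrArg motive.map ((hpushInr_map _ _ _ _ _).trans (Category.id_comp _)))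
  have h₂ : motive.map (hpushInr (yo₀.map X.coneSquare.kA) (yo₀.map X.coneSquare.kB)) ≫
      motive.map X.coneSquare.compare =
        Yo.map (X.coneMinus.incl (X.coneStrip (Set.Ici 0) ⊤)) :=
    (motive.map_comp _ _).symm.trans (congrArg motive.map (hpushInr_desc _ _ _ _ _))
  exact comp_inv_comp_eq h₁ h₂

end UnifBornCoarse

theorem isIso_suspYoMap {X Y : BornCoarse G} {f : X ⟶ Y} (h : BornCoarse.IsCoarseEquivalence f) :
    IsIso (suspYoMap f) :=
  isIso_motive_map (motivicEquivalence_hpushMap _ _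
    (BornCoarse.motivicEquivalence_yo_of_isCoarseEquivalence h) (MorphismProperty.id_mem _ _)
    (MorphismProperty.id_mem _ _))

/-! ### Maps between the Mayer-Vietoris squares -/

namespace CylindricalEnd

variable (D : CylindricalEnd G)

/-- The inclusion of the decomposition of the cone into that of `Y`. -/
def squareOToY' : D.squareO.Map D.squareY' where
  k := 𝟙 _
  α := D.Winf.coneMinus.subFunctor.map
    (homOfLE (show D.coneW ≤ D.lineW from fun _ hp => ⟨trivial, hp.2⟩))
  β := 𝟙 _
  x := D.Winf.coneMinus.subFunctor.map (homOfLE (le_sup_right : D.Yplus ≤ D.Y))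
  hα := rfl
  hβ := rfl
  ha := rfl
  hb := rfl

theorem onCylinder_of_nonpos {p : D.M.line.space.carrier} (h : p.1 ≤ 0) :
    D.onCylinder p = p.2.1 := by
  have hp : D.toRay p = ⟨(0, p.2), ⟨le_refl (0 : ℝ), trivial⟩⟩ :=
    Subtype.ext (Prod.ext (max_eq_right h) rfl)
  unfold onCylinder
  rw [hp]
  exact D.cylinder_zero p.2

theorem onCylinder_mem (p : D.M.line.space.carrier) : D.onCylinder p ∈ D.Minf :=
  (BornCoarse.Hom.toFun D.cylinder.hom (D.toRay p) : D.Minf).2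

/-- The map `jTilde` with values in `𝒪(W∞)₋`, on a half-line. -/
noncomputable def jStrip (T : Set ℝ) : D.M.line.space.sub (D.M.strip T ⊤) ⟶ D.Winf.coneMinus :=
  D.M.line.space.incl _ ≫ D.jTilde ≫ D.Winf.coneMinus.incl D.Y

/-- At `t = 0` both formulas defining `jTilde` give `(0, m)`; this is the compatibility of its
restrictions on intersections. -/
theorem zero_jStrip (T : Set ℝ) (h : (0 : ℝ) ∈ T) :
    BornCoarse.codRestrict D.M.zeroLine (D.M.strip T ⊤) (fun _ => ⟨h, trivial⟩) ≫ D.jStrip T =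
      D.Winf.space.incl (D.W ⊓ D.Minf) ≫ D.Winf.zeroConeMinus :=
  BornCoarse.hom_ext fun m => Prod.ext (min_self (0 : ℝ))
    (D.onCylinder_of_nonpos (p := (0, m)) le_rfl)

theorem onCylinder_mem_W (p : D.M.strip (Set.Iic 0) ⊤) : D.onCylinder p.1 ∈ D.W := by
  rw [D.onCylinder_of_nonpos p.2.1]
  exact (Subtype.prop p.1.2).1

/-- The map `jTilde` as a map from the decomposition of `ℝ ⊗ M` to the decomposition `(Y₋, Y₊)`. -/
noncomputable def lineToY : D.M.lineSquare.Map D.squareY where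
  k := D.f
  α := BornCoarse.codRestrict (D.jStrip (Set.Iic 0)) D.Yminus
    (fun p => ⟨min_le_right p.1.1 0, D.onCylinder_mem_W p⟩)
  β := BornCoarse.codRestrict (D.jStrip (Set.Ici 0)) D.Yplus
    (fun p => ⟨show (0 : ℝ) ≤ min p.1.1 0 from le_min p.2.1 le_rfl, trivial⟩)
  x := D.jTilde
  hα := BornCoarse.comp_incl_injective (D.zero_jStrip _ (le_refl (0 : ℝ)))
  hβ := BornCoarse.comp_incl_injective (D.zero_jStrip _ (le_refl (0 : ℝ)))
  ha := rfl
  hb := rfl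

/-- The map `jTilde` as a map from the decomposition of `ℝ ⊗ M` to the decomposition
`(ℝ × W, [0,∞) × M∞)`. -/
noncomputable def lineToY' : D.M.lineSquare.Map D.squareY' where
  k := D.M.toCone
  α := BornCoarse.codRestrict (D.jStrip (Set.Iic 0)) D.lineW
    (fun p => ⟨trivial, D.onCylinder_mem_W p⟩)
  β := BornCoarse.codRestrict (D.jStrip (Set.Ici 0)) D.coneMinf
    (fun p => ⟨show (0 : ℝ) ≤ min p.1.1 0 from le_min p.2.1 le_rfl, D.onCylinder_mem p.1⟩)
  x := D.jTilde
  hα := BornCoarse.comp_incl_injective (D.zero_jStrip _ (le_refl (0 : ℝ)))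
  hβ := BornCoarse.comp_incl_injective (D.zero_jStrip _ (le_refl (0 : ℝ)))
  ha := rfl
  hb := rfl

/-! ### Commutativity of the diagram and the splitting -/

theorem j_boundary (hLine : D.M.lineSquare.IsExcisive) (hSusp : IsIso (D.M.suspension hLine))
    (hY : D.squareY.IsExcisive) : D.j hLine hSusp ≫ D.boundary hY = suspYoMap D.f :=
  inv_comp_comp_eq (D.lineToY.boundary_naturality hLine hY)

theorem j_boundary' (hLine : D.M.lineSquare.IsExcisive) (hSusp : IsIso (D.M.suspension hLine))
    (hY' : D.squareY'.IsExcisive) : D.j hLine hSusp ≫ D.boundary' hY' = suspYoMap D.M.toCone :=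
  inv_comp_comp_eq (D.lineToY'.boundary_naturality hLine hY')

theorem s_boundary' (hY' : D.squareY'.IsExcisive) (hO : D.squareO.IsExcisive) :
    D.s ≫ D.boundary' hY' = D.boundary'' hO :=
  (D.squareOToY'.boundary_naturality hO hY').trans
    ((congrArg (D.boundary'' hO ≫ ·) (suspYoMap_id _)).trans (Category.comp_id _))

theorem s_i (hGerms : IsIso D.Winf.unionToGerms) (hc : IsIso (D.Winf.c hGerms)) :
    D.s ≫ D.i hGerms hc = D.Winf.coneToGerms := by
  have h : D.s ≫ Yo.map (D.Winf.coneMinus.incl D.Y) =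
      Yo.map (D.Winf.coneMinus.incl D.Yplus) := (Yo.map_comp _ _).symm
  exact (Category.assoc _ _ _).symm.trans ((congrArg (· ≫ _) h).trans
    ((IsIso.comp_inv_eq _).2 (D.Winf.coneToGerms_c hGerms).symm))

/-- The gluing lemma is applied with `Y₊` as the extra summand and `[0,∞) × M` as the discarded
half. The map `(-∞,0] × M → Y₋` is an equivalence because both motives are empty. The two comparison
maps then carry the result to `ℝ ⊗ M` and `Y`. -/
theorem motivicEquivalence_coprod_jTilde :
    motivicEquivalence G (coprod.desc
      (yo₀.map (D.Winf.coneMinus.subFunctor.map (homOfLE (le_sup_right : D.Yplus ≤ D.Y))))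
      (yo₀.map D.jTilde)) := by
  have h := motivicEquivalence_coprod_hpush (f := yo₀.map D.M.lineSquare.kA)
    (g := yo₀.map D.M.lineSquare.kB) (f' := yo₀.map D.squareY.kA) (g' := yo₀.map D.squareY.kB)
    (κ := yo₀.map D.lineToY.k) (α := yo₀.map D.lineToY.α) (β := yo₀.map D.lineToY.β)
    (by rw [← Functor.map_comp, D.lineToY.hα, Functor.map_comp])
    (by rw [← Functor.map_comp, D.lineToY.hβ, Functor.map_comp])
    (BornCoarse.motivicEquivalence_yo_of_isCoarseEquivalence D.coarseEquivalence)
    (motivicEquivalence_of_initial _ (D.M.motivicEquivalence_initial_strip_Iic ⊤)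
      (D.Winf.motivicEquivalence_initial_coneStrip_Iic D.W))
    (D.M.motivicEquivalence_initial_strip_Ici ⊤)
  exact motivicEquivalence_coprodDesc_of_comp h D.motivicEquivalence_squareY
    D.M.motivicEquivalence_lineSquare (hpushInr_desc _ _ _ _ _) D.lineToY.union_compare

theorem nonempty_isColimit_s_j (hLine : D.M.lineSquare.IsExcisive)
    (hSusp : IsIso (D.M.suspension hLine)) :
    Nonempty (IsColimit (BinaryCofan.mk D.s (D.j hLine hSusp))) := by
  obtain ⟨h⟩ := nonempty_isColimit_motive _ _ D.motivicEquivalence_coprod_jTilde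
  -- The summand `ℝ ⊗ M` is exchanged for `Σ Yoˢ(M)` along the suspension equivalence.
  exact ⟨BinaryCofan.isColimitCompRightIso _ (inv (D.M.suspension hLine)) h⟩

end CylindricalEnd

end CoarseMotives

theorem mainTheorem5 {G : Type u} [Group G] (D : CoarseMotives.CylindricalEnd G) :
    ∃ (hLine : D.M.lineSquare.IsExcisive)
      (hSusp : IsIso (D.M.suspension hLine))
      (hGerms : IsIso D.Winf.unionToGerms)
      (hc : IsIso (D.Winf.c hGerms))
      (hY : D.squareY.IsExcisive)
      (hY' : D.squareY'.IsExcisive)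
      (hO : D.squareO.IsExcisive),
      IsIso D.Winf.coneToGerms ∧
      IsIso (CoarseMotives.suspYoMap D.f) ∧
      D.s ≫ D.i hGerms hc = D.Winf.coneToGerms ∧
      D.s ≫ D.boundary' hY' = D.boundary'' hO ∧
      D.j hLine hSusp ≫ D.boundary hY = CoarseMotives.suspYoMap D.f ∧
      D.j hLine hSusp ≫ D.boundary' hY' = CoarseMotives.suspYoMap D.M.toCone ∧
      Nonempty (IsColimit (BinaryCofan.mk D.s (D.j hLine hSusp))) := by
  have hLine := CoarseMotives.isIso_motive_map D.M.motivicEquivalence_lineSquare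
  have hSusp := D.M.isIso_suspension hLine
  have hGerms := D.Winf.isIso_unionToGerms
  have hY := CoarseMotives.isIso_motive_map D.motivicEquivalence_squareY
  have hY' := CoarseMotives.isIso_motive_map D.motivicEquivalence_squareY'
  have hO := CoarseMotives.isIso_motive_map D.motivicEquivalence_squareO
  exact ⟨hLine, hSusp, hGerms, D.Winf.isIso_c hGerms, hY, hY', hO,
    D.Winf.isIso_coneToGerms D.motivicEquivalence_initial_Winf,
    CoarseMotives.isIso_suspYoMap D.coarseEquivalence, D.s_i hGerms _, D.s_boundary' hY' hO,
    D.j_boundary hLine hSusp hY, D.j_boundary' hLine hSusp hY',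
    D.nonempty_isColimit_s_j hLine hSusp⟩
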